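/- Let $\lambda=e^{2\pi i\theta}$, where $\theta\in\mathbb R\setminus\mathbb Q$ is Diophantine, i.e. there are $c,r>0$ with $|\lambda^n-1|\ge c\,n^{-r}$ for all $n\ge 1$. Let $F$ be a holomorphic automorphism of $\mathbb C^2$ of the form $$F(z,w)=\bigl(z+f(w)z^2+O(z^3),\ \lambda w+g(w)z+O(z^2)\bigr),$$ with $f,g$ entire, $f(0)\ne0$ and $g(w)=O(w^2)$; the remainders are $z^3$, respectively $z^2$, times entire functions of $(z,w)$. **Notation.** Write $f(w)/f(0)=1+\sum_{\ell\ge1}d_\ell w^\ell$, $g(w)/f(0)=\sum_{\ell\ge2}b_\ell w^\ell$, $q(w)=\sum_{\ell\ge1}\frac{d_\ell}{\lambda^\ell-1}w^\ell$. For $C>1$ and $r>0$ put $\gamma(\delta)=C\sum_{\ell\ge1}|d_\ell|\ell^r\delta^\ell$; call $(C,r)$ admissible if $r$ is an exponent in the Diophantine condition and $|q(w)|\le\gamma(|w|)$ for all $w$. For $R,\delta>0$ let $$K_{R,\delta}=\overline{\{u\in\mathbb C:\ \mathrm{Re}\,u>-\gamma(\delta),\ \arg(u-R)\in[-\tfrac{3\pi}4,\tfrac{3\pi}4]\}},\qquad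 U_{R,\delta}=\{(u,w):u\in K_{R,\delta},\ |w|<\delta\},$$ $\Theta(u,w)=\bigl(-\tfrac1{f(0)u},w\bigr)$ and $V_{R,\delta}=\Theta(U_{R,\delta})$. Further let $$\Phi(u,w)=\Bigl(u,\ w+\lambda^{-1}\sum_{\ell\ge2}b_\ell w^\ell\sum_{k\ge0}\frac{\lambda^{(\ell-1)k}}{u+k}\Bigr),\qquad \Psi(u,w)=(u+q(w),w),$$ the series in $k$ being the limits of their partial sums. Let $h$ be the function in the expansion $\Psi^{-1}\Phi^{-1}\Theta^{-1}F\,\Theta\,\Phi\,\Psi(u,w)=\bigl(u+1+\frac{h(w)}u,\lambda w\bigr)+O(u^{-2})$, where, for $|w|<\delta$ and $u\in K_{R,\delta}$ with $R$ large, $\Phi^{-1}$ is the inverse of $\Phi$ on a region $|w|<\delta'$ with fixed $\delta'>\delta$. Put $A=h(0)$, $\tau(u,w)=\bigl(u-\sum_{k\ge0}\frac{h(\lambda^kw)-A}{u+k},w\bigr)$, $T=\Theta\circ\Phi\circ\Psi\circ\tau$, $H=T^{-1}\circ F\circ T$ with the inverse of $T|_{U_{R,\delta}}$, and $$Q_n(u,w)=(u-n-A\log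 n,\ \lambda^{-n}w),\qquad \varphi_n=Q_n\circ H^n,\qquad \chi(u,w)=(u+1,\lambda w).$$ **Statement.** There are an invariant non-recurrent Fatou component $\Omega$ of $F$ (that is, $F(\Omega)=\Omega$ and every orbit in $\Omega$ eventually leaves every compact subset of $\Omega$), whose $\omega$-limit set (the set of accumulation points of the orbits of its points) is $\{0\}\times\mathbb C\subset\partial\Omega$, and a univalent map $\mathcal Q:\Omega\to\mathbb C^2$ with $$\mathcal Q\circ F=\chi\circ\mathcal Q\quad\text{on }\Omega,\qquad \mathcal Q(\Omega)=\mathbb C^2,$$ and $\mathcal Q$ is a biholomorphism onto $\mathbb C^2$; in particular $\Omega$ is biholomorphic to $\mathbb C^2$. Moreover, for every admissible $(C,r)$ there is a function $R_0:(0,\infty)\to(0,\infty)$ such that: 1. For all nondecreasing sequences $\delta_m\to\infty$ of positive numbers and $R_m\ge R_0(\delta_m)$, the absorbing set $\mathcal V=\bigcup_{n\ge0}\bigcup_{m\ge0}F^{\circ n}(V_{R_m,\delta_m/4})$ is contained in $\Omega$, and $\Omega=\bigcup_{n\ge0}(F^{-1})^{\circ n}(\mathcal V)$. 2. For all $\delta>0$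 and $R\ge R_0(\delta)$, the map $T$ is injective on $U_{R,\delta}$; $T(U_{R,\delta/4})\subset\Omega$; $F^{\circ n}(T(U_{R,\delta/4}))\subset T(U_{R,\delta})$ for all $n$, so that all $H^n$ are well defined on $U_{R,\delta/4}$; and $\varphi_n\to\mathcal Q\circ T$ uniformly on compact subsets of $U_{R,\delta/4}$. 3. For every $p\in\Omega$ there is $\delta>0$ such that for every $R\ge R_0(\delta)$ some $F^{\circ n}(p)$ lies in $T(U_{R,\delta/4})$; writing $F^{\circ n}(p)=T(x)$ with $x\in U_{R,\delta/4}$, one has $\mathcal Q(p)=\chi^{-n}(\lim_k\varphi_k(x))$. -/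

import Mathlib

open Set Filter Topology

noncomputable section

namespace ParabolicCylinder

/-! ### Holomorphic maps, Fatou components -/

/-- `Q` is a biholomorphism of `Ω` onto `W`: holomorphic, with a holomorphic inverse `W → Ω`. -/
def IsBiholomorphism (Q : ℂ × ℂ → ℂ × ℂ) (Ω W : Set (ℂ × ℂ)) : Prop :=
  DifferentiableOn ℂ Q Ω ∧ MapsTo Q Ω W ∧
    ∃ P : ℂ × ℂ → ℂ × ℂ, DifferentiableOn ℂ P W ∧ MapsTo P W Ω ∧ InvOn P Q Ω W

/-- A holomorphic automorphism of `ℂ²`. -/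
def IsAutomorphism (F : ℂ × ℂ → ℂ × ℂ) : Prop := IsBiholomorphism F univ univ

/-- A univalent map on `Ω`: holomorphic and injective. -/
def IsUnivalentOn (Q : ℂ × ℂ → ℂ × ℂ) (Ω : Set (ℂ × ℂ)) : Prop :=
  DifferentiableOn ℂ Q Ω ∧ InjOn Q Ω

/-- The maps `s k` diverge to infinity, uniformly on compact subsets of `W`. -/
def CompactlyDivergesOn (s : ℕ → ℂ × ℂ → ℂ × ℂ) (W : Set (ℂ × ℂ)) : Prop :=
  ∀ A ⊆ W, IsCompact A → ∀ B : Set (ℂ × ℂ), IsCompact B →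
    ∀ᶠ k in atTop, Disjoint (s k '' A) B

/-- The iterates of `F` form a normal family on `W`: every sequence of iterates has a subsequence
that converges locally uniformly on `W` or that diverges compactly to infinity. -/
def IterNormalOn (F : ℂ × ℂ → ℂ × ℂ) (W : Set (ℂ × ℂ)) : Prop :=
  ∀ s : ℕ → ℕ, ∃ σ : ℕ → ℕ, StrictMono σ ∧
    ((∃ G : ℂ × ℂ → ℂ × ℂ, TendstoLocallyUniformlyOn (fun k => F^[s (σ k)]) G atTop W) ∨
      CompactlyDivergesOn (fun k => F^[s (σ k)]) W)

/-- The Fatou set of `F`. -/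
def fatouSet (F : ℂ × ℂ → ℂ × ℂ) : Set (ℂ × ℂ) :=
  {p | ∃ W : Set (ℂ × ℂ), IsOpen W ∧ p ∈ W ∧ IterNormalOn F W}

/-- `Ω` is a Fatou component of `F`: a connected component of the Fatou set. -/
def IsFatouComponent (F : ℂ × ℂ → ℂ × ℂ) (Ω : Set (ℂ × ℂ)) : Prop :=
  ∃ p ∈ fatouSet F, Ω = connectedComponentIn (fatouSet F) p

/-- Every orbit in `Ω` eventually leaves every compact subset of `Ω`. -/
def IsNonRecurrent (F : ℂ × ℂ → ℂ × ℂ) (Ω : Set (ℂ × ℂ)) : Prop :=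
  ∀ p ∈ Ω, ∀ A ⊆ Ω, IsCompact A → ∀ᶠ n in atTop, F^[n] p ∉ A

/-- The ω-limit set of `F` on `Ω`: all accumulation points of the orbits of points of `Ω`. -/
def omegaLimitSet (F : ℂ × ℂ → ℂ × ℂ) (Ω : Set (ℂ × ℂ)) : Set (ℂ × ℂ) :=
  {q | ∃ p ∈ Ω, MapClusterPt q atTop (fun n : ℕ => F^[n] p)}

/-- The `w`-axis `{0} × ℂ`. -/
def wAxis : Set (ℂ × ℂ) := {p | p.1 = 0}

/-! ### The class of automorphisms -/

/-- The multiplier `λ = exp(2πiθ)`. -/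
def lam (θ : ℝ) : ℂ := Complex.exp (2 * Real.pi * Complex.I * θ)

/-- `|λⁿ - 1| ≥ c n⁻ʳ` for all `n ≥ 1`, for some `c > 0`. -/
def HasDiophantineExponent (θ r : ℝ) : Prop :=
  ∃ c : ℝ, 0 < c ∧ ∀ n : ℕ, 1 ≤ n → c * (n : ℝ) ^ (-r) ≤ ‖lam θ ^ n - 1‖

/-- `θ` is irrational and Diophantine. -/
def IsDiophantine (θ : ℝ) : Prop :=
  Irrational θ ∧ ∃ r : ℝ, 0 < r ∧ HasDiophantineExponent θ r

/-- `F(z,w) = (z + f(w) z² + O(z³), λ w + g(w) z + O(z²))` with `f`, `g` entire, `f(0) ≠ 0` and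
`g(w) = O(w²)`. As `F` is entire, the remainders are `z³`, resp. `z²`, times entire functions. -/
def HasForm (θ : ℝ) (f g : ℂ → ℂ) (F : ℂ × ℂ → ℂ × ℂ) : Prop :=
  Differentiable ℂ f ∧ Differentiable ℂ g ∧ f 0 ≠ 0 ∧ g 0 = 0 ∧ deriv g 0 = 0 ∧
    ∃ a b : ℂ × ℂ → ℂ, Differentiable ℂ a ∧ Differentiable ℂ b ∧
      ∀ z w : ℂ, F (z, w) =
        (z + f w * z ^ 2 + z ^ 3 * a (z, w), lam θ * w + g w * z + z ^ 2 * b (z, w))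

/-! ### The regions

The normalisation `f(0) = 1` is achieved by the dilatation `(z,w) ↦ (f(0) z, w)`. It is built into
the definitions below: the coordinate at infinity is `u = -1/(f(0) z)`, and the Taylor coefficients
are those of `f / f(0)` and `g / f(0)`. For `f(0) = 1` nothing changes. -/

/-- Taylor coefficients at `0` of `k / f(0)`. -/
def coeff (f k : ℂ → ℂ) (l : ℕ) : ℂ := iteratedDeriv l k 0 / (l.factorial : ℂ) / f 0

/-- `γ(δ) = C ∑_{l ≥ 1} |d_l| lʳ δˡ`, where `f / f(0) = 1 + ∑_{l ≥ 1} d_l wˡ`. -/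
def gam (f : ℂ → ℂ) (C r δ : ℝ) : ℝ :=
  C * ∑' l : ℕ, ‖coeff f f (l + 1)‖ * ((l + 1 : ℕ) : ℝ) ^ r * δ ^ (l + 1)

/-- `K_{R,δ}`, the closure of `{Re u > -γ(δ), arg (u - R) ∈ [-3π/4, 3π/4]}`. -/
def K (γ : ℝ → ℝ) (R δ : ℝ) : Set ℂ :=
  closure {u : ℂ | -γ δ < u.re ∧
    (u - (R : ℂ)).arg ∈ Icc (-(3 * Real.pi / 4)) (3 * Real.pi / 4)}

/-- `U_{R,δ} = K_{R,δ} × {|w| < δ}`. -/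
def U (γ : ℝ → ℝ) (R δ : ℝ) : Set (ℂ × ℂ) := {p | p.1 ∈ K γ R δ ∧ ‖p.2‖ < δ}

/-- `Θ(u,w) = (-1/u, w)`, up to the normalising dilatation. -/
def Theta (f : ℂ → ℂ) (p : ℂ × ℂ) : ℂ × ℂ := (-1 / (f 0 * p.1), p.2)

/-- The inverse of `Θ` on `ℂ* × ℂ`; it is given by the same formula. -/
def ThetaInv (f : ℂ → ℂ) (p : ℂ × ℂ) : ℂ × ℂ := (-1 / (f 0 * p.1), p.2)

/-- `V_{R,δ} = Θ(U_{R,δ})`. -/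
def V (f : ℂ → ℂ) (γ : ℝ → ℝ) (R δ : ℝ) : Set (ℂ × ℂ) := Theta f '' U γ R δ

/-- The absorbing set `⋃_n ⋃_m Fⁿ(V_{R_m, δ_m/4})`. -/
def absorbingSet (f : ℂ → ℂ) (F : ℂ × ℂ → ℂ × ℂ) (γ : ℝ → ℝ) (R δ : ℕ → ℝ) : Set (ℂ × ℂ) :=
  ⋃ n : ℕ, ⋃ m : ℕ, F^[n] '' V f γ (R m) (δ m / 4)

/-! ### The coordinate changes -/

/-- Sum of a series that may converge only conditionally, as the limit of its partial sums. -/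
def seriesSum (a : ℕ → ℂ) : ℂ := limUnder atTop (fun N => ∑ k ∈ Finset.range N, a k)

/-- `Φ(u,w) = (u, w + λ⁻¹ ∑_{l ≥ 2} b_l wˡ ∑_k λ^{(l-1)k}/(u+k))`, `g / f(0) = ∑_{l ≥ 2} b_l wˡ`. -/
def Phi (θ : ℝ) (f g : ℂ → ℂ) (p : ℂ × ℂ) : ℂ × ℂ :=
  (p.1, p.2 + (lam θ)⁻¹ * ∑' l : ℕ, coeff f g (l + 2) * p.2 ^ (l + 2) *
    seriesSum (fun k => lam θ ^ ((l + 1) * k) / (p.1 + k)))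

/-- The inverse of `Φ` on the region `|w| < δ`. (For `u ∈ K_{R,δ}` with `R` large, the map
`w ↦ Φ(u,w)` is injective on `|w| < δ`.) -/
def PhiInv (θ : ℝ) (f g : ℂ → ℂ) (δ : ℝ) : ℂ × ℂ → ℂ × ℂ :=
  Function.invFunOn (Phi θ f g) {p | ‖p.2‖ < δ}

/-- `q(w) = ∑_{l ≥ 1} d_l wˡ / (λˡ - 1)`. -/
def q (θ : ℝ) (f : ℂ → ℂ) (w : ℂ) : ℂ :=
  ∑' l : ℕ, coeff f f (l + 1) / (lam θ ^ (l + 1) - 1) * w ^ (l + 1)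

/-- `Ψ(u,w) = (u + q(w), w)`. -/
def Psi (θ : ℝ) (f : ℂ → ℂ) (p : ℂ × ℂ) : ℂ × ℂ := (p.1 + q θ f p.2, p.2)

/-- The inverse of `Ψ`. -/
def PsiInv (θ : ℝ) (f : ℂ → ℂ) (p : ℂ × ℂ) : ℂ × ℂ := (p.1 - q θ f p.2, p.2)

/-- `F̃ = Θ⁻¹ ∘ F ∘ Θ`. -/
def Ftilde (f : ℂ → ℂ) (F : ℂ × ℂ → ℂ × ℂ) : ℂ × ℂ → ℂ × ℂ := ThetaInv f ∘ F ∘ Theta f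

/-- `G̃ = Ψ⁻¹ ∘ Φ⁻¹ ∘ F̃ ∘ Φ ∘ Ψ`. -/
def Gtilde (θ : ℝ) (f g : ℂ → ℂ) (F : ℂ × ℂ → ℂ × ℂ) (δ : ℝ) : ℂ × ℂ → ℂ × ℂ :=
  PsiInv θ f ∘ PhiInv θ f g δ ∘ Ftilde f F ∘ Phi θ f g ∘ Psi θ f

/-- The function `h` in `G̃(u,w) = (u + 1 + h(w)/u, λ w) + O(1/u²)`, read off along real
`u → +∞`. -/
def h (θ : ℝ) (f g : ℂ → ℂ) (F : ℂ × ℂ → ℂ × ℂ) (w : ℂ) : ℂ :=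
  limUnder (atTop : Filter ℝ)
    (fun x : ℝ => (x : ℂ) * ((Gtilde θ f g F (‖w‖ + 1) ((x : ℂ), w)).1 - (x : ℂ) - 1))

/-- `A = h(0)`. -/
def A (θ : ℝ) (f g : ℂ → ℂ) (F : ℂ × ℂ → ℂ × ℂ) : ℂ := h θ f g F 0

/-- `τ(u,w) = (u - ∑_k (h(λᵏ w) - A)/(u+k), w)`. -/
def tau (θ : ℝ) (f g : ℂ → ℂ) (F : ℂ × ℂ → ℂ × ℂ) (p : ℂ × ℂ) : ℂ × ℂ :=
  (p.1 - seriesSum (fun k => (h θ f g F (lam θ ^ k * p.2) - A θ f g F) / (p.1 + k)), p.2)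

/-- The total change of coordinates `Θ ∘ Φ ∘ Ψ ∘ τ`. -/
def T (θ : ℝ) (f g : ℂ → ℂ) (F : ℂ × ℂ → ℂ × ℂ) : ℂ × ℂ → ℂ × ℂ :=
  Theta f ∘ Phi θ f g ∘ Psi θ f ∘ tau θ f g F

/-- `H = τ⁻¹ ∘ Ψ⁻¹ ∘ Φ⁻¹ ∘ Θ⁻¹ ∘ F ∘ Θ ∘ Φ ∘ Ψ ∘ τ`, that is `F` in the new coordinates, with the
inverse of the coordinate change taken on `U_{R,δ}`. -/
def H (θ : ℝ) (f g : ℂ → ℂ) (F : ℂ × ℂ → ℂ × ℂ) (γ : ℝ → ℝ) (R δ : ℝ) : ℂ × ℂ → ℂ × ℂ :=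
  Function.invFunOn (T θ f g F) (U γ R δ) ∘ F ∘ T θ f g F

/-- `Q_n(u,w) = (u - n - A log n, λ⁻ⁿ w)`. -/
def Qn (θ : ℝ) (f g : ℂ → ℂ) (F : ℂ × ℂ → ℂ × ℂ) (n : ℕ) (p : ℂ × ℂ) : ℂ × ℂ :=
  (p.1 - n - A θ f g F * (Real.log n : ℂ), (lam θ ^ n)⁻¹ * p.2)

/-- The approximate Fatou coordinates `φ_n = Q_n ∘ Hⁿ`. -/
def phi (θ : ℝ) (f g : ℂ → ℂ) (F : ℂ × ℂ → ℂ × ℂ) (γ : ℝ → ℝ) (R δ : ℝ) (n : ℕ) :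
    ℂ × ℂ → ℂ × ℂ :=
  Qn θ f g F n ∘ (H θ f g F γ R δ)^[n]

/-- The normal form `χ(u,w) = (u + 1, λ w)`. -/
def chi (θ : ℝ) (p : ℂ × ℂ) : ℂ × ℂ := (p.1 + 1, lam θ * p.2)

end ParabolicCylinder

end

noncomputable section

namespace ParabolicCylinder

/-! ### Holomorphic maps between complex normed spaces -/

section SeveralVariables

variable {E F : Type*} [NormedAddCommGroup E] [NormedSpace ℂ E] [NormedAddCommGroup F]
  [NormedSpace ℂ F]

theorem mapsTo_closedBall_of_norm_le {f : E → F} {c : E} {r ε : ℝ} (hr : 0 < r)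
    (hb : ∀ x ∈ Metric.ball c r, ‖f x‖ ≤ ε) :
    MapsTo f (Metric.ball c r) (Metric.closedBall (f c) (2 * ε)) := by
  intro x hx
  rw [mem_closedBall_iff_norm]
  have h1 := hb x hx
  have h2 := hb c (Metric.mem_ball_self hr)
  have := norm_sub_le (f x) (f c)
  linarith

theorem norm_sub_le_of_norm_le_ball {f : E → F} {c z : E} {r ε : ℝ}
    (hd : DifferentiableOn ℂ f (Metric.ball c r)) (hb : ∀ x ∈ Metric.ball c r, ‖f x‖ ≤ ε)
    (hz : z ∈ Metric.ball c r) : ‖f z - f c‖ ≤ 2 * ε / r * ‖z - c‖ := by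
  have hr : 0 < r := Metric.nonempty_ball.1 ⟨z, hz⟩
  simpa [dist_eq_norm] using Complex.dist_le_div_mul_dist_of_mapsTo_ball hd
    (mapsTo_closedBall_of_norm_le hr hb) hz

theorem norm_fderiv_le_of_norm_le_ball {f : E → F} {c : E} {r ε : ℝ} (hr : 0 < r)
    (hd : DifferentiableOn ℂ f (Metric.ball c r)) (hb : ∀ x ∈ Metric.ball c r, ‖f x‖ ≤ ε) :
    ‖fderiv ℂ f c‖ ≤ 2 * ε / r :=
  Complex.norm_fderiv_le_div_of_mapsTo_ball hd (mapsTo_closedBall_of_norm_le hr hb) hr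

/-- A uniform limit of holomorphic maps on an open set is holomorphic. -/
theorem differentiableOn_of_tendstoUniformlyOn [CompleteSpace F] {f : ℕ → E → F} {g : E → F}
    {s : Set E} (hs : IsOpen s) (hf : ∀ n, DifferentiableOn ℂ (f n) s)
    (hfg : TendstoUniformlyOn f g atTop s) : DifferentiableOn ℂ g s := by
  intro x hx
  obtain ⟨r, hr, hrs⟩ := Metric.isOpen_iff.1 hs x hx
  have hsub : ∀ y ∈ Metric.ball x (r / 2), Metric.ball y (r / 2) ⊆ s := by
    intro y hy
    refine Subset.trans (Metric.ball_subset_ball' ?_) hrs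
    have := Metric.mem_ball.1 hy
    linarith
  have hys : ∀ y ∈ Metric.ball x (r / 2), y ∈ s := fun y hy =>
    hsub y hy (Metric.mem_ball_self (by linarith))
  have hda : ∀ n, ∀ y ∈ Metric.ball x (r / 2), DifferentiableAt ℂ (f n) y := fun n y hy =>
    (hf n).differentiableAt (hs.mem_nhds (hys y hy))
  have hc : UniformCauchySeqOn (fun n => fderiv ℂ (f n)) atTop (Metric.ball x (r / 2)) := by
    rw [Metric.uniformCauchySeqOn_iff]
    intro ε hε
    obtain ⟨N, hN⟩ := Metric.uniformCauchySeqOn_iff.1 hfg.uniformCauchySeqOn (ε * r / 8)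
      (by positivity)
    refine ⟨N, fun m hm n hn y hy => ?_⟩
    rw [dist_eq_norm, ← fderiv_sub (hda m y hy) (hda n y hy)]
    have h1 : ‖fderiv ℂ (f m - f n) y‖ ≤ 2 * (ε * r / 8) / (r / 2) := by
      refine norm_fderiv_le_of_norm_le_ball (by linarith)
        (((hf m).sub (hf n)).mono (hsub y hy)) fun z hz => ?_
      have := (hN m hm n hn z (hsub y hy hz)).le
      rwa [dist_eq_norm] at this
    have h2 : 2 * (ε * r / 8) / (r / 2) = ε / 2 := by field_simp; norm_num
    linarith
  choose! g' hg' using fun y (hy : y ∈ Metric.ball x (r / 2)) =>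
    cauchySeq_tendsto_of_complete (hc.cauchySeq hy)
  have hu := hc.tendstoUniformlyOn_of_tendsto hg'
  have hx0 : x ∈ Metric.ball x (r / 2) := Metric.mem_ball_self (by linarith)
  exact (hasFDerivAt_of_tendstoUniformlyOn Metric.isOpen_ball hu
    (fun n y hy => (hda n y hy).hasFDerivAt)
    (fun y hy => hfg.tendsto_at (hys y hy)) hx0).differentiableAt.differentiableWithinAt

theorem differentiableOn_tsum_of_norm_le [CompleteSpace F] {f : ℕ → E → F} {u : ℕ → ℝ}
    {s : Set E} (hs : IsOpen s) (hf : ∀ n, DifferentiableOn ℂ (f n) s) (hu : Summable u)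
    (hb : ∀ n, ∀ x ∈ s, ‖f n x‖ ≤ u n) : DifferentiableOn ℂ (fun x => ∑' n, f n x) s :=
  differentiableOn_of_tendstoUniformlyOn hs
    (fun _ => DifferentiableOn.fun_sum fun n _ => hf n) (tendstoUniformlyOn_tsum_nat hu hb)

theorem exists_lipschitz_of_differentiable [ProperSpace E] {G : E → F} (hG : Differentiable ℂ G)
    (R : ℝ) : ∃ C : ℝ, 0 < C ∧ (∀ x, ‖x‖ ≤ R → ‖G x‖ ≤ C) ∧
      ∀ x y, ‖x‖ ≤ R → ‖y‖ ≤ R → ‖G x - G y‖ ≤ C * ‖x - y‖ := by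
  obtain ⟨M, hM⟩ := (isCompact_closedBall (0 : E) (R + 1)).exists_bound_of_continuousOn
    hG.continuous.continuousOn
  have hM' : ∀ x, ‖x‖ ≤ R + 1 → ‖G x‖ ≤ |M| := fun x hx =>
    (hM x (by simpa using hx)).trans (le_abs_self M)
  refine ⟨2 * |M| + 1, by positivity, fun x hx => ?_, fun x y hx hy => ?_⟩
  · have := hM' x (by linarith)
    have := abs_nonneg M
    linarith
  · rcases lt_or_ge ‖x - y‖ 1 with h | h
    · have := norm_sub_le_of_norm_le_ball (f := G) (c := y) (z := x) (r := 1) (ε := |M|)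
        hG.differentiableOn (fun z hz => hM' z ?_) (by simpa [dist_eq_norm] using h)
      · have h0 := norm_nonneg (x - y)
        nlinarith
      · have h1 : ‖z - y‖ < 1 := by simpa [dist_eq_norm] using hz
        have := norm_le_insert' z y
        linarith
    · have h1 := norm_sub_le (G x) (G y)
      have h2 := hM' x (by linarith)
      have h3 := hM' y (by linarith)
      have := abs_nonneg M
      nlinarith

theorem exists_taylor_bound {f : ℂ → ℂ} (hf : Differentiable ℂ f) (R : ℝ) :
    ∃ C : ℝ, 0 < C ∧ ∀ w s : ℂ, ‖w‖ ≤ R → ‖s‖ ≤ 1 →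
      ‖f (w + s) - f w - deriv f w * s‖ ≤ C * ‖s‖ ^ 2 := by
  have hd : Differentiable ℂ (deriv f) := by
    rw [← differentiableOn_univ] at hf ⊢
    exact hf.deriv isOpen_univ
  obtain ⟨C, hC, -, hL⟩ := exists_lipschitz_of_differentiable hd (R + 1)
  refine ⟨C, hC, fun w s hw hs => ?_⟩
  have key := (convex_closedBall w ‖s‖).norm_image_sub_le_of_norm_deriv_le
    (f := fun t => f t - deriv f w * t) (C := C * ‖s‖) (x := w) (y := w + s) (𝕜 := ℂ)
    (fun t _ => by fun_prop) (fun t ht => ?_) (by simp) (by simp)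
  · simp only [add_sub_cancel_left] at key
    calc ‖f (w + s) - f w - deriv f w * s‖
        = ‖f (w + s) - deriv f w * (w + s) - (f w - deriv f w * w)‖ := by congr 1; ring
      _ ≤ C * ‖s‖ * ‖s‖ := key
      _ = C * ‖s‖ ^ 2 := by ring
  · have h1 : deriv (fun t => f t - deriv f w * t) t = deriv f t - deriv f w := by
      rw [deriv_fun_sub (hf t) (by fun_prop), deriv_const_mul_field]
      simp
    rw [h1]
    have h2 : ‖t - w‖ ≤ ‖s‖ := by simpa [dist_eq_norm] using ht
    have h3 := norm_le_insert' t w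
    exact (hL t w (by linarith) (by linarith)).trans (by gcongr)

/-- Identity theorem on a ball. -/
theorem eqOn_zero_ball_of_eqOn_zero_open {f : E → F} [CompleteSpace F] {c : E} {r : ℝ}
    (hf : DifferentiableOn ℂ f (Metric.ball c r)) {S : Set E} (hS : IsOpen S)
    (hne : (S ∩ Metric.ball c r).Nonempty) (h0 : ∀ x ∈ S ∩ Metric.ball c r, f x = 0) :
    ∀ x ∈ Metric.ball c r, f x = 0 := by
  obtain ⟨p, hpS, hpB⟩ := hne
  intro x hx
  set l : ℂ → E := fun t => p + t • (x - p) with hl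
  have hlc : Differentiable ℂ l := by fun_prop
  set O : Set ℂ := l ⁻¹' Metric.ball c r with hO
  have hOo : IsOpen O := Metric.isOpen_ball.preimage hlc.continuous
  have hconv : Convex ℝ O := by
    intro s hs t ht a b ha hb hab
    have : l (a • s + b • t) = a • l s + b • l t := by
      simp only [hl, smul_add, Complex.real_smul, add_smul, mul_smul, Complex.coe_smul]
      have : p = a • p + b • p := by rw [← add_smul, hab, one_smul]
      nth_rewrite 1 [this]
      abel
    simp only [hO, mem_preimage, this]
    exact convex_ball c r hs ht ha hb hab
  have h0O : (0 : ℂ) ∈ O := by simp [hO, hl, hpB]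
  have h1O : (1 : ℂ) ∈ O := by simp only [hO, hl, mem_preimage, one_smul]; simpa using hx
  have han : AnalyticOnNhd ℂ (f ∘ l) O :=
    (hf.comp hlc.differentiableOn (fun t ht => ht)).analyticOnNhd hOo
  have hev : f ∘ l =ᶠ[𝓝 0] 0 := by
    have hl0 : l 0 = p := by simp [hl]
    have : ∀ᶠ t in 𝓝 (0 : ℂ), l t ∈ S ∩ Metric.ball c r :=
      hlc.continuous.continuousAt.eventually_mem
        ((hS.inter Metric.isOpen_ball).mem_nhds (by rw [hl0]; exact ⟨hpS, hpB⟩))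
    filter_upwards [this] with t ht
    exact h0 _ ht
  have := han.eqOn_zero_of_preconnected_of_eventuallyEq_zero hconv.isPreconnected h0O hev h1O
  simpa [hl] using this

end SeveralVariables

/-! ### Perturbations of the identity -/

section NearIdentity

variable {X : Type*} [NormedAddCommGroup X] [NormedSpace ℂ X] [CompleteSpace X] [Nontrivial X]
  {G : X → X} {S : Set X}

/-- `G - id` is `1/2`-Lipschitz on `S`. -/
def NearId (G : X → X) (S : Set X) : Prop :=
  ∀ x ∈ S, ∀ y ∈ S, ‖(G x - x) - (G y - y)‖ ≤ 1 / 2 * ‖x - y‖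

theorem NearId.mono {S' : Set X} (h : NearId G S) (hS : S' ⊆ S) : NearId G S' :=
  fun x hx y hy => h x (hS hx) y (hS hy)

theorem NearId.approx (h : NearId G S) : ApproximatesLinearOn G
    ((ContinuousLinearEquiv.refl ℂ X : X ≃L[ℂ] X) : X →L[ℂ] X) S (1 / 2) := by
  intro x hx y hy
  have := h x hx y hy
  calc ‖G x - G y - (x - y)‖ = ‖(G x - x) - (G y - y)‖ := by congr 1; abel
    _ ≤ _ := this
    _ = ((1 / 2 : NNReal) : ℝ) * ‖x - y‖ := by norm_num

theorem nearId_const_lt : Subsingleton X ∨ (1 / 2 : NNReal) <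
    ‖((ContinuousLinearEquiv.refl ℂ X).symm : X →L[ℂ] X)‖₊⁻¹ := by
  right
  have : ‖((ContinuousLinearEquiv.refl ℂ X).symm : X →L[ℂ] X)‖₊ = 1 := by
    have := ContinuousLinearMap.norm_id (𝕜 := ℂ) (E := X)
    exact NNReal.eq this
  rw [this, inv_one]
  exact NNReal.half_lt_self one_ne_zero

theorem NearId.injOn (h : NearId G S) : InjOn G S := h.approx.injOn nearId_const_lt

theorem NearId.exists_preimage {x₀ y : X} {r : ℝ} (h : NearId G (Metric.closedBall x₀ r))
    (hy : 2 * ‖y - G x₀‖ ≤ r) : ∃ x, G x = y ∧ ‖x - x₀‖ ≤ 2 * ‖y - G x₀‖ := by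
  have h' := h.mono (Metric.closedBall_subset_closedBall hy)
  have hs := h'.approx.surjOn_closedBall_of_nonlinearRightInverse
    (ContinuousLinearEquiv.refl ℂ X).toNonlinearRightInverse (b := x₀)
    (ε := 2 * ‖y - G x₀‖) (by positivity) Subset.rfl
  have hn : ((ContinuousLinearEquiv.refl ℂ X).toNonlinearRightInverse.nnnorm : ℝ) = 1 :=
    ContinuousLinearMap.norm_id (𝕜 := ℂ) (E := X)
  rw [hn] at hs
  obtain ⟨x, hx, hxy⟩ := hs (a := y) (by
    rw [mem_closedBall_iff_norm]
    have : ((1 / 2 : NNReal) : ℝ) = 1 / 2 := by norm_num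
    rw [this]
    linarith [norm_nonneg (y - G x₀)])
  exact ⟨x, hxy, by simpa [dist_eq_norm] using hx⟩

theorem NearId.isOpen_image (h : NearId G S) (hS : IsOpen S) : IsOpen (G '' S) :=
  (h.approx.toOpenPartialHomeomorph G S nearId_const_lt hS).open_target

theorem NearId.differentiableOn_inverse (h : NearId G S) (hS : IsOpen S)
    (hG : DifferentiableOn ℂ G S) {P : X → X} (hP : LeftInvOn P G S) :
    DifferentiableOn ℂ P (G '' S) := by
  rintro _ ⟨x, hx, rfl⟩
  set e := h.approx.toOpenPartialHomeomorph G S nearId_const_lt hS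
  have hopen := h.isOpen_image hS
  have hPe : EqOn P e.symm (G '' S) := by
    rintro _ ⟨z, hz, rfl⟩
    rw [hP hz]
    exact (e.left_inv hz).symm
  have hcont : ContinuousAt P (G x) := by
    have h1 : ContinuousAt e.symm (G x) :=
      e.continuousOn_symm.continuousAt (hopen.mem_nhds (mem_image_of_mem _ hx))
    exact h1.congr (eventuallyEq_of_mem (hopen.mem_nhds (mem_image_of_mem _ hx))
      (fun y hy => (hPe hy).symm))
  have hd : HasFDerivAt G (fderiv ℂ G x) x :=
    (hG.differentiableAt (hS.mem_nhds hx)).hasFDerivAt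
  have hdE : HasFDerivAt (fun y => y - G y) (ContinuousLinearMap.id ℂ X - fderiv ℂ G x) x :=
    (hasFDerivAt_id x).sub hd
  have hn : ‖ContinuousLinearMap.id ℂ X - fderiv ℂ G x‖ ≤ 1 / 2 := by
    refine hdE.le_of_lip' (by norm_num) ?_
    filter_upwards [hS.mem_nhds hx] with y hy
    have := h y hy x hx
    rw [← norm_neg] at this
    calc ‖y - G y - (x - G x)‖ = ‖-((G y - y) - (G x - x))‖ := by congr 1; abel
      _ ≤ _ := this
  have hlt : ‖(1 : X →L[ℂ] X) - fderiv ℂ G x‖ < 1 := lt_of_le_of_lt hn (by norm_num)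
  set v := Units.oneSub _ hlt
  have hv : (ContinuousLinearEquiv.ofUnit v : X →L[ℂ] X) = fderiv ℂ G x := by
    ext y
    change (v : X →L[ℂ] X) y = _
    simp [v]
  have hd' : HasFDerivAt G (ContinuousLinearEquiv.ofUnit v : X →L[ℂ] X) (P (G x)) := by
    rw [hP hx, hv]; exact hd
  refine (hd'.of_local_left_inverse hcont ?_).differentiableAt.differentiableWithinAt
  filter_upwards [hopen.mem_nhds (mem_image_of_mem _ hx)] with y hy
  obtain ⟨z, hz, rfl⟩ := hy
  rw [hP hz]

end NearIdentity

/-! ### Power series without constant term -/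

/-- The power series `∑ c l * t ^ (l + 1)` has infinite radius of convergence. -/
def EntSeq (c : ℕ → ℂ) : Prop := ∀ t : ℝ, 0 ≤ t → Summable fun l => ‖c l‖ * t ^ (l + 1)

/-- The sum of the power series `∑ c l * w ^ (l + 1)`. -/
def pw (c : ℕ → ℂ) (w : ℂ) : ℂ := ∑' l, c l * w ^ (l + 1)

theorem EntSeq.summable {c : ℕ → ℂ} (hc : EntSeq c) (w : ℂ) :
    Summable fun l => c l * w ^ (l + 1) :=
  Summable.of_norm (by simpa using hc ‖w‖ (norm_nonneg w))

theorem EntSeq.differentiable_pw {c : ℕ → ℂ} (hc : EntSeq c) : Differentiable ℂ (pw c) := by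
  intro w
  have h : DifferentiableOn ℂ (pw c) (Metric.ball 0 (‖w‖ + 1)) := by
    refine Complex.differentiableOn_tsum_of_summable_norm (hc (‖w‖ + 1) (by positivity))
      (fun l => by fun_prop) Metric.isOpen_ball fun l z hz => ?_
    rw [norm_mul, norm_pow]
    have : ‖z‖ < ‖w‖ + 1 := by simpa using hz
    gcongr
  exact h.differentiableAt (Metric.isOpen_ball.mem_nhds (by simp))

theorem EntSeq.mul_rpow {c d : ℕ → ℂ} (hc : EntSeq c) {B r : ℝ}
    (hd : ∀ l, ‖d l‖ ≤ B * ((l + 1 : ℕ) : ℝ) ^ r * ‖c l‖) : EntSeq d := by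
  intro t ht
  have ho := (isLittleO_pow_const_const_pow_of_one_lt (R := ℝ) ⌈r⌉₊
    (by norm_num : (1 : ℝ) < 2)).isBigO
  obtain ⟨C, hC, hb⟩ := Asymptotics.bound_of_isBigO_nat_atTop ho
  refine Summable.of_nonneg_of_le (fun l => by positivity) (fun l => ?_)
    ((hc (2 * t) (by positivity)).mul_left (|B| * C))
  have h1 := hb (x := l + 1) (by positivity)
  rw [Real.norm_of_nonneg (by positivity), Real.norm_of_nonneg (by positivity)] at h1
  have h2 : ((l + 1 : ℕ) : ℝ) ^ r ≤ ((l + 1 : ℕ) : ℝ) ^ ⌈r⌉₊ := by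
    rw [← Real.rpow_natCast]
    exact Real.rpow_le_rpow_of_exponent_le (by simp) (Nat.le_ceil r)
  calc ‖d l‖ * t ^ (l + 1) ≤ (|B| * (C * 2 ^ (l + 1)) * ‖c l‖) * t ^ (l + 1) := by
        gcongr
        refine (hd l).trans ?_
        gcongr
        · exact le_abs_self B
        · exact h2.trans h1
    _ = |B| * C * (‖c l‖ * (2 * t) ^ (l + 1)) := by rw [mul_pow]; ring

theorem EntSeq.shift {c : ℕ → ℂ} (hc : EntSeq c) : EntSeq fun l => c (l + 1) := by
  intro t ht
  refine Summable.of_nonneg_of_le (fun l => by positivity) (fun l => ?_)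
    ((summable_nat_add_iff 1).2 (hc (max t 1) (by positivity)))
  have h1 : t ^ (l + 1) ≤ max t 1 ^ (l + 1) := by gcongr; exact le_max_left _ _
  have h2 : max t 1 ^ (l + 1) ≤ max t 1 ^ (l + 1 + 1) :=
    pow_le_pow_right₀ (le_max_right _ _) (by omega)
  gcongr
  exact h1.trans h2

theorem hasSum_coeff (f : ℂ → ℂ) {k : ℂ → ℂ} (hk : Differentiable ℂ k) (w : ℂ) :
    HasSum (fun l => coeff f k l * w ^ l) (k w / f 0) := by
  have h := (Complex.hasSum_taylorSeries_of_entire hk 0 w).div_const (f 0)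
  have e : (fun l => coeff f k l * w ^ l) =
      fun l => ((l.factorial : ℂ)⁻¹ • (w - 0) ^ l • iteratedDeriv l k 0) / f 0 := by
    ext l
    simp only [coeff, sub_zero, smul_eq_mul]
    ring
  rw [e]
  exact h

theorem entSeq_coeff (f : ℂ → ℂ) {k : ℂ → ℂ} (hk : Differentiable ℂ k) :
    EntSeq fun l => coeff f k (l + 1) := by
  intro t ht
  have h := (hasSum_coeff f hk (t : ℂ)).summable.norm
  have h' : Summable fun l => ‖coeff f k l‖ * t ^ l := by
    refine h.congr fun l => ?_
    rw [norm_mul, norm_pow, Complex.norm_real, Real.norm_of_nonneg ht]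
  exact (summable_nat_add_iff 1).2 h'

theorem coeff_zero (f k : ℂ → ℂ) : coeff f k 0 = k 0 / f 0 := by simp [coeff]

theorem pw_coeff (f : ℂ → ℂ) {k : ℂ → ℂ} (hk : Differentiable ℂ k) (w : ℂ) :
    pw (fun l => coeff f k (l + 1)) w = (k w - k 0) / f 0 := by
  have h := hasSum_coeff f hk w
  have h2 := h.summable.tsum_eq_zero_add
  rw [h.tsum_eq, coeff_zero] at h2
  rw [sub_div, h2, pw]
  ring

theorem mul_pw_coeff (f : ℂ → ℂ) {g : ℂ → ℂ} (hg : Differentiable ℂ g) (h0 : g 0 = 0)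
    (h1 : deriv g 0 = 0) (w : ℂ) : w * pw (fun l => coeff f g (l + 2)) w = g w / f 0 := by
  have h := pw_coeff f hg w
  rw [h0, sub_zero, pw, ((entSeq_coeff f hg).summable w).tsum_eq_zero_add] at h
  have : coeff f g (0 + 1) = 0 := by simp [coeff, h1]
  rw [this, zero_mul, zero_add] at h
  rw [← h, pw, ← tsum_mul_left]
  congr 1
  ext l
  ring

/-! ### The cohomological equation -/

theorem norm_lam (θ : ℝ) : ‖lam θ‖ = 1 := by
  rw [lam, show (2 * Real.pi * Complex.I * θ : ℂ) = ((2 * Real.pi * θ : ℝ) : ℂ) * Complex.I by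
    push_cast; ring]
  exact Complex.norm_exp_ofReal_mul_I _

theorem lam_ne_zero (θ : ℝ) : lam θ ≠ 0 := Complex.exp_ne_zero _

theorem norm_lam_pow (θ : ℝ) (k : ℕ) : ‖lam θ ^ k‖ = 1 := by rw [norm_pow, norm_lam, one_pow]

theorem norm_lam_mul (θ : ℝ) (w : ℂ) : ‖lam θ * w‖ = ‖w‖ := by rw [norm_mul, norm_lam, one_mul]

theorem norm_lam_pow_mul (θ : ℝ) (k : ℕ) (w : ℂ) : ‖lam θ ^ k * w‖ = ‖w‖ := by
  rw [norm_mul, norm_lam_pow, one_mul]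

/-- Coefficients of the solution of the cohomological equation `e (λ w) - e w = pw c w`. -/
def coh (θ : ℝ) (c : ℕ → ℂ) (l : ℕ) : ℂ := c l / (lam θ ^ (l + 1) - 1)

theorem HasDiophantineExponent.lam_pow_sub_one_ne_zero {θ r : ℝ} (h : HasDiophantineExponent θ r)
    (l : ℕ) : lam θ ^ (l + 1) - 1 ≠ 0 := by
  obtain ⟨c, hc, h⟩ := h
  have := h (l + 1) (by omega)
  rw [← norm_pos_iff]
  refine lt_of_lt_of_le ?_ this
  positivity

theorem EntSeq.coh {θ r : ℝ} (h : HasDiophantineExponent θ r) {c : ℕ → ℂ} (hc : EntSeq c) :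
    EntSeq (coh θ c) := by
  have hne := h.lam_pow_sub_one_ne_zero
  obtain ⟨b, hb, h⟩ := h
  refine hc.mul_rpow (B := b⁻¹) (r := r) fun l => ?_
  have h1 := h (l + 1) (by omega)
  have h2 : 0 < ‖lam θ ^ (l + 1) - 1‖ := norm_pos_iff.2 (hne l)
  rw [ParabolicCylinder.coh, norm_div, div_le_iff₀ h2]
  have h3 : (0 : ℝ) < ((l + 1 : ℕ) : ℝ) ^ r := by positivity
  rw [Real.rpow_neg (by positivity)] at h1
  calc ‖c l‖ = b⁻¹ * ((l + 1 : ℕ) : ℝ) ^ r * ‖c l‖ * (b * (((l + 1 : ℕ) : ℝ) ^ r)⁻¹) := by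
        field_simp
    _ ≤ _ := by gcongr

theorem pw_coh {θ r : ℝ} (h : HasDiophantineExponent θ r) {c : ℕ → ℂ} (hc : EntSeq c) (w : ℂ) :
    pw (coh θ c) (lam θ * w) - pw (coh θ c) w = pw c w := by
  have hs := hc.coh h
  rw [pw, pw, ← (hs.summable _).tsum_sub (hs.summable _), pw]
  congr 1
  ext l
  have := h.lam_pow_sub_one_ne_zero l
  rw [coh, mul_pow]
  field_simp

theorem q_eq (θ : ℝ) (f : ℂ → ℂ) : q θ f = pw (coh θ fun l => coeff f f (l + 1)) := rfl

/-! ### The sector `Re u + |Im u| > 0` -/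

/-- The sector `arg (u - R) ∈ [-3π/4, 3π/4]` is `{R ≤ mm u}`. -/
def mm (u : ℂ) : ℝ := u.re + |u.im|

theorem mm_le_norm (u : ℂ) : mm u ≤ 3 / 2 * ‖u‖ := by
  have h : ‖u‖ ^ 2 = u.re ^ 2 + u.im ^ 2 := by
    rw [← Complex.normSq_eq_norm_sq, Complex.normSq_apply]; ring
  rw [mm]
  refine abs_le_of_sq_le_sq' ?_ (by positivity) |>.2
  rw [mul_pow, h]
  have := sq_abs u.im
  nlinarith [sq_nonneg (u.re - |u.im|)]

theorem mm_add (u s : ℂ) : |mm (u + s) - mm u| ≤ 2 * ‖s‖ := by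
  have h1 := Complex.abs_re_le_norm s
  have h2 := Complex.abs_im_le_norm s
  have h3 := abs_abs_sub_abs_le (u.im + s.im) u.im
  rw [add_sub_cancel_left] at h3
  simp only [mm, Complex.add_re, Complex.add_im]
  rw [abs_le] at *
  have h4 : |s.im| ≤ ‖s‖ := abs_le.2 h2
  constructor <;> linarith

theorem continuous_mm : Continuous mm := by unfold mm; fun_prop

theorem norm_pos_of_mm_pos {u : ℂ} (hu : 0 < mm u) : 0 < ‖u‖ := by
  linarith [mm_le_norm u]

theorem norm_add_natCast {u : ℂ} (hu : 0 < mm u) (k : ℕ) : (‖u‖ + k) / 3 ≤ ‖u + k‖ := by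
  have h : ‖u‖ ^ 2 = u.re ^ 2 + u.im ^ 2 := by
    rw [← Complex.normSq_eq_norm_sq, Complex.normSq_apply]; ring
  have h' : ‖u + k‖ ^ 2 = (u.re + k) ^ 2 + u.im ^ 2 := by
    rw [← Complex.normSq_eq_norm_sq, Complex.normSq_apply]; simp; ring
  refine abs_le_of_sq_le_sq' ?_ (by positivity) |>.2
  rw [h']
  have hk : (0 : ℝ) ≤ k := k.cast_nonneg
  have h1 : (‖u‖ + k) ^ 2 ≤ 2 * (u.re ^ 2 + u.im ^ 2 + k ^ 2) := by
    nlinarith [sq_nonneg (‖u‖ - k)]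
  have h2 : 2 * (u.re ^ 2 + u.im ^ 2 + k ^ 2) ≤ 9 * ((u.re + k) ^ 2 + u.im ^ 2) := by
    rcases le_or_gt 0 u.re with h | h
    · nlinarith [mul_nonneg h hk, sq_nonneg u.re, sq_nonneg u.im]
    · have h3 : u.re ^ 2 ≤ u.im ^ 2 := by
        rw [← sq_abs u.im]
        unfold mm at hu
        nlinarith
      nlinarith [sq_nonneg (9 * u.re + 7 * k), sq_nonneg u.re]
  rw [div_pow]
  linarith

theorem add_natCast_ne_zero {u : ℂ} (hu : 0 < mm u) (k : ℕ) : u + k ≠ 0 := by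
  rw [← norm_pos_iff]
  have := norm_add_natCast hu k
  have := norm_pos_of_mm_pos hu
  have : (0 : ℝ) ≤ k := k.cast_nonneg
  linarith

theorem mem_slitPlane_of_mm_pos {u : ℂ} (hu : 0 < mm u) : u ∈ Complex.slitPlane := by
  rw [Complex.mem_slitPlane_iff]
  by_contra! h
  rw [mm, h.2, abs_zero] at hu
  linarith

/-! ### Summation by parts -/

theorem sum_inv_mul_le {t : ℝ} (ht : 0 < t) (n : ℕ) :
    ∑ k ∈ Finset.range n, ((t + k) * (t + k + 1))⁻¹ ≤ t⁻¹ := by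
  have h : ∑ k ∈ Finset.range n, ((t + k) * (t + k + 1))⁻¹ = t⁻¹ - (t + n)⁻¹ := by
    induction n with
    | zero => simp
    | succ n ih =>
      rw [Finset.sum_range_succ, ih]
      have h1 : t + n ≠ 0 := by positivity
      have h2 : t + (n + 1) ≠ 0 := by positivity
      have h3 : t + n + 1 ≠ 0 := by positivity
      push_cast
      field_simp
      ring
  rw [h]
  have : 0 ≤ (t + n)⁻¹ := by positivity
  linarith

theorem summable_inv_mul {t : ℝ} (ht : 0 < t) :
    Summable fun k : ℕ => ((t + k) * (t + k + 1))⁻¹ :=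
  summable_of_sum_range_le (fun k => by positivity) (sum_inv_mul_le ht)

theorem tsum_inv_mul_le {t : ℝ} (ht : 0 < t) :
    ∑' k : ℕ, ((t + k) * (t + k + 1))⁻¹ ≤ t⁻¹ :=
  Real.tsum_le_of_sum_range_le (fun k => by positivity) (sum_inv_mul_le ht)

/-- The kernel `1 / ((u + k) (u + k + 1))`. -/
def kern (u : ℂ) (k : ℕ) : ℂ := ((u + k) * (u + k + 1))⁻¹

theorem norm_kern_le {u : ℂ} (hu : 0 < mm u) {t : ℝ} (ht : 0 < t) (htu : t ≤ ‖u‖) (k : ℕ) :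
    ‖kern u k‖ ≤ 9 * ((t + k) * (t + k + 1))⁻¹ := by
  have h1 := norm_add_natCast hu k
  have h2 := norm_add_natCast hu (k + 1)
  push_cast at h2
  rw [← add_assoc, ← add_assoc] at h2
  have h3 : (0 : ℝ) ≤ k := k.cast_nonneg
  rw [kern, norm_inv, norm_mul]
  calc (‖u + k‖ * ‖u + k + 1‖)⁻¹ ≤ ((t + k) / 3 * ((t + k + 1) / 3))⁻¹ := by
        gcongr
        · linarith
        · linarith
    _ = 9 * ((t + k) * (t + k + 1))⁻¹ := by field_simp; norm_num

theorem sum_by_parts {u : ℂ} (hu : 0 < mm u) (X : ℕ → ℂ) (n : ℕ) :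
    ∑ k ∈ Finset.range n, (X (k + 1) - X k) / (u + k) =
      X n / (u + n) - X 0 / u + ∑ k ∈ Finset.range n, X (k + 1) * kern u k := by
  induction n with
  | zero => simp
  | succ n ih =>
    rw [Finset.sum_range_succ, Finset.sum_range_succ, ih, kern]
    have h1 := add_natCast_ne_zero hu n
    have h2 := add_natCast_ne_zero hu (n + 1)
    have h3 : u + n + 1 ≠ 0 := by push_cast at h2; rwa [add_assoc]
    push_cast at h2 ⊢
    field_simp
    ring

theorem summable_mul_kern {u : ℂ} (hu : 0 < mm u) {X : ℕ → ℂ} {B : ℝ} (hX : ∀ k, ‖X k‖ ≤ B) :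
    Summable fun k => X k * kern u k := by
  have ht := norm_pos_of_mm_pos hu
  refine Summable.of_norm_bounded ((summable_inv_mul ht).mul_left (B * 9)) fun k => ?_
  rw [norm_mul, mul_assoc]
  have := norm_kern_le hu ht le_rfl k
  have h0 := (norm_nonneg _).trans (hX k)
  gcongr
  exact hX k

theorem tendsto_inv_add_natCast (u : ℂ) : Tendsto (fun n : ℕ => (u + n)⁻¹) atTop (𝓝 0) := by
  refine tendsto_inv₀_cobounded.comp ?_
  rw [← tendsto_norm_atTop_iff_cobounded]
  refine tendsto_atTop_mono (fun n => ?_)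
    (tendsto_atTop_add_const_right atTop (-‖u‖) tendsto_natCast_atTop_atTop)
  have := norm_le_insert' (n : ℂ) (-u)
  simp only [norm_neg, sub_neg_eq_add, Complex.norm_natCast] at this
  rw [add_comm u]
  linarith

theorem seriesSum_sub {u : ℂ} (hu : 0 < mm u) {X : ℕ → ℂ} {B : ℝ} (hX : ∀ k, ‖X k‖ ≤ B) :
    seriesSum (fun k => (X (k + 1) - X k) / (u + k)) =
      -(X 0 / u) + ∑' k, X (k + 1) * kern u k := by
  refine Tendsto.limUnder_eq ?_
  simp only [sum_by_parts hu X]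
  have h1 : Tendsto (fun n : ℕ => X n / (u + n)) atTop (𝓝 0) := by
    simp only [div_eq_mul_inv]
    refine isBoundedUnder_le_mul_tendsto_zero ?_ (tendsto_inv_add_natCast u)
    exact isBoundedUnder_of ⟨B, hX⟩
  have h2 := (summable_mul_kern hu (fun k => hX (k + 1))).hasSum.tendsto_sum_nat
  simpa using (h1.sub_const (X 0 / u)).add h2

/-- The function `∑ k, (e (λ ^ (k + 1) w) - e (λ ^ k w)) / (u + k)`, summed by parts. -/
def Sg (θ : ℝ) (e : ℂ → ℂ) (p : ℂ × ℂ) : ℂ :=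
  -(e p.2 / p.1) + ∑' k : ℕ, e (lam θ ^ (k + 1) * p.2) * kern p.1 k

/-- The region `mm u > ρ`, `|w| < δ`. -/
def Dom (ρ δ : ℝ) : Set (ℂ × ℂ) := {p | ρ < mm p.1 ∧ ‖p.2‖ < δ}

theorem isOpen_Dom (ρ δ : ℝ) : IsOpen (Dom ρ δ) :=
  (isOpen_lt continuous_const (continuous_mm.comp continuous_fst)).inter
    (isOpen_lt (continuous_norm.comp continuous_snd) continuous_const)

theorem differentiableOn_Sg {θ : ℝ} {e : ℂ → ℂ} (he : Differentiable ℂ e) (δ : ℝ) :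
    DifferentiableOn ℂ (Sg θ e) (Dom 0 δ) := by
  intro p hp
  have hp0 := norm_pos_of_mm_pos hp.1
  set s : Set (ℂ × ℂ) := Dom 0 δ ∩ {x | ‖p.1‖ / 2 < ‖x.1‖} with hs
  have hso : IsOpen s := (isOpen_Dom 0 δ).inter (isOpen_lt continuous_const (by fun_prop))
  have hps : p ∈ s := ⟨hp, half_lt_self hp0⟩
  obtain ⟨C, hC, hCb, -⟩ := exists_lipschitz_of_differentiable he δ
  have h1 : DifferentiableOn ℂ (fun x : ℂ × ℂ => ∑' k : ℕ, e (lam θ ^ (k + 1) * x.2) * kern x.1 k)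
      s := by
    refine differentiableOn_tsum_of_norm_le hso (fun k => ?_)
      ((summable_inv_mul (half_pos hp0)).mul_left (C * 9)) fun k x hx => ?_
    · refine DifferentiableOn.mul (by fun_prop) ?_
      unfold kern
      refine DifferentiableOn.fun_inv (by fun_prop) fun x hx => ?_
      have h1 := add_natCast_ne_zero hx.1.1 k
      have h2 := add_natCast_ne_zero hx.1.1 (k + 1)
      push_cast at h2
      rw [← add_assoc] at h2
      exact mul_ne_zero h1 h2
    · rw [norm_mul, mul_assoc]
      have := norm_kern_le hx.1.1 (half_pos hp0) (le_of_lt hx.2) k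
      gcongr
      exact hCb _ (by rw [norm_lam_pow_mul]; exact hx.1.2.le)
  have h2 : DifferentiableAt ℂ (fun x : ℂ × ℂ => -(e x.2 / x.1)) p := by
    have : p.1 ≠ 0 := norm_pos_iff.1 hp0
    fun_prop (disch := assumption)
  exact (h2.add (h1.differentiableAt (hso.mem_nhds hps))).differentiableWithinAt

theorem norm_kern_sub_le {u : ℂ} (hu : 0 < mm u) (k : ℕ) :
    ‖kern u k - kern u (k + 1)‖ ≤ 54 * ‖u‖⁻¹ * ((‖u‖ + k) * (‖u‖ + k + 1))⁻¹ := by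
  have ht := norm_pos_of_mm_pos hu
  have h1 := add_natCast_ne_zero hu k
  have h2 := add_natCast_ne_zero hu (k + 1)
  have h3 := add_natCast_ne_zero hu (k + 2)
  have h4 := norm_add_natCast hu (k + 2)
  push_cast at h2 h3 h4
  rw [← add_assoc] at h2 h3
  have hk : (0 : ℝ) ≤ k := k.cast_nonneg
  have h5 : kern u k - kern u (k + 1) = kern u k * (2 / (u + k + 2)) := by
    have h2' : u + (k + 1) ≠ 0 := by rwa [← add_assoc]
    have h3' : u + (k + 1) + 1 ≠ 0 := by
      rw [show u + (k + 1) + 1 = u + k + 2 by ring]; exact h3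
    simp only [kern]
    push_cast
    field_simp
    ring
  have h6 : ‖2 / (u + k + 2)‖ ≤ 6 * ‖u‖⁻¹ := by
    rw [norm_div, Complex.norm_ofNat, add_assoc]
    rw [div_le_iff₀ (by linarith)]
    calc (2 : ℝ) = 6 * ‖u‖⁻¹ * (‖u‖ / 3) := by field_simp; norm_num
      _ ≤ _ := by gcongr; linarith
  rw [h5, norm_mul]
  calc _ ≤ 9 * ((‖u‖ + k) * (‖u‖ + k + 1))⁻¹ * (6 * ‖u‖⁻¹) := by
        gcongr
        exact norm_kern_le hu ht le_rfl k
    _ = _ := by ring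

theorem norm_Sg_add_le {θ : ℝ} {e e₂ : ℂ → ℂ} (h : ∀ w, e₂ (lam θ * w) - e₂ w = e w)
    {B : ℝ} {p : ℂ × ℂ} (hu : 0 < mm p.1) (hB : ∀ w, ‖w‖ ≤ ‖p.2‖ → ‖e₂ w‖ ≤ B)  :
    ‖Sg θ e p + e p.2 / p.1‖ ≤ 63 * B * (‖p.1‖⁻¹) ^ 2 := by
  obtain ⟨u, w⟩ := p
  simp only at hu hB ⊢
  have ht := norm_pos_of_mm_pos hu
  set X : ℕ → ℂ := fun k => e₂ (lam θ ^ (k + 1) * w) with hX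
  have hXB : ∀ k, ‖X k‖ ≤ B := fun k => hB _ (by rw [norm_lam_pow_mul])
  have hB0 : 0 ≤ B := (norm_nonneg _).trans (hXB 0)
  have hdiff : ∀ k, e (lam θ ^ (k + 1) * w) = X (k + 1) - X k := fun k => by
    rw [← h]; simp only [hX]; congr 2; ring
  have hsum : Summable fun k : ℕ => e (lam θ ^ (k + 1) * w) * kern u k := by
    refine summable_mul_kern hu (B := B + B) fun k => ?_
    rw [hdiff]
    exact (norm_sub_le _ _).trans (add_le_add (hXB _) (hXB _))
  have hid : ∀ n, ∑ k ∈ Finset.range n, e (lam θ ^ (k + 1) * w) * kern u k =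
      X n * kern u n - X 0 * kern u 0 +
        ∑ k ∈ Finset.range n, X (k + 1) * (kern u k - kern u (k + 1)) := by
    intro n
    induction n with
    | zero => simp
    | succ n ih => rw [Finset.sum_range_succ, Finset.sum_range_succ, ih, hdiff]; ring
  have hk0 : ‖kern u 0‖ ≤ 9 * (‖u‖⁻¹) ^ 2 := by
    refine (norm_kern_le hu ht le_rfl 0).trans ?_
    rw [inv_pow, sq]
    gcongr <;> simp
  have hbd : ∀ n, ‖∑ k ∈ Finset.range n, e (lam θ ^ (k + 1) * w) * kern u k‖ ≤
      ‖X n * kern u n‖ + 63 * B * (‖u‖⁻¹) ^ 2 := by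
    intro n
    rw [hid]
    have h1 : ‖X 0 * kern u 0‖ ≤ B * (9 * (‖u‖⁻¹) ^ 2) := by
      rw [norm_mul]
      gcongr
      exact hXB 0
    have h2 : ‖∑ k ∈ Finset.range n, X (k + 1) * (kern u k - kern u (k + 1))‖ ≤
        B * (54 * ‖u‖⁻¹ * ‖u‖⁻¹) := by
      refine (norm_sum_le _ _).trans ?_
      calc _ ≤ ∑ k ∈ Finset.range n, B * (54 * ‖u‖⁻¹ * ((‖u‖ + k) * (‖u‖ + k + 1))⁻¹) := by
            refine Finset.sum_le_sum fun k _ => ?_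
            rw [norm_mul]
            gcongr
            · exact hXB _
            · exact norm_kern_sub_le hu k
        _ = B * (54 * ‖u‖⁻¹ * ∑ k ∈ Finset.range n, ((‖u‖ + k) * (‖u‖ + k + 1))⁻¹) := by
            rw [Finset.mul_sum, Finset.mul_sum]
        _ ≤ _ := by
            gcongr
            exact sum_inv_mul_le ht n
    have h3 := norm_add_le (X n * kern u n - X 0 * kern u 0)
      (∑ k ∈ Finset.range n, X (k + 1) * (kern u k - kern u (k + 1)))
    have h4 := norm_sub_le (X n * kern u n) (X 0 * kern u 0)
    nlinarith
  have hlim : Tendsto (fun n => ‖X n * kern u n‖ + 63 * B * (‖u‖⁻¹) ^ 2) atTop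
      (𝓝 (0 + 63 * B * (‖u‖⁻¹) ^ 2)) :=
    (tendsto_zero_iff_norm_tendsto_zero.1
      (summable_mul_kern hu hXB).tendsto_atTop_zero).add_const _
  have := le_of_tendsto_of_tendsto' hsum.hasSum.tendsto_sum_nat.norm hlim hbd
  rw [zero_add] at this
  rw [Sg, neg_add_cancel_comm]
  exact this

/-! ### The coordinate changes in terms of `Sg` -/

theorem Phi_fst (θ : ℝ) (f g : ℂ → ℂ) (p : ℂ × ℂ) : (Phi θ f g p).1 = p.1 := rfl

/-- The solution of the cohomological equation for `g w / (f 0 * w)`. -/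
def eg (θ : ℝ) (f g : ℂ → ℂ) : ℂ → ℂ := pw (coh θ fun l => coeff f g (l + 2))

theorem hasSum_pw_kern {θ : ℝ} {c : ℕ → ℂ} (hc : EntSeq c) {u : ℂ} (hu : 0 < mm u) (w : ℂ) :
    HasSum (fun l => ∑' k : ℕ, c l * (lam θ ^ (k + 1) * w) ^ (l + 1) * kern u k)
      (∑' k : ℕ, pw c (lam θ ^ (k + 1) * w) * kern u k) := by
  have hsum : Summable (Function.uncurry fun l k : ℕ =>
      c l * (lam θ ^ (k + 1) * w) ^ (l + 1) * kern u k) := by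
    have ht := norm_pos_of_mm_pos hu
    have h1 := (hc ‖w‖ (norm_nonneg w)).mul_of_nonneg ((summable_inv_mul ht).mul_left 9)
      (fun l => by positivity) (fun k => by positivity)
    refine Summable.of_norm_bounded h1 fun x => ?_
    simp only [Function.uncurry]
    rw [norm_mul, norm_mul, norm_pow, norm_lam_pow_mul]
    gcongr
    exact norm_kern_le hu ht le_rfl _
  have h2 : ∑' k : ℕ, pw c (lam θ ^ (k + 1) * w) * kern u k =
      ∑' l, ∑' k : ℕ, c l * (lam θ ^ (k + 1) * w) ^ (l + 1) * kern u k := by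
    rw [← hsum.tsum_comm]
    refine tsum_congr fun k => ?_
    rw [tsum_mul_right, pw]
  rw [h2]
  exact hsum.prod.hasSum

theorem Phi_eq {θ r : ℝ} (h : HasDiophantineExponent θ r) {f g : ℂ → ℂ}
    (hg : Differentiable ℂ g) {p : ℂ × ℂ} (hp : 0 < mm p.1) :
    Phi θ f g p = (p.1, p.2 + (lam θ)⁻¹ * (p.2 * Sg θ (eg θ f g) p)) := by
  obtain ⟨u, w⟩ := p
  simp only at hp
  set c : ℕ → ℂ := fun l => coeff f g (l + 2) with hc
  have hcE : EntSeq c := (entSeq_coeff f hg).shift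
  have hE := hcE.coh h
  have hne := h.lam_pow_sub_one_ne_zero
  have hser : ∀ l : ℕ, seriesSum (fun k => lam θ ^ ((l + 1) * k) / (u + k)) =
      -((lam θ ^ (l + 1) - 1)⁻¹ / u) +
        ∑' k : ℕ, (lam θ ^ (l + 1)) ^ (k + 1) * (lam θ ^ (l + 1) - 1)⁻¹ * kern u k := by
    intro l
    have := seriesSum_sub hp (X := fun k => (lam θ ^ (l + 1)) ^ k * (lam θ ^ (l + 1) - 1)⁻¹)
      (B := ‖(lam θ ^ (l + 1) - 1)⁻¹‖) (fun k => by
        rw [norm_mul, ← pow_mul, norm_lam_pow, one_mul])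
    simp only [pow_zero, one_mul] at this
    rw [← this]
    congr 1
    ext k
    have := hne l
    rw [pow_mul, pow_succ (lam θ ^ (l + 1)) k]
    field_simp
  have hterm : ∀ l : ℕ, c l * w ^ (l + 2) *
      seriesSum (fun k => lam θ ^ ((l + 1) * k) / (u + k)) =
      w * (-(coh θ c l * w ^ (l + 1) / u) +
        ∑' k : ℕ, coh θ c l * (lam θ ^ (k + 1) * w) ^ (l + 1) * kern u k) := by
    intro l
    rw [hser, mul_add, mul_add, ← tsum_mul_left, ← tsum_mul_left]
    congr 1
    · rw [coh]; ring
    · congr 1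
      ext k
      rw [coh, mul_pow, ← pow_mul, ← pow_mul, mul_comm (l + 1)]
      ring
  have hmain : ∑' l : ℕ, c l * w ^ (l + 2) *
      seriesSum (fun k => lam θ ^ ((l + 1) * k) / (u + k)) = w * Sg θ (eg θ f g) (u, w) := by
    have h1 := (((hE.summable w).hasSum.div_const u).neg.add
      (hasSum_pw_kern hE (θ := θ) hp w)).mul_left w
    rw [tsum_congr hterm, h1.tsum_eq]
    rfl
  simp only [Phi]
  rw [hmain]

theorem tau_eq {θ r : ℝ} (h : HasDiophantineExponent θ r) {f g : ℂ → ℂ} {F : ℂ × ℂ → ℂ × ℂ}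
    {c : ℕ → ℂ} (hc : EntSeq c)
    (hh : ∀ w, ParabolicCylinder.h θ f g F w = A θ f g F + pw c w)
    {p : ℂ × ℂ} (hp : 0 < mm p.1) :
    tau θ f g F p = (p.1 - Sg θ (pw (coh θ c)) p, p.2) := by
  obtain ⟨u, w⟩ := p
  simp only at hp
  obtain ⟨C, -, hC, -⟩ := exists_lipschitz_of_differentiable (hc.coh h).differentiable_pw ‖w‖
  have := seriesSum_sub hp (X := fun k => pw (coh θ c) (lam θ ^ k * w)) (B := C)
    (fun k => hC _ (norm_lam_pow_mul θ k w).le)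
  simp only [pow_zero, one_mul] at this
  rw [tau, Sg, ← this]
  congr 3
  ext k
  simp only [hh]
  rw [add_sub_cancel_left, ← pw_coh h hc, pow_succ']
  ring_nf

/-! ### Asymptotics at infinity -/

/-- `‖u‖ → ∞` with `|w| < δ`. -/
def Gl (δ : ℝ) : Filter (ℂ × ℂ) := comap (fun p => ‖p.1‖) atTop ⊓ 𝓟 {p | ‖p.2‖ < δ}

/-- `mm u → ∞` with `|w| < δ`. -/
def Fl (δ : ℝ) : Filter (ℂ × ℂ) := comap (fun p => mm p.1) atTop ⊓ 𝓟 {p | ‖p.2‖ < δ}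

theorem eventually_Fl {δ : ℝ} {P : ℂ × ℂ → Prop} :
    (∀ᶠ p in Fl δ, P p) ↔ ∃ ρ : ℝ, 0 < ρ ∧ ∀ p ∈ Dom ρ δ, P p := by
  rw [Fl, eventually_inf_principal, eventually_comap]
  simp only [eventually_atTop]
  constructor
  · rintro ⟨ρ, h⟩
    exact ⟨max ρ 1, by positivity, fun p hp =>
      h _ ((le_max_left _ _).trans hp.1.le) p rfl hp.2⟩
  · rintro ⟨ρ, -, h⟩
    refine ⟨ρ + 1, fun b hb p hp hp2 => h p ⟨?_, hp2⟩⟩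
    linarith

theorem eventually_mem_Dom (ρ δ : ℝ) : ∀ᶠ p in Fl δ, p ∈ Dom ρ δ :=
  eventually_Fl.2 ⟨max ρ 1, by positivity, fun _ hp => ⟨(le_max_left _ _).trans_lt hp.1, hp.2⟩⟩

theorem Fl_le_Gl (δ : ℝ) : Fl δ ≤ Gl δ := by
  refine inf_le_inf_right _ ?_
  rw [← tendsto_iff_comap]
  refine tendsto_atTop_mono (fun p => ?_)
    ((tendsto_comap (f := fun p : ℂ × ℂ => mm p.1)).const_mul_atTop
      (by norm_num : (0 : ℝ) < 2 / 3))
  have := mm_le_norm p.1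
  linarith

theorem tendsto_norm_fst_Gl (δ : ℝ) : Tendsto (fun p : ℂ × ℂ => ‖p.1‖) (Gl δ) atTop :=
  tendsto_comap.mono_left inf_le_left

theorem tendsto_mm_fst_Fl (δ : ℝ) : Tendsto (fun p : ℂ × ℂ => mm p.1) (Fl δ) atTop :=
  tendsto_comap.mono_left inf_le_left

theorem eventually_snd_Gl (δ : ℝ) : ∀ᶠ p in Gl δ, ‖p.2‖ < δ := by
  have : ∀ᶠ p : ℂ × ℂ in 𝓟 {p | ‖p.2‖ < δ}, ‖p.2‖ < δ := eventually_principal.2 fun p hp => hp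
  exact this.filter_mono inf_le_right

theorem eventually_snd_Fl (δ : ℝ) : ∀ᶠ p in Fl δ, ‖p.2‖ < δ :=
  (eventually_snd_Gl δ).filter_mono (Fl_le_Gl δ)

theorem tendsto_Fl_iff {ι : Type*} {l : Filter ι} {δ : ℝ} {Y : ι → ℂ × ℂ} :
    Tendsto Y l (Fl δ) ↔ Tendsto (fun i => mm (Y i).1) l atTop ∧ ∀ᶠ i in l, ‖(Y i).2‖ < δ := by
  rw [Fl, tendsto_inf, tendsto_comap_iff, tendsto_principal]
  rfl

theorem tendsto_Gl_iff {ι : Type*} {l : Filter ι} {δ : ℝ} {Y : ι → ℂ × ℂ} :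
    Tendsto Y l (Gl δ) ↔ Tendsto (fun i => ‖(Y i).1‖) l atTop ∧ ∀ᶠ i in l, ‖(Y i).2‖ < δ := by
  rw [Gl, tendsto_inf, tendsto_comap_iff, tendsto_principal]
  rfl

theorem tendsto_inv_Gl (δ : ℝ) : Tendsto (fun p : ℂ × ℂ => p.1⁻¹) (Gl δ) (𝓝 0) := by
  rw [tendsto_zero_iff_norm_tendsto_zero]
  simp only [norm_inv]
  exact tendsto_inv_atTop_zero.comp (tendsto_norm_fst_Gl δ)

theorem tendsto_inv_Fl (δ : ℝ) : Tendsto (fun p : ℂ × ℂ => p.1⁻¹) (Fl δ) (𝓝 0) :=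
  (tendsto_inv_Gl δ).mono_left (Fl_le_Gl δ)

theorem isBigO_snd {c : ℂ → ℂ} (hc : Differentiable ℂ c) (δ : ℝ) :
    (fun p : ℂ × ℂ => c p.2) =O[Gl δ] fun _ => (1 : ℂ) := by
  obtain ⟨C, -, hC, -⟩ := exists_lipschitz_of_differentiable hc δ
  refine Asymptotics.IsBigO.of_bound C ?_
  filter_upwards [eventually_snd_Gl δ] with p hp
  simpa using hC _ hp.le

theorem isBigO_comp_sub {c : ℂ → ℂ} (hc : Differentiable ℂ c) {δ : ℝ} {s : ℂ × ℂ → ℂ}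
    (hs : Tendsto s (Fl δ) (𝓝 0)) :
    (fun p : ℂ × ℂ => c (p.2 + s p) - c p.2) =O[Fl δ] s := by
  obtain ⟨C, -, -, hC⟩ := exists_lipschitz_of_differentiable hc (δ + 1)
  refine Asymptotics.IsBigO.of_bound C ?_
  filter_upwards [eventually_snd_Fl δ, hs.norm.eventually_le_const (u := 1) (by simp)] with p hp h1
  have := norm_add_le p.2 (s p)
  simpa using hC (p.2 + s p) p.2 (by linarith) (by linarith)

theorem isBigO_comp_taylor {c : ℂ → ℂ} (hc : Differentiable ℂ c) {δ : ℝ} {s : ℂ × ℂ → ℂ}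
    (hs : Tendsto s (Fl δ) (𝓝 0)) :
    (fun p : ℂ × ℂ => c (p.2 + s p) - c p.2 - deriv c p.2 * s p) =O[Fl δ] fun p => s p ^ 2 := by
  obtain ⟨C, -, hC⟩ := exists_taylor_bound hc δ
  refine Asymptotics.IsBigO.of_bound C ?_
  filter_upwards [eventually_snd_Fl δ, hs.norm.eventually_le_const (u := 1) (by simp)] with p hp h1
  simpa using hC p.2 (s p) hp.le h1

section shift

variable {δ : ℝ} {X : ℂ × ℂ → ℂ} (hX : (fun p => X p - p.1) =O[Fl δ] fun _ => (1 : ℂ))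

include hX

theorem tendsto_mm_of_isBigO : Tendsto (fun p => mm (X p)) (Fl δ) atTop := by
  obtain ⟨C, hC⟩ := hX.bound
  refine tendsto_atTop_mono' (Fl δ) ?_
    (tendsto_atTop_add_const_right _ (-(2 * C)) (tendsto_mm_fst_Fl δ))
  filter_upwards [hC] with p hp
  have := (abs_le.1 (mm_add p.1 (X p - p.1))).1
  rw [add_sub_cancel] at this
  simp only [norm_one, mul_one] at hp
  linarith

theorem isBigO_inv_of_isBigO : (fun p => (X p)⁻¹) =O[Fl δ] fun p => p.1⁻¹ := by
  obtain ⟨C, hC⟩ := hX.bound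
  refine Asymptotics.IsBigO.of_bound 2 ?_
  filter_upwards [hC, (tendsto_mm_fst_Fl δ).eventually_ge_atTop (4 * |C| + 1)] with p hp h1
  have h2 := mm_le_norm p.1
  have h3 := norm_le_insert (X p) p.1
  have h4 := le_abs_self C
  have h5 := abs_nonneg C
  simp only [norm_one, mul_one] at hp
  rw [norm_inv, norm_inv]
  have h6 : 0 < ‖p.1‖ := by linarith
  rw [← inv_inv (2 : ℝ), ← mul_inv]
  apply inv_anti₀ (by positivity)
  linarith

theorem isBigO_inv_sub_of_isBigO :
    (fun p => (X p)⁻¹ - p.1⁻¹) =O[Fl δ] fun p => p.1⁻¹ ^ 2 := by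
  have h1 := (hX.neg_left.mul (isBigO_inv_of_isBigO hX)).mul
    (Asymptotics.isBigO_refl (fun p : ℂ × ℂ => p.1⁻¹) (Fl δ))
  refine (h1.congr' ?_ ?_)
  · filter_upwards [(tendsto_mm_fst_Fl δ).eventually_gt_atTop 0,
      (tendsto_mm_of_isBigO hX).eventually_gt_atTop 0] with p hp hXp
    have h2 : p.1 ≠ 0 := norm_pos_iff.1 (norm_pos_of_mm_pos hp)
    have h3 : X p ≠ 0 := norm_pos_iff.1 (norm_pos_of_mm_pos hXp)
    field_simp
    ring
  · exact Eventually.of_forall fun p => by ring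

end shift

theorem isBigO_inv_one (δ : ℝ) : (fun p : ℂ × ℂ => p.1⁻¹) =O[Fl δ] fun _ => (1 : ℂ) :=
  (tendsto_inv_Fl δ).isBigO_one ℂ

theorem isBigO_Sg {θ : ℝ} {e e₂ : ℂ → ℂ} (h : ∀ w, e₂ (lam θ * w) - e₂ w = e w)
    (he₂ : Differentiable ℂ e₂) (δ : ℝ) :
    (fun p => Sg θ e p + e p.2 * p.1⁻¹) =O[Fl δ] fun p => p.1⁻¹ ^ 2 := by
  obtain ⟨C, -, hC, -⟩ := exists_lipschitz_of_differentiable he₂ δ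
  refine Asymptotics.IsBigO.of_bound (63 * C) ?_
  filter_upwards [(tendsto_mm_fst_Fl δ).eventually_gt_atTop 0, eventually_snd_Fl δ] with p hp h2
  have := norm_Sg_add_le h (B := C) hp (fun w hw => hC w (hw.trans h2.le))
  rwa [← div_eq_mul_inv, norm_pow, norm_inv]

/-- `Sg` along a map `(u, w) ↦ (u + O(1), λ w)`. -/
theorem isBigO_Sg_comp {θ : ℝ} {e e₂ : ℂ → ℂ} (h : ∀ w, e₂ (lam θ * w) - e₂ w = e w)
    (he₂ : Differentiable ℂ e₂) (he : Differentiable ℂ e) {δ : ℝ} {X : ℂ × ℂ → ℂ}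
    (hX : (fun p => X p - p.1) =O[Fl δ] fun _ => (1 : ℂ)) :
    (fun p => Sg θ e (X p, lam θ * p.2) + e (lam θ * p.2) * p.1⁻¹) =O[Fl δ]
      fun p => p.1⁻¹ ^ 2 := by
  have ht : Tendsto (fun p : ℂ × ℂ => (X p, lam θ * p.2)) (Fl δ) (Fl δ) := by
    refine tendsto_Fl_iff.2 ⟨tendsto_mm_of_isBigO hX, ?_⟩
    filter_upwards [eventually_snd_Fl δ] with p hp
    rwa [norm_lam_mul]
  have h1 := ((isBigO_Sg h he₂ δ).comp_tendsto ht).trans ((isBigO_inv_of_isBigO hX).pow 2)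
  have hb : (fun p : ℂ × ℂ => e (lam θ * p.2)) =O[Fl δ] fun _ => (1 : ℂ) :=
    (isBigO_snd (c := fun w => e (lam θ * w)) (by fun_prop) δ).mono (Fl_le_Gl δ)
  have h2 := hb.mul (isBigO_inv_sub_of_isBigO hX)
  simp only [one_mul] at h2
  refine (h1.sub h2).congr_left fun p => ?_
  simp only [Function.comp]
  ring

/-! ### Holomorphic perturbations of the identity on the regions `Dom ρ δ` -/

theorem ball_subset_Dom {ρ δ r : ℝ} {x : ℂ × ℂ} (hx : x ∈ Dom (ρ + 2 * r) δ) :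
    Metric.closedBall x r ⊆ Dom ρ (δ + r) := by
  intro y hy
  have h1 : ‖y - x‖ ≤ r := by simpa [dist_eq_norm] using hy
  have h2 := (norm_fst_le (y - x)).trans h1
  have h3 := (norm_snd_le (y - x)).trans h1
  have h4 := (abs_le.1 (mm_add x.1 (y - x).1)).1
  have h5 := norm_add_le x.2 (y - x).2
  simp only [Prod.fst_sub, Prod.snd_sub, add_sub_cancel] at h2 h3 h4 h5
  exact ⟨by linarith [hx.1], by linarith [hx.2]⟩

theorem lipschitz_of_norm_le_Dom {V : Type*} [NormedAddCommGroup V] [NormedSpace ℂ V]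
    {E : ℂ × ℂ → V} {ρ δ ε : ℝ} (hE : DifferentiableOn ℂ E (Dom ρ (δ + 1)))
    (hb : ∀ x ∈ Dom ρ (δ + 1), ‖E x‖ ≤ ε) :
    ∀ x ∈ Dom (ρ + 2) δ, ∀ y ∈ Dom (ρ + 2) δ, ‖E x - E y‖ ≤ 2 * ε * ‖x - y‖ := by
  have hsub : ∀ x ∈ Dom (ρ + 2) δ, Metric.ball x 1 ⊆ Dom ρ (δ + 1) := fun x hx =>
    Metric.ball_subset_closedBall.trans (ball_subset_Dom (by simpa using hx))
  have hmem : ∀ x ∈ Dom (ρ + 2) δ, x ∈ Dom ρ (δ + 1) := fun x hx =>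
    hsub x hx (Metric.mem_ball_self one_pos)
  intro x hx y hy
  rcases lt_or_ge ‖x - y‖ 1 with h | h
  · have := norm_sub_le_of_norm_le_ball (hE.mono (hsub y hy)) (fun z hz => hb z (hsub y hy hz))
      (z := x) (by simpa [dist_eq_norm] using h)
    simpa using this
  · have h1 := hb x (hmem x hx)
    have h2 := hb y (hmem y hy)
    have h3 := norm_sub_le (E x) (E y)
    nlinarith [norm_nonneg (E x)]

/-- `G - id` is holomorphic on the sector and tends to zero at infinity. -/
structure AsympId (G : ℂ × ℂ → ℂ × ℂ) : Prop where
  diff : ∀ δ, DifferentiableOn ℂ G (Dom 0 δ)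
  tendsto : ∀ δ, Tendsto (fun p => G p - p) (Fl δ) (𝓝 0)

theorem Dom_anti {ρ ρ' δ δ' : ℝ} (h : ρ ≤ ρ') (hδ : δ' ≤ δ) : Dom ρ' δ' ⊆ Dom ρ δ :=
  fun _ hp => ⟨h.trans_lt hp.1, hp.2.trans_le hδ⟩

theorem AsympId.nearId {G : ℂ × ℂ → ℂ × ℂ} (hG : AsympId G) (δ : ℝ) :
    ∃ ρ : ℝ, 0 < ρ ∧ NearId G (Dom ρ δ) := by
  obtain ⟨ρ, hρ, h⟩ := eventually_Fl.1
    ((hG.tendsto (δ + 1)).norm.eventually_le_const (u := 1 / 4) (by simp))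
  refine ⟨ρ + 2, by linarith, fun x hx y hy => ?_⟩
  have := lipschitz_of_norm_le_Dom (E := fun p => G p - p)
    (((hG.diff (δ + 1)).mono (Dom_anti hρ.le le_rfl)).sub differentiableOn_id) h x hx y hy
  convert this using 2
  norm_num

theorem AsympId.solve {G : ℂ × ℂ → ℂ × ℂ} (hG : AsympId G) (δ : ℝ) :
    ∀ᶠ x₀ in Fl δ, ∀ y, ‖y - G x₀‖ ≤ 1 / 4 → ∃ x, G x = y ∧ ‖x - x₀‖ ≤ 2 * ‖y - G x₀‖ := by
  obtain ⟨ρ, hρ, h⟩ := hG.nearId (δ + 1 / 2)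
  refine eventually_Fl.2 ⟨ρ + 2 * (1 / 2), by linarith, fun x₀ hx₀ y hy => ?_⟩
  exact (h.mono (ball_subset_Dom hx₀)).exists_preimage (by linarith)

theorem AsympId.tendsto_Fl {G : ℂ × ℂ → ℂ × ℂ} (hG : AsympId G) {δ δ' : ℝ} (h : δ < δ') :
    Tendsto G (Fl δ) (Fl δ') := by
  have ht := (hG.tendsto δ).norm
  simp only [norm_zero] at ht
  refine tendsto_Fl_iff.2 ⟨tendsto_mm_of_isBigO (X := fun p => (G p).1) ?_, ?_⟩
  · refine Asymptotics.IsBigO.of_bound 1 ?_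
    filter_upwards [ht.eventually_le_const one_pos] with p hp
    simpa using (norm_fst_le (G p - p)).trans hp
  · filter_upwards [ht.eventually_lt_const (sub_pos.2 h), eventually_snd_Fl δ] with p hp h2
    have h3 := norm_snd_le (G p - p)
    have h4 := norm_add_le p.2 (G p - p).2
    simp only [Prod.snd_sub, add_sub_cancel] at h3 h4
    linarith

/-! ### The map at infinity -/

/-- `HasForm` with the remainders made explicit. -/
structure Form (θ : ℝ) (f g : ℂ → ℂ) (F : ℂ × ℂ → ℂ × ℂ) (a b : ℂ × ℂ → ℂ) : Prop where
  hf : Differentiable ℂ f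
  hg : Differentiable ℂ g
  f0 : f 0 ≠ 0
  g0 : g 0 = 0
  g1 : deriv g 0 = 0
  ha : Differentiable ℂ a
  hb : Differentiable ℂ b
  eq : ∀ z w : ℂ, F (z, w) =
    (z + f w * z ^ 2 + z ^ 3 * a (z, w), lam θ * w + g w * z + z ^ 2 * b (z, w))

theorem HasForm.exists_form {θ : ℝ} {f g : ℂ → ℂ} {F : ℂ × ℂ → ℂ × ℂ} (h : HasForm θ f g F) :
    ∃ a b, Form θ f g F a b := by
  obtain ⟨h1, h2, h3, h4, h5, a, b, h6, h7, h8⟩ := h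
  exact ⟨a, b, h1, h2, h3, h4, h5, h6, h7, h8⟩

/-- The coefficient of `1 / u` in the first component of `Ftilde`. -/
def kap (f : ℂ → ℂ) (a : ℂ × ℂ → ℂ) (w : ℂ) : ℂ := (f w / f 0) ^ 2 - a (0, w) / f 0 ^ 2

/-- The leading coefficient of the second component of `Phi - id`. -/
def Ew (θ : ℝ) (f g : ℂ → ℂ) (w : ℂ) : ℂ := -((lam θ)⁻¹ * (w * eg θ f g w))

/-- The explicit form of the function `h`. -/
def hfun (θ : ℝ) (f g : ℂ → ℂ) (a : ℂ × ℂ → ℂ) (w : ℂ) : ℂ :=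
  deriv f w / f 0 * Ew θ f g w + kap f a w

theorem differentiable_deriv {f : ℂ → ℂ} (hf : Differentiable ℂ f) :
    Differentiable ℂ (deriv f) := by
  rw [← differentiableOn_univ] at hf ⊢
  exact hf.deriv isOpen_univ

section

variable {θ r : ℝ} {f g : ℂ → ℂ} {F : ℂ × ℂ → ℂ × ℂ} {a b : ℂ × ℂ → ℂ}

theorem Form.differentiable_kap (hF : Form θ f g F a b) : Differentiable ℂ (kap f a) := by
  have h1 := hF.hf
  have h2 := hF.ha
  unfold kap
  fun_prop

theorem Form.entSeq_g (hF : Form θ f g F a b) : EntSeq fun l => coeff f g (l + 2) :=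
  (entSeq_coeff f hF.hg).shift

theorem Form.differentiable_eg (hD : HasDiophantineExponent θ r) (hF : Form θ f g F a b) :
    Differentiable ℂ (eg θ f g) := (hF.entSeq_g.coh hD).differentiable_pw

theorem Form.differentiable_Ew (hD : HasDiophantineExponent θ r) (hF : Form θ f g F a b) :
    Differentiable ℂ (Ew θ f g) := by
  have := hF.differentiable_eg hD
  unfold Ew
  fun_prop

theorem Form.differentiable_hfun (hD : HasDiophantineExponent θ r) (hF : Form θ f g F a b) :
    Differentiable ℂ (hfun θ f g a) := by
  have h1 := hF.differentiable_Ew hD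
  have h2 := hF.differentiable_kap
  have h3 := differentiable_deriv hF.hf
  unfold hfun
  fun_prop

theorem Form.differentiable_q (hD : HasDiophantineExponent θ r) (hF : Form θ f g F a b) :
    Differentiable ℂ (q θ f) := by
  rw [q_eq]
  exact ((entSeq_coeff f hF.hf).coh hD).differentiable_pw

theorem Form.q_lam (hD : HasDiophantineExponent θ r) (hF : Form θ f g F a b) (w : ℂ) :
    q θ f (lam θ * w) - q θ f w = f w / f 0 - 1 := by
  rw [q_eq, pw_coh hD (entSeq_coeff f hF.hf), pw_coeff f hF.hf, sub_div, div_self hF.f0]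

theorem Form.Ew_lam (hD : HasDiophantineExponent θ r) (hF : Form θ f g F a b) (w : ℂ) :
    Ew θ f g (lam θ * w) = lam θ * Ew θ f g w - g w / f 0 := by
  have h1 := pw_coh hD hF.entSeq_g w
  rw [← mul_pw_coeff f hF.hg hF.g0 hF.g1, ← h1, Ew, Ew, ← eg]
  have := lam_ne_zero θ
  field_simp
  ring

theorem Theta_ThetaInv (hf : f 0 ≠ 0) (p : ℂ × ℂ) : Theta f (ThetaInv f p) = p := by
  simp only [Theta, ThetaInv]
  ext
  · rcases eq_or_ne p.1 0 with h | h
    · simp [h]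
    · field_simp
  · rfl

theorem ThetaInv_Theta (hf : f 0 ≠ 0) (p : ℂ × ℂ) : ThetaInv f (Theta f p) = p :=
  Theta_ThetaInv hf p

theorem Form.F_Theta (hF : Form θ f g F a b) (p : ℂ × ℂ) :
    F (Theta f p) = Theta f (Ftilde f F p) := by
  rw [Ftilde, Function.comp, Function.comp, Theta_ThetaInv hF.f0]

theorem isBigO_comp_Theta {c : ℂ × ℂ → ℂ} (hc : Differentiable ℂ c) (δ : ℝ) :
    (fun p => c (Theta f p)) =O[Gl δ] (fun _ => (1 : ℂ)) ∧
    (fun p => c (Theta f p) - c (0, p.2)) =O[Gl δ] fun p => p.1⁻¹ := by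
  obtain ⟨C, hC, h1, h2⟩ := exists_lipschitz_of_differentiable hc (max 1 δ)
  have hz : ∀ p : ℂ × ℂ, (Theta f p).1 = -(f 0)⁻¹ * p.1⁻¹ := fun p => by
    simp only [Theta]; rw [neg_div, one_div, mul_inv]; ring
  have hs : ∀ᶠ p in Gl δ, ‖Theta f p‖ ≤ max 1 δ := by
    have ht : Tendsto (fun p : ℂ × ℂ => ‖-(f 0)⁻¹ * p.1⁻¹‖) (Gl δ) (𝓝 0) := by
      have := ((tendsto_inv_Gl δ).const_mul (-(f 0)⁻¹)).norm
      simpa using this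
    filter_upwards [ht.eventually_le_const one_pos, eventually_snd_Gl δ] with p h1 h2
    refine max_le_iff.2 ⟨?_, ?_⟩
    · rw [hz]; exact h1.trans (le_max_left _ _)
    · exact h2.le.trans (le_max_right _ _)
  constructor
  · refine Asymptotics.IsBigO.of_bound C ?_
    filter_upwards [hs] with p hp
    simpa using h1 _ hp
  · refine Asymptotics.IsBigO.of_bound (C * ‖(f 0)⁻¹‖) ?_
    filter_upwards [hs] with p hp
    have h3 : ‖((0 : ℂ), p.2)‖ ≤ max 1 δ :=
      (norm_prod_le_iff.2 ⟨by rw [norm_zero]; exact norm_nonneg (Theta f p),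
        norm_snd_le (Theta f p)⟩ : ‖((0 : ℂ), p.2)‖ ≤ ‖Theta f p‖).trans hp
    refine (h2 _ _ hp h3).trans ?_
    rw [mul_assoc]
    gcongr
    refine norm_prod_le_iff.2 ⟨?_, ?_⟩
    · rw [Prod.fst_sub, hz, sub_zero, norm_mul, norm_neg]
    · simp only [Theta, Prod.snd_sub, sub_self, norm_zero]
      positivity

theorem Form.isBigO_Ftilde (hF : Form θ f g F a b) (δ : ℝ) :
    (fun p => (Ftilde f F p).1 - (p.1 + f p.2 / f 0 + kap f a p.2 * p.1⁻¹)) =O[Gl δ]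
      (fun p => p.1⁻¹ ^ 2) ∧
    (fun p => (Ftilde f F p).2 - (lam θ * p.2 - g p.2 / f 0 * p.1⁻¹)) =O[Gl δ]
      (fun p => p.1⁻¹ ^ 2) := by
  have hf0 := hF.f0
  have hz : ∀ p : ℂ × ℂ, (Theta f p).1 = -(f 0)⁻¹ * p.1⁻¹ := fun p => by
    simp only [Theta]; rw [neg_div, one_div, mul_inv]; ring
  have hFT : ∀ p : ℂ × ℂ, F (Theta f p) = _ := fun p => hF.eq (Theta f p).1 (Theta f p).2
  set J : ℂ × ℂ → ℂ := fun p => p.1⁻¹ with hJ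
  have hJt : Tendsto J (Gl δ) (𝓝 0) := tendsto_inv_Gl δ
  have hJ1 : J =O[Gl δ] fun _ => (1 : ℂ) := hJt.isBigO_one ℂ
  constructor
  · set φ : ℂ × ℂ → ℂ := fun p => f p.2 / f 0 with hφ
    set α : ℂ × ℂ → ℂ := fun p => a (Theta f p) / f 0 ^ 2 with hα
    set κ : ℂ × ℂ → ℂ := fun p => kap f a p.2 with hκ
    set s : ℂ × ℂ → ℂ := fun p => -φ p * J p + α p * J p ^ 2 with hs
    have hφ1 : φ =O[Gl δ] fun _ => (1 : ℂ) := isBigO_snd (c := fun w => f w / f 0)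
      (by have := hF.hf; fun_prop) δ
    have hκ1 : κ =O[Gl δ] fun _ => (1 : ℂ) := isBigO_snd hF.differentiable_kap δ
    have hα1 : α =O[Gl δ] fun _ => (1 : ℂ) := by
      have := (isBigO_comp_Theta (f := f) hF.ha δ).1.mul
        (Asymptotics.isBigO_refl (fun _ => (f 0 ^ 2)⁻¹) (Gl δ))
      exact this.trans (Asymptotics.isBigO_const_const _ one_ne_zero _)
    have hαd : (fun p => α p - a (0, p.2) / f 0 ^ 2) =O[Gl δ] J := by
      have := (isBigO_comp_Theta (f := f) hF.ha δ).2.const_mul_left (f 0 ^ 2)⁻¹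
      refine this.congr_left fun p => ?_
      simp only [hα]; ring
    have hsO : s =O[Gl δ] J := by
      have h1 := hφ1.neg_left.mul (Asymptotics.isBigO_refl J (Gl δ))
      have h2 := (hα1.mul hJ1).mul (Asymptotics.isBigO_refl J (Gl δ))
      simp only [one_mul] at h1 h2
      refine (h1.add h2).congr_left fun p => ?_
      simp only [hs]; ring
    have hst : Tendsto s (Gl δ) (𝓝 0) := hsO.trans_tendsto hJt
    have hinv : (fun p => (1 + s p)⁻¹) =O[Gl δ] fun _ => (1 : ℂ) := by
      have : Tendsto (fun p => (1 + s p)⁻¹) (Gl δ) (𝓝 (1 + 0)⁻¹) :=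
        (hst.const_add 1).inv₀ (by simp)
      exact this.isBigO_one ℂ
    have hnum : (fun p => -((α p - a (0, p.2) / f 0 ^ 2) * J p + (α p * φ p - κ p * φ p) * J p ^ 2
        + α p * κ p * J p * J p ^ 2)) =O[Gl δ] fun p => J p ^ 2 := by
      have r2 := Asymptotics.isBigO_refl (fun p => J p ^ 2) (Gl δ)
      have h1 := hαd.mul (Asymptotics.isBigO_refl J (Gl δ))
      have h2 := ((hα1.mul hφ1).sub (hκ1.mul hφ1)).mul r2
      have h3 := ((hα1.mul hκ1).mul hJ1).mul r2
      simp only [one_mul] at h2 h3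
      exact (((h1.congr_right fun p => (sq (J p)).symm).add h2).add h3).neg_left
    have := hnum.mul hinv
    simp only [mul_one] at this
    refine this.congr' ?_ EventuallyEq.rfl
    have hev : ∀ᶠ p in Gl δ, 1 + s p ≠ 0 := by
      have : Tendsto (fun p => 1 + s p) (Gl δ) (𝓝 (1 + 0)) := hst.const_add 1
      exact this.eventually_ne (by simp)
    filter_upwards [hev, (tendsto_norm_fst_Gl δ).eventually_gt_atTop 0] with p hp hp0
    have hu : p.1 ≠ 0 := norm_pos_iff.1 hp0
    have h1 : (Ftilde f F p).1 = p.1 / (1 + s p) := by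
      have hz' : (F (Theta f p)).1 = -(f 0)⁻¹ * p.1⁻¹ * (1 + s p) := by
        rw [hFT]
        simp only [hz, hs, hφ, hα, hJ]
        have : (Theta f p).2 = p.2 := rfl
        have h2 : a (-(f 0)⁻¹ * p.1⁻¹, p.2) = a (Theta f p) := by rw [← hz]; rfl
        rw [this, h2]
        field_simp
        ring
      simp only [Ftilde, ThetaInv, Function.comp]
      rw [hz']
      field_simp
    rw [h1]
    have hκe : kap f a p.2 = φ p ^ 2 - a (0, p.2) / f 0 ^ 2 := rfl
    have hφe : f p.2 / f 0 = φ p := rfl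
    have huJ : p.1 * J p = 1 := mul_inv_cancel₀ hu
    have hJe : p.1⁻¹ = J p := rfl
    simp only [hφe, hJe]
    rw [eq_comm, sub_eq_iff_eq_add, div_eq_iff hp, add_mul, mul_assoc _ _ (1 + s p),
      inv_mul_cancel₀ hp]
    simp only [hs, hκ]
    rw [hκe]
    linear_combination (φ p - α p * J p) * huJ
  · have h1 := ((isBigO_comp_Theta (f := f) hF.hb δ).1.const_mul_left ((f 0)⁻¹ ^ 2)).mul
      (Asymptotics.isBigO_refl (fun p => J p ^ 2) (Gl δ))
    simp only [one_mul] at h1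
    refine h1.congr_left fun p => ?_
    have h2 : (Ftilde f F p).2 = (F (Theta f p)).2 := rfl
    rw [h2, hFT]
    simp only [hz]
    have : (Theta f p).2 = p.2 := rfl
    have h3 : b (-(f 0)⁻¹ * p.1⁻¹, p.2) = b (Theta f p) := by rw [← hz]; rfl
    rw [this, h3]
    ring

end

/-! ### The conjugations by `Phi` and `Psi` -/

/-- The second component of `Phi - id`. -/
def eta (θ : ℝ) (f g : ℂ → ℂ) (p : ℂ × ℂ) : ℂ := (lam θ)⁻¹ * (p.2 * Sg θ (eg θ f g) p)

/-- The normal form of `F` after the conjugation by `Theta ∘ Phi`. -/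
def N₁ (θ : ℝ) (f g : ℂ → ℂ) (a : ℂ × ℂ → ℂ) (p : ℂ × ℂ) : ℂ × ℂ :=
  (p.1 + f p.2 / f 0 + hfun θ f g a p.2 * p.1⁻¹, lam θ * p.2)

/-- The normal form of `F` after the conjugation by `Theta ∘ Phi ∘ Psi`. -/
def N₀ (θ : ℝ) (f g : ℂ → ℂ) (a : ℂ × ℂ → ℂ) (p : ℂ × ℂ) : ℂ × ℂ :=
  (p.1 + 1 + hfun θ f g a p.2 * p.1⁻¹, lam θ * p.2)

section

variable {θ r : ℝ} {f g : ℂ → ℂ} {F : ℂ × ℂ → ℂ × ℂ} {a b : ℂ × ℂ → ℂ}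

theorem Form.Phi_eq_eta (hD : HasDiophantineExponent θ r) (hF : Form θ f g F a b) {p : ℂ × ℂ}
    (hp : 0 < mm p.1) : Phi θ f g p = (p.1, p.2 + eta θ f g p) := Phi_eq hD hF.hg hp

theorem eventually_mm_pos (δ : ℝ) : ∀ᶠ p : ℂ × ℂ in Fl δ, 0 < mm p.1 :=
  (tendsto_mm_fst_Fl δ).eventually_gt_atTop 0

theorem isBigO_snd_Fl {c : ℂ → ℂ} (hc : Differentiable ℂ c) (δ : ℝ) :
    (fun p : ℂ × ℂ => c p.2) =O[Fl δ] fun _ => (1 : ℂ) :=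
  (isBigO_snd hc δ).mono (Fl_le_Gl δ)

theorem Form.isBigO_eta_sub (hD : HasDiophantineExponent θ r) (hF : Form θ f g F a b) (δ : ℝ) :
    (fun p => eta θ f g p - Ew θ f g p.2 * p.1⁻¹) =O[Fl δ] fun p => p.1⁻¹ ^ 2 := by
  have h1 := isBigO_Sg (pw_coh hD (hF.entSeq_g.coh hD))
    ((hF.entSeq_g.coh hD).coh hD).differentiable_pw δ
  have h2 := (isBigO_snd_Fl (c := fun w => (lam θ)⁻¹ * w) (by fun_prop) δ).mul h1
  simp only [one_mul] at h2
  refine h2.congr_left fun p => ?_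
  rw [eta, Ew, eg]
  ring

theorem Form.isBigO_eta (hD : HasDiophantineExponent θ r) (hF : Form θ f g F a b) (δ : ℝ) :
    eta θ f g =O[Fl δ] fun p => p.1⁻¹ := by
  have h1 := hF.isBigO_eta_sub hD δ
  have h2 := (isBigO_snd_Fl (hF.differentiable_Ew hD) δ).mul
    (Asymptotics.isBigO_refl (fun p : ℂ × ℂ => p.1⁻¹) (Fl δ))
  have h3 := (isBigO_inv_one δ).mul (Asymptotics.isBigO_refl (fun p : ℂ × ℂ => p.1⁻¹) (Fl δ))
  simp only [one_mul] at h2 h3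
  refine ((h1.trans (h3.congr_left fun p => (sq _).symm)).add h2).congr_left fun p => ?_
  ring

theorem Form.tendsto_eta (hD : HasDiophantineExponent θ r) (hF : Form θ f g F a b) (δ : ℝ) :
    Tendsto (eta θ f g) (Fl δ) (𝓝 0) := (hF.isBigO_eta hD δ).trans_tendsto (tendsto_inv_Fl δ)

theorem Form.asympId_Phi (hD : HasDiophantineExponent θ r) (hF : Form θ f g F a b) :
    AsympId (Phi θ f g) where
  diff δ := by
    have h1 := differentiableOn_Sg (θ := θ) (hF.differentiable_eg hD) δ
    have h2 : DifferentiableOn ℂ (fun p : ℂ × ℂ => (p.1, p.2 + eta θ f g p)) (Dom 0 δ) := by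
      unfold eta
      fun_prop
    exact h2.congr fun p hp => hF.Phi_eq_eta hD hp.1
  tendsto δ := by
    have h1 : Tendsto (fun p => ((0 : ℂ), eta θ f g p)) (Fl δ) (𝓝 (0, 0)) :=
      tendsto_const_nhds.prodMk_nhds (hF.tendsto_eta hD δ)
    refine h1.congr' ?_
    filter_upwards [eventually_mm_pos δ] with p hp
    rw [hF.Phi_eq_eta hD hp]
    ext <;> simp

theorem Form.isBigO_N₁ (hD : HasDiophantineExponent θ r) (hF : Form θ f g F a b) (δ : ℝ) :
    (fun p => (N₁ θ f g a p).1 - p.1) =O[Fl δ] fun _ => (1 : ℂ) := by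
  have h1 := isBigO_snd_Fl (c := fun w => f w / f 0) (by have := hF.hf; fun_prop) δ
  have h2 := (isBigO_snd_Fl (hF.differentiable_hfun hD) δ).mul (isBigO_inv_one δ)
  simp only [one_mul] at h2
  refine (h1.add h2).congr_left fun p => ?_
  rw [N₁]
  ring

theorem tendsto_Fl_of_isBigO {δ : ℝ} {Y : ℂ × ℂ → ℂ × ℂ}
    (h1 : (fun p => (Y p).1 - p.1) =O[Fl δ] fun _ => (1 : ℂ)) (h2 : ∀ p, ‖(Y p).2‖ = ‖p.2‖) :
    Tendsto Y (Fl δ) (Fl δ) := by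
  refine tendsto_Fl_iff.2 ⟨tendsto_mm_of_isBigO h1, ?_⟩
  filter_upwards [eventually_snd_Fl δ] with p hp
  rwa [h2]

theorem Form.tendsto_N₁ (hD : HasDiophantineExponent θ r) (hF : Form θ f g F a b) (δ : ℝ) :
    Tendsto (N₁ θ f g a) (Fl δ) (Fl δ) :=
  tendsto_Fl_of_isBigO (hF.isBigO_N₁ hD δ) fun _ => norm_lam_mul _ _

theorem Form.isBigO_Ftilde_Phi (hD : HasDiophantineExponent θ r) (hF : Form θ f g F a b) (δ : ℝ) :
    (fun p => Ftilde f F (Phi θ f g p) - Phi θ f g (N₁ θ f g a p)) =O[Fl δ]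
      fun p => p.1⁻¹ ^ 2 := by
  set η := eta θ f g with hη
  have hΦ : Tendsto (Phi θ f g) (Fl δ) (Gl (δ + 1)) :=
    ((hF.asympId_Phi hD).tendsto_Fl (lt_add_one δ)).mono_right (Fl_le_Gl _)
  have hJJ := Asymptotics.isBigO_refl (fun p : ℂ × ℂ => p.1⁻¹) (Fl δ)
  have hev : ∀ᶠ p in Fl δ, Phi θ f g p = (p.1, p.2 + η p) := by
    filter_upwards [eventually_mm_pos δ] with p hp using hF.Phi_eq_eta hD hp
  have hηt : Tendsto η (Fl δ) (𝓝 0) := hF.tendsto_eta hD δ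
  have hηO : η =O[Fl δ] fun p => p.1⁻¹ := hF.isBigO_eta hD δ
  have hηs := hF.isBigO_eta_sub hD δ
  have hN := hF.isBigO_N₁ hD δ
  have hevN : ∀ᶠ p in Fl δ, Phi θ f g (N₁ θ f g a p) =
      ((N₁ θ f g a p).1, lam θ * p.2 + η (N₁ θ f g a p)) := by
    filter_upwards [(hF.tendsto_N₁ hD δ).eventually (eventually_mm_pos δ)] with p hp
      using hF.Phi_eq_eta hD hp
  refine Asymptotics.IsBigO.congr' (f₁ := fun p =>
    ((Ftilde f F (Phi θ f g p)).1 - (N₁ θ f g a p).1,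
      (Ftilde f F (Phi θ f g p)).2 - (lam θ * p.2 + η (N₁ θ f g a p))))
    (g₁ := fun p => p.1⁻¹ ^ 2) (Asymptotics.IsBigO.prod_left ?_ ?_)
    (by filter_upwards [hevN] with p hp; rw [hp]; rfl) EventuallyEq.rfl
  · have r1 := (hF.isBigO_Ftilde (δ + 1)).1.comp_tendsto hΦ
    have h1 := (isBigO_comp_taylor hF.hf hηt).trans (hηO.pow 2)
    have h2 := (isBigO_snd_Fl (differentiable_deriv hF.hf) δ).mul hηs
    have h3 := ((isBigO_comp_sub hF.differentiable_kap hηt).trans hηO).mul hJJ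
    simp only [one_mul] at h2
    have h4 := ((h1.add h2).const_mul_left (f 0)⁻¹).add (h3.congr_right fun p => (sq _).symm)
    refine (r1.add h4).congr' ?_ EventuallyEq.rfl
    filter_upwards [hev] with p hp
    simp only [Function.comp, hp, N₁, hfun, hη]
    ring
  · have r2 := (hF.isBigO_Ftilde (δ + 1)).2.comp_tendsto hΦ
    have h1 := ((isBigO_comp_sub hF.hg hηt).trans hηO).mul hJJ
    have h2 := isBigO_Sg_comp (pw_coh hD (hF.entSeq_g.coh hD))
      ((hF.entSeq_g.coh hD).coh hD).differentiable_pw (hF.differentiable_eg hD) hN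
    have h3 := (isBigO_snd_Fl (c := fun w => (lam θ)⁻¹ * (lam θ * w)) (by fun_prop) δ).mul h2
    simp only [one_mul] at h3
    have h4 := ((hηs.const_mul_left (lam θ)).sub
      ((h1.congr_right fun p => (sq _).symm).const_mul_left (f 0)⁻¹)).sub h3
    refine (r2.add h4).congr' ?_ EventuallyEq.rfl
    filter_upwards [hev] with p hp
    have h5 := hF.Ew_lam hD p.2
    have h6 : η (N₁ θ f g a p) = (lam θ)⁻¹ * (lam θ * p.2) *
        Sg θ (pw (coh θ fun l => coeff f g (l + 2))) ((N₁ θ f g a p).1, lam θ * p.2) := by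
      rw [mul_assoc]; rfl
    have h7 : Ew θ f g (lam θ * p.2) = -((lam θ)⁻¹ * (lam θ * p.2 *
      pw (coh θ fun l => coeff f g (l + 2)) (lam θ * p.2))) := rfl
    rw [h6]
    simp only [Function.comp, hp]
    rw [h7] at h5
    have h8 : eta θ f g p = η p := rfl
    rw [h8]
    linear_combination p.1⁻¹ * h5

theorem Form.isBigO_N₁_Psi (hD : HasDiophantineExponent θ r) (hF : Form θ f g F a b) (δ : ℝ) :
    (fun p => N₁ θ f g a (Psi θ f p) - Psi θ f (N₀ θ f g a p)) =O[Fl δ] fun p => p.1⁻¹ ^ 2 := by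
  have hX : (fun p : ℂ × ℂ => (p.1 + q θ f p.2) - p.1) =O[Fl δ] fun _ => (1 : ℂ) :=
    (isBigO_snd_Fl (hF.differentiable_q hD) δ).congr_left fun p => by ring
  have h1 := (isBigO_snd_Fl (hF.differentiable_hfun hD) δ).mul (isBigO_inv_sub_of_isBigO hX)
  simp only [one_mul] at h1
  refine (h1.prod_left (Asymptotics.isBigO_zero _ _)).congr_left fun p => ?_
  have := hF.q_lam hD p.2
  simp only [N₁, N₀, Psi]
  ext
  · simp only [Prod.fst_sub]
    linear_combination this
  · simp

theorem PsiInv_Psi (θ : ℝ) (f : ℂ → ℂ) (p : ℂ × ℂ) : PsiInv θ f (Psi θ f p) = p := by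
  simp [Psi, PsiInv]

theorem Psi_PsiInv (θ : ℝ) (f : ℂ → ℂ) (p : ℂ × ℂ) : Psi θ f (PsiInv θ f p) = p := by
  simp [Psi, PsiInv]

theorem Form.isBigO_Psi (hD : HasDiophantineExponent θ r) (hF : Form θ f g F a b) (δ : ℝ) :
    (fun p => (Psi θ f p).1 - p.1) =O[Fl δ] fun _ => (1 : ℂ) :=
  (isBigO_snd_Fl (hF.differentiable_q hD) δ).congr_left fun p => by simp [Psi]

theorem Form.tendsto_Psi (hD : HasDiophantineExponent θ r) (hF : Form θ f g F a b) (δ : ℝ) :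
    Tendsto (Psi θ f) (Fl δ) (Fl δ) :=
  tendsto_Fl_of_isBigO (hF.isBigO_Psi hD δ) fun _ => rfl

theorem Form.tendsto_PsiInv (hD : HasDiophantineExponent θ r) (hF : Form θ f g F a b) (δ : ℝ) :
    Tendsto (PsiInv θ f) (Fl δ) (Fl δ) :=
  tendsto_Fl_of_isBigO ((isBigO_snd_Fl (hF.differentiable_q hD) δ).neg_left.congr_left
    fun p => by simp [PsiInv]) fun _ => rfl

theorem Form.PsiInv_lipschitz (hD : HasDiophantineExponent θ r) (hF : Form θ f g F a b) (δ : ℝ) :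
    ∃ C : ℝ, 0 < C ∧ ∀ x y : ℂ × ℂ, ‖x.2‖ ≤ δ → ‖y.2‖ ≤ δ →
      ‖PsiInv θ f x - PsiInv θ f y‖ ≤ C * ‖x - y‖ := by
  obtain ⟨C, hC, -, h⟩ := exists_lipschitz_of_differentiable (hF.differentiable_q hD) δ
  refine ⟨1 + C, by positivity, fun x y hx hy => norm_prod_le_iff.2 ⟨?_, ?_⟩⟩
  · have h1 := h x.2 y.2 hx hy
    have h2 := norm_fst_le (x - y)
    have h3 : ‖x.2 - y.2‖ ≤ ‖x - y‖ := norm_snd_le (x - y)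
    have h4 := norm_sub_le (x - y).1 (q θ f x.2 - q θ f y.2)
    have h5 : (PsiInv θ f x - PsiInv θ f y).1 = (x - y).1 - (q θ f x.2 - q θ f y.2) := by
      simp only [PsiInv, Prod.fst_sub]; ring
    rw [h5]
    nlinarith
  · have h2 := norm_snd_le (x - y)
    have h3 : (PsiInv θ f x - PsiInv θ f y).2 = (x - y).2 := rfl
    rw [h3]
    nlinarith [norm_nonneg (x - y)]

/-- `F` in the coordinates `Theta ∘ Phi ∘ Psi`. -/
theorem Form.exists_step₀ (hD : HasDiophantineExponent θ r) (hF : Form θ f g F a b) (δ : ℝ) :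
    ∃ C : ℝ, 0 < C ∧ ∀ᶠ x in Fl δ, ∃ y, Phi θ f g (Psi θ f y) = Ftilde f F (Phi θ f g (Psi θ f x)) ∧
      ‖y - N₀ θ f g a x‖ ≤ C * ‖x.1⁻¹‖ ^ 2 := by
  have hΨ := hF.tendsto_Psi hD δ
  have r1 := ((hF.isBigO_Ftilde_Phi hD δ).comp_tendsto hΨ).trans
    ((isBigO_inv_of_isBigO (hF.isBigO_Psi hD δ)).pow 2)
  have r2 := hF.isBigO_N₁_Psi hD δ
  obtain ⟨C₁, hC₁, h1⟩ := r1.exists_pos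
  obtain ⟨C₂, hC₂, h2⟩ := r2.exists_pos
  obtain ⟨C, hC, hP⟩ := hF.PsiInv_lipschitz hD (δ + 1)
  have hJ : Tendsto (fun p : ℂ × ℂ => (C₁ + C₂) * ‖p.1⁻¹‖ ^ 2) (Fl δ) (𝓝 0) := by
    simpa using ((tendsto_inv_Fl δ).norm.pow 2).const_mul (C₁ + C₂)
  refine ⟨C * (2 * C₁ + C₂), by positivity, ?_⟩
  filter_upwards [h1.bound, h2.bound, hJ.eventually_le_const (u := 1 / 4) (by norm_num),
    ((hF.tendsto_N₁ hD δ).comp hΨ).eventually ((hF.asympId_Phi hD).solve δ),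
    eventually_snd_Fl δ] with x hx1 hx2 hx3 hx4 hx5
  simp only [Function.comp, norm_pow] at hx1 hx2 hx4
  have hJ0 : 0 ≤ ‖x.1⁻¹‖ ^ 2 := by positivity
  obtain ⟨y, hy1, hy2⟩ := hx4 _ (hx1.trans (by nlinarith))
  refine ⟨PsiInv θ f y, by rw [Psi_PsiInv, hy1], ?_⟩
  have e1 : ‖(N₁ θ f g a (Psi θ f x)).2‖ = ‖x.2‖ := norm_lam_mul _ _
  have e2 : ‖(Psi θ f (N₀ θ f g a x)).2‖ = ‖x.2‖ := norm_lam_mul _ _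
  have h3 : ‖y.2‖ ≤ δ + 1 := by
    have h4 := (norm_snd_le (y - N₁ θ f g a (Psi θ f x))).trans hy2
    have h5 := norm_le_insert' y.2 (N₁ θ f g a (Psi θ f x)).2
    rw [Prod.snd_sub] at h4
    nlinarith
  have h4 := hP y (Psi θ f (N₀ θ f g a x)) h3 (by rw [e2]; linarith)
  rw [PsiInv_Psi] at h4
  refine h4.trans ?_
  rw [mul_assoc]
  gcongr
  have h5 := norm_sub_le_norm_sub_add_norm_sub y (N₁ θ f g a (Psi θ f x))
    (Psi θ f (N₀ θ f g a x))
  linarith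

/-- The function `h` of the normal form is `hfun`. -/
theorem Form.h_eq (hD : HasDiophantineExponent θ r) (hF : Form θ f g F a b) (w : ℂ) :
    h θ f g F w = hfun θ f g a w := by
  obtain ⟨C, hC, hstep⟩ := hF.exists_step₀ hD (‖w‖ + 1)
  obtain ⟨ρ, hρ, hn⟩ := (hF.asympId_Phi hD).nearId (‖w‖ + 1)
  have ht : Tendsto (fun x : ℝ => ((x : ℂ), w)) atTop (Fl (‖w‖ + 1)) := by
    refine tendsto_Fl_iff.2 ⟨?_, Eventually.of_forall fun x => lt_add_one _⟩
    simp only [mm, Complex.ofReal_re, Complex.ofReal_im, abs_zero, add_zero]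
    exact tendsto_id
  have hJ : Tendsto (fun x : ℝ => C * ‖(x : ℂ)⁻¹‖ ^ 2) atTop (𝓝 0) := by
    simpa using (((tendsto_inv_Fl _).comp ht).norm.pow 2).const_mul C
  have hN0 : Tendsto (N₀ θ f g a) (Fl (‖w‖ + 1)) (Fl (‖w‖ + 1)) := by
    refine tendsto_Fl_of_isBigO ?_ fun p => norm_lam_mul _ _
    have h2 := (isBigO_snd_Fl (hF.differentiable_hfun hD) (‖w‖ + 1)).mul (isBigO_inv_one _)
    simp only [one_mul] at h2
    refine ((Asymptotics.isBigO_refl (fun _ => (1 : ℂ)) _).add h2).congr_left fun p => ?_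
    rw [N₀]
    ring
  obtain ⟨Cq, hCq, hqb, -⟩ := exists_lipschitz_of_differentiable (hF.differentiable_q hD)
    (‖w‖ + 1)
  refine Tendsto.limUnder_eq ?_
  rw [tendsto_iff_norm_sub_tendsto_zero]
  have hlim : Tendsto (fun x : ℝ => C * ‖(x : ℂ)⁻¹‖) atTop (𝓝 0) := by
    simpa using (((tendsto_inv_Fl _).comp ht).norm).const_mul C
  refine squeeze_zero' (Eventually.of_forall fun x => norm_nonneg _) ?_ hlim
  filter_upwards [ht.eventually hstep, hJ.eventually_lt_const (u := 1) one_pos,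
    (hN0.comp ht).eventually (eventually_mem_Dom (ρ + 2 + 2 * Cq) (‖w‖ + 1)),
    eventually_gt_atTop 0] with x ⟨y, hy1, hy2⟩ hx2 hx3 hx0
  simp only [Function.comp] at hx3
  have hx0' : (x : ℂ) ≠ 0 := by exact_mod_cast hx0.ne'
  have hd := hy2.trans hx2.le
  have hy3 : ‖y.2‖ < ‖w‖ + 1 := by
    have h4 := (norm_snd_le (y - N₀ θ f g a (x, w))).trans hy2
    have h5 := norm_le_insert' y.2 (N₀ θ f g a (x, w)).2
    have e1 : ‖(N₀ θ f g a (x, w)).2‖ = ‖w‖ := norm_lam_mul _ _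
    rw [Prod.snd_sub] at h4
    linarith
  have hy4 : ρ < mm (Psi θ f y).1 := by
    have h4 := (norm_fst_le (y - N₀ θ f g a (x, w))).trans hd
    have h5 := (abs_le.1 (mm_add (N₀ θ f g a (x, w)).1 (y - N₀ θ f g a (x, w)).1)).1
    have h6 := (abs_le.1 (mm_add y.1 (q θ f y.2))).1
    have h7 := hqb y.2 hy3.le
    rw [Prod.fst_sub, add_sub_cancel] at h5
    rw [Prod.fst_sub] at h4
    have := hx3.1
    simp only [Psi]
    linarith
  have hG : Gtilde θ f g F (‖w‖ + 1) ((x : ℂ), w) = y := by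
    simp only [Gtilde, Function.comp]
    rw [← hy1]
    have hex : ∃ p ∈ {p : ℂ × ℂ | ‖p.2‖ < ‖w‖ + 1}, Phi θ f g p = Phi θ f g (Psi θ f y) :=
      ⟨Psi θ f y, hy3, rfl⟩
    have h1 := Function.invFunOn_mem hex
    have h2 := Function.invFunOn_eq hex
    have h3 : PhiInv θ f g (‖w‖ + 1) (Phi θ f g (Psi θ f y)) = Psi θ f y := by
      refine hn.injOn ⟨?_, h1⟩ ⟨hy4, hy3⟩ h2
      have := congrArg Prod.fst h2
      rw [Phi_fst, Phi_fst] at this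
      exact hy4.trans_eq (congrArg mm this.symm)
    rw [h3, PsiInv_Psi]
  rw [hG]
  have h8 : (x : ℂ) * (y.1 - x - 1) - hfun θ f g a w = x * (y - N₀ θ f g a (x, w)).1 := by
    simp only [N₀, Prod.fst_sub]
    field_simp
    ring
  rw [h8, norm_mul]
  have h9 := (norm_fst_le (y - N₀ θ f g a (x, w))).trans hy2
  calc ‖(x : ℂ)‖ * ‖(y - N₀ θ f g a (x, w)).1‖ ≤ ‖(x : ℂ)‖ * (C * ‖(x : ℂ)⁻¹‖ ^ 2) := by gcongr
    _ = C * ‖(x : ℂ)⁻¹‖ := by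
      have : ‖(x : ℂ)‖ ≠ 0 := norm_ne_zero_iff.2 hx0'
      rw [norm_inv]
      field_simp

end

/-! ### The total change of coordinates -/

/-- Taylor coefficients of `hfun - hfun 0`. -/
def cH (θ : ℝ) (f g : ℂ → ℂ) (a : ℂ × ℂ → ℂ) (l : ℕ) : ℂ :=
  coeff (fun _ => 1) (hfun θ f g a) (l + 1)

/-- The solution of the cohomological equation for `hfun - hfun 0`. -/
def eh (θ : ℝ) (f g : ℂ → ℂ) (a : ℂ × ℂ → ℂ) : ℂ → ℂ := pw (coh θ (cH θ f g a))

/-- The normal form of `F` in the coordinates `T`. -/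
def Nf (θ : ℝ) (f g : ℂ → ℂ) (F : ℂ × ℂ → ℂ × ℂ) (p : ℂ × ℂ) : ℂ × ℂ :=
  (p.1 + 1 + A θ f g F * p.1⁻¹, lam θ * p.2)

/-- The change of coordinates `T` without `Theta`. -/
def Lm (θ : ℝ) (f g : ℂ → ℂ) (F : ℂ × ℂ → ℂ × ℂ) (p : ℂ × ℂ) : ℂ × ℂ :=
  Phi θ f g (Psi θ f (tau θ f g F p))

theorem T_eq (θ : ℝ) (f g : ℂ → ℂ) (F : ℂ × ℂ → ℂ × ℂ) (p : ℂ × ℂ) :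
    T θ f g F p = Theta f (Lm θ f g F p) := rfl

section

variable {θ r : ℝ} {f g : ℂ → ℂ} {F : ℂ × ℂ → ℂ × ℂ} {a b : ℂ × ℂ → ℂ}

theorem Form.entSeq_cH (hD : HasDiophantineExponent θ r) (hF : Form θ f g F a b) :
    EntSeq (cH θ f g a) := entSeq_coeff _ (hF.differentiable_hfun hD)

theorem Form.pw_cH (hD : HasDiophantineExponent θ r) (hF : Form θ f g F a b) (w : ℂ) :
    pw (cH θ f g a) w = hfun θ f g a w - A θ f g F := by
  rw [A, hF.h_eq hD]
  have := pw_coeff (fun _ => 1) (hF.differentiable_hfun hD) w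
  rw [div_one] at this
  exact this

theorem Form.differentiable_eh (hD : HasDiophantineExponent θ r) (hF : Form θ f g F a b) :
    Differentiable ℂ (eh θ f g a) := ((hF.entSeq_cH hD).coh hD).differentiable_pw

theorem Form.tau_eq_Sg (hD : HasDiophantineExponent θ r) (hF : Form θ f g F a b) {p : ℂ × ℂ}
    (hp : 0 < mm p.1) : tau θ f g F p = (p.1 - Sg θ (eh θ f g a) p, p.2) :=
  tau_eq hD (hF.entSeq_cH hD) (fun w => by rw [hF.pw_cH hD, hF.h_eq hD]; ring) hp

theorem Form.isBigO_Sg_eh (hD : HasDiophantineExponent θ r) (hF : Form θ f g F a b) (δ : ℝ) :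
    Sg θ (eh θ f g a) =O[Fl δ] fun p => p.1⁻¹ := by
  have h1 := isBigO_Sg (pw_coh hD ((hF.entSeq_cH hD).coh hD))
    (((hF.entSeq_cH hD).coh hD).coh hD).differentiable_pw δ
  have h2 := (isBigO_snd_Fl (hF.differentiable_eh hD) δ).mul
    (Asymptotics.isBigO_refl (fun p : ℂ × ℂ => p.1⁻¹) (Fl δ))
  have h3 := (isBigO_inv_one δ).mul (Asymptotics.isBigO_refl (fun p : ℂ × ℂ => p.1⁻¹) (Fl δ))
  simp only [one_mul] at h2 h3
  refine ((h1.trans (h3.congr_left fun p => (sq _).symm)).sub h2).congr_left fun p => ?_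
  rw [eh]
  ring

theorem Form.tendsto_Sg_eh (hD : HasDiophantineExponent θ r) (hF : Form θ f g F a b) (δ : ℝ) :
    Tendsto (Sg θ (eh θ f g a)) (Fl δ) (𝓝 0) :=
  (hF.isBigO_Sg_eh hD δ).trans_tendsto (tendsto_inv_Fl δ)

theorem Form.asympId_tau (hD : HasDiophantineExponent θ r) (hF : Form θ f g F a b) :
    AsympId (tau θ f g F) where
  diff δ := by
    have h1 := differentiableOn_Sg (θ := θ) (hF.differentiable_eh hD) δ
    have h2 : DifferentiableOn ℂ (fun p : ℂ × ℂ => (p.1 - Sg θ (eh θ f g a) p, p.2))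
        (Dom 0 δ) := by
      fun_prop
    exact h2.congr fun p hp => hF.tau_eq_Sg hD hp.1
  tendsto δ := by
    have h1 : Tendsto (fun p => (-Sg θ (eh θ f g a) p, (0 : ℂ))) (Fl δ) (𝓝 (-0, 0)) :=
      (hF.tendsto_Sg_eh hD δ).neg.prodMk_nhds tendsto_const_nhds
    rw [neg_zero] at h1
    refine h1.congr' ?_
    filter_upwards [eventually_mm_pos δ] with p hp
    rw [hF.tau_eq_Sg hD hp]
    ext <;> simp

theorem Form.isBigO_tau (hD : HasDiophantineExponent θ r) (hF : Form θ f g F a b) (δ : ℝ) :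
    (fun p => (tau θ f g F p).1 - p.1) =O[Fl δ] fun _ => (1 : ℂ) := by
  refine (hF.tendsto_Sg_eh hD δ).neg.isBigO_one ℂ |>.congr' ?_ EventuallyEq.rfl
  filter_upwards [eventually_mm_pos δ] with p hp
  rw [hF.tau_eq_Sg hD hp]
  ring

theorem Form.tendsto_tau (hD : HasDiophantineExponent θ r) (hF : Form θ f g F a b) (δ : ℝ) :
    Tendsto (tau θ f g F) (Fl δ) (Fl δ) :=
  tendsto_Fl_of_isBigO (hF.isBigO_tau hD δ) fun _ => rfl

theorem isBigO_Nf (θ : ℝ) (f g : ℂ → ℂ) (F : ℂ × ℂ → ℂ × ℂ) (δ : ℝ) :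
    (fun p => (Nf θ f g F p).1 - p.1) =O[Fl δ] fun _ => (1 : ℂ) := by
  refine ((Asymptotics.isBigO_refl (fun _ => (1 : ℂ)) _).add
    ((isBigO_inv_one δ).const_mul_left (A θ f g F))).congr_left fun p => ?_
  rw [Nf]
  ring

theorem tendsto_Nf (θ : ℝ) (f g : ℂ → ℂ) (F : ℂ × ℂ → ℂ × ℂ) (δ : ℝ) :
    Tendsto (Nf θ f g F) (Fl δ) (Fl δ) :=
  tendsto_Fl_of_isBigO (isBigO_Nf θ f g F δ) fun _ => norm_lam_mul _ _

theorem Form.isBigO_N₀_tau (hD : HasDiophantineExponent θ r) (hF : Form θ f g F a b) (δ : ℝ) :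
    (fun p => N₀ θ f g a (tau θ f g F p) - tau θ f g F (Nf θ f g F p)) =O[Fl δ]
      fun p => p.1⁻¹ ^ 2 := by
  have h1 := isBigO_Sg (pw_coh hD ((hF.entSeq_cH hD).coh hD))
    (((hF.entSeq_cH hD).coh hD).coh hD).differentiable_pw δ
  have h2 := isBigO_Sg_comp (pw_coh hD ((hF.entSeq_cH hD).coh hD))
    (((hF.entSeq_cH hD).coh hD).coh hD).differentiable_pw (hF.differentiable_eh hD)
    (isBigO_Nf θ f g F δ)
  have h3 := (isBigO_snd_Fl (hF.differentiable_hfun hD) δ).mul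
    (isBigO_inv_sub_of_isBigO (hF.isBigO_tau hD δ))
  simp only [one_mul] at h3
  refine (((h3.add h2).sub h1).prod_left (Asymptotics.isBigO_zero _ _)).congr' ?_ EventuallyEq.rfl
  filter_upwards [eventually_mm_pos δ, (tendsto_Nf θ f g F δ).eventually (eventually_mm_pos δ)]
    with p hp hNp
  have h4 := pw_coh hD (hF.entSeq_cH hD) p.2
  rw [hF.pw_cH hD] at h4
  have h5 : N₀ θ f g a (tau θ f g F p) = ((tau θ f g F p).1 + 1 +
    hfun θ f g a p.2 * (tau θ f g F p).1⁻¹, lam θ * p.2) := rfl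
  rw [h5, hF.tau_eq_Sg hD hNp, hF.tau_eq_Sg hD hp]
  have h6 : Sg θ (eh θ f g a) (Nf θ f g F p) =
    Sg θ (pw (coh θ (cH θ f g a))) ((Nf θ f g F p).1, lam θ * p.2) := rfl
  rw [h6, eh]
  ext
  · simp only [Prod.fst_sub]
    simp only [Nf]
    linear_combination p.1⁻¹ * h4
  · simp [Nf]

/-- `F` in the coordinates `T`. -/
theorem Form.exists_step (hD : HasDiophantineExponent θ r) (hF : Form θ f g F a b) (δ : ℝ) :
    ∃ C : ℝ, 0 < C ∧ ∀ᶠ x in Fl δ, ∃ y, T θ f g F y = F (T θ f g F x) ∧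
      ‖y - Nf θ f g F x‖ ≤ C * ‖x.1⁻¹‖ ^ 2 := by
  obtain ⟨C₀, hC₀, h0⟩ := hF.exists_step₀ hD δ
  obtain ⟨C₁, hC₁, h1⟩ := (hF.isBigO_N₀_tau hD δ).exists_pos
  obtain ⟨C₂, hC₂, h2⟩ := ((isBigO_inv_of_isBigO (hF.isBigO_tau hD δ)).pow 2).exists_pos
  set C := C₀ * C₂ + C₁ with hC
  have hJ : Tendsto (fun p : ℂ × ℂ => C * ‖p.1⁻¹‖ ^ 2) (Fl δ) (𝓝 0) := by
    simpa using ((tendsto_inv_Fl δ).norm.pow 2).const_mul C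
  refine ⟨2 * C, by positivity, ?_⟩
  filter_upwards [(hF.tendsto_tau hD δ).eventually h0, h1.bound, h2.bound,
    hJ.eventually_le_const (u := 1 / 4) (by norm_num),
    (tendsto_Nf θ f g F δ).eventually ((hF.asympId_tau hD).solve δ)]
    with x ⟨y, hy1, hy2⟩ hx1 hx2 hx3 hx4
  simp only [norm_pow] at hx1 hx2
  have h3 : ‖y - tau θ f g F (Nf θ f g F x)‖ ≤ C * ‖x.1⁻¹‖ ^ 2 := by
    have h5 := norm_sub_le_norm_sub_add_norm_sub y (N₀ θ f g a (tau θ f g F x))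
      (tau θ f g F (Nf θ f g F x))
    rw [hC]
    nlinarith
  obtain ⟨z, hz1, hz2⟩ := hx4 y (h3.trans hx3)
  refine ⟨z, ?_, by linarith⟩
  rw [T_eq, T_eq, Lm, hz1, hy1, hF.F_Theta]
  rfl

theorem Form.tendsto_PsiInv_Lm (hD : HasDiophantineExponent θ r) (hF : Form θ f g F a b) (δ : ℝ) :
    Tendsto (fun x => PsiInv θ f (Lm θ f g F x) - x) (Fl δ) (𝓝 0) := by
  obtain ⟨C, hC, hP⟩ := hF.PsiInv_lipschitz hD (δ + 1)
  have ht : Tendsto (fun x => Psi θ f (tau θ f g F x)) (Fl δ) (Fl δ) :=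
    (hF.tendsto_Psi hD δ).comp (hF.tendsto_tau hD δ)
  have h1 := (((hF.asympId_Phi hD).tendsto δ).comp ht).norm
  have h2 := ((hF.asympId_tau hD).tendsto δ).norm
  have hlim := (h1.const_mul C).add h2
  simp only [norm_zero, mul_zero, add_zero] at hlim h1
  rw [tendsto_zero_iff_norm_tendsto_zero]
  refine squeeze_zero' (Eventually.of_forall fun x => norm_nonneg _) ?_ hlim
  filter_upwards [h1.eventually_le_const one_pos, eventually_snd_Fl δ] with x hx1 hx2
  simp only [Function.comp] at hx1 ⊢
  have e1 : (Psi θ f (tau θ f g F x)).2 = x.2 := rfl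
  have h3 := (norm_snd_le _).trans hx1
  have h4 := norm_le_insert' (Phi θ f g (Psi θ f (tau θ f g F x))).2 x.2
  rw [Prod.snd_sub, e1] at h3
  have h5 := hP (Phi θ f g (Psi θ f (tau θ f g F x))) (Psi θ f (tau θ f g F x))
    (by linarith) (by rw [e1]; linarith)
  rw [PsiInv_Psi] at h5
  have h6 := norm_sub_le_norm_sub_add_norm_sub (PsiInv θ f (Lm θ f g F x)) (tau θ f g F x) x
  rw [Lm] at h6 ⊢
  linarith

theorem Form.solve_Lm (hD : HasDiophantineExponent θ r) (hF : Form θ f g F a b) (δ : ℝ) {ε : ℝ}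
    (hε : 0 < ε) : ∀ᶠ y in Fl δ, ∃ x, Lm θ f g F x = y ∧ ‖x - PsiInv θ f y‖ ≤ ε := by
  obtain ⟨C, hC, hP⟩ := hF.PsiInv_lipschitz hD (δ + 1)
  have hΨ := hF.tendsto_PsiInv hD δ
  have h1 := ((hF.asympId_Phi hD).tendsto δ).norm
  have h2 := (((hF.asympId_tau hD).tendsto δ).comp hΨ).norm
  have hlim := ((h1.const_mul (2 * C)).add h2)
  simp only [norm_zero, mul_zero, add_zero] at hlim h1
  filter_upwards [(hF.asympId_Phi hD).solve δ, hΨ.eventually ((hF.asympId_tau hD).solve δ),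
    h1.eventually_le_const (u := 1 / 4) (by norm_num),
    hlim.eventually_le_const (u := min (1 / 4) (ε / 2)) (by positivity), eventually_snd_Fl δ]
    with y hy1 hy2 hy3 hy4 hy5
  simp only [Function.comp] at hy4
  obtain ⟨v, hv1, hv2⟩ := hy1 y (by rwa [norm_sub_rev])
  rw [norm_sub_rev y] at hv2
  have hv3 : ‖v.2‖ ≤ δ + 1 := by
    have h3 := (norm_snd_le (v - y)).trans hv2
    have h4 := norm_le_insert' v.2 y.2
    rw [Prod.snd_sub] at h3
    linarith
  have h3 := hP v y hv3 (by linarith)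
  have h4 := norm_sub_le_norm_sub_add_norm_sub (PsiInv θ f v) (PsiInv θ f y)
    (tau θ f g F (PsiInv θ f y))
  rw [norm_sub_rev (PsiInv θ f y) (tau θ f g F (PsiInv θ f y))] at h4
  have h5 : ‖PsiInv θ f v - tau θ f g F (PsiInv θ f y)‖ ≤ min (1 / 4) (ε / 2) := by
    have : C * ‖v - y‖ ≤ C * (2 * ‖Phi θ f g y - y‖) := by gcongr
    linarith
  obtain ⟨x, hx1, hx2⟩ := hy2 _ (h5.trans (min_le_left _ _))
  refine ⟨x, ?_, ?_⟩
  · rw [Lm, hx1, Psi_PsiInv, hv1]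
  · have := h5.trans (min_le_right _ _)
    linarith

theorem Form.injOn_Lm (hD : HasDiophantineExponent θ r) (hF : Form θ f g F a b) (δ : ℝ) :
    ∃ ρ : ℝ, 0 < ρ ∧ InjOn (Lm θ f g F) (Dom ρ δ) ∧ DifferentiableOn ℂ (Lm θ f g F) (Dom ρ δ) ∧
      ∀ x ∈ Dom ρ δ, 0 < mm (Lm θ f g F x).1 := by
  obtain ⟨ρ₁, hρ₁, h1⟩ := (hF.asympId_Phi hD).nearId δ
  obtain ⟨ρ₂, hρ₂, h2⟩ := (hF.asympId_tau hD).nearId δ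
  have ht : Tendsto (fun x => Psi θ f (tau θ f g F x)) (Fl δ) (Fl δ) :=
    (hF.tendsto_Psi hD δ).comp (hF.tendsto_tau hD δ)
  obtain ⟨ρ₃, hρ₃, h3⟩ := eventually_Fl.1 (ht.eventually (eventually_mem_Dom ρ₁ δ))
  have h23 : Dom (max ρ₂ ρ₃) δ ⊆ Dom ρ₂ δ := Dom_anti (le_max_left _ _) le_rfl
  have h33 : Dom (max ρ₂ ρ₃) δ ⊆ Dom ρ₃ δ := Dom_anti (le_max_right _ _) le_rfl
  refine ⟨max ρ₂ ρ₃, lt_max_of_lt_left hρ₂, ?_, ?_, ?_⟩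
  · intro x hx y hy hxy
    have h4 := h1.injOn (h3 x (h33 hx)) (h3 y (h33 hy)) hxy
    have h5 := congrArg (PsiInv θ f) h4
    rw [PsiInv_Psi, PsiInv_Psi] at h5
    exact h2.injOn (h23 hx) (h23 hy) h5
  · have hq := hF.differentiable_q hD
    have hΨ : Differentiable ℂ (Psi θ f) := by unfold Psi; fun_prop
    refine DifferentiableOn.comp (t := Dom 0 δ) ((hF.asympId_Phi hD).diff δ)
      (hΨ.comp_differentiableOn (((hF.asympId_tau hD).diff δ).mono
        (h23.trans (Dom_anti hρ₂.le le_rfl)))) fun x hx => ?_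
    exact Dom_anti hρ₁.le le_rfl (h3 x (h33 hx))
  · intro x hx
    exact hρ₁.trans (h3 x (h33 hx)).1

end

/-! ### The regions `K` -/

theorem arg_mem_iff (z : ℂ) :
    z.arg ∈ Icc (-(3 * Real.pi / 4)) (3 * Real.pi / 4) ↔ 0 ≤ mm z := by
  have hπ := Real.pi_pos
  have h1 : z.re = ‖z‖ * Real.cos |z.arg| := by rw [Real.cos_abs, Complex.norm_mul_cos_arg]
  have habs : |z.arg| ≤ Real.pi := Complex.abs_arg_le_pi z
  have h2 : |z.im| = ‖z‖ * Real.sin |z.arg| := by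
    have h3 : |Real.sin z.arg| = Real.sin |z.arg| := by
      rcases le_total 0 z.arg with h | h
      · rw [abs_of_nonneg h] at habs ⊢
        exact abs_of_nonneg (Real.sin_nonneg_of_nonneg_of_le_pi h habs)
      · rw [abs_of_nonpos h] at habs ⊢
        rw [Real.sin_neg]
        refine abs_of_nonpos ?_
        have := Real.sin_nonneg_of_nonneg_of_le_pi (neg_nonneg.2 h) habs
        rw [Real.sin_neg] at this
        linarith
    rw [← h3, ← Complex.norm_mul_sin_arg, abs_mul, abs_of_nonneg (norm_nonneg z)]
  have h4 : mm z = ‖z‖ * (√2 * Real.cos (|z.arg| - Real.pi / 4)) := by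
    rw [mm, h1, h2, Real.cos_sub, Real.cos_pi_div_four, Real.sin_pi_div_four]
    have : √2 * √2 = 2 := Real.mul_self_sqrt (by norm_num)
    linear_combination (-‖z‖ * (Real.cos |z.arg| + Real.sin |z.arg|) / 2) * this
  have h0 : z.arg ∈ Icc (-(3 * Real.pi / 4)) (3 * Real.pi / 4) ↔ |z.arg| ≤ 3 * Real.pi / 4 :=
    abs_le.symm
  have habs0 := abs_nonneg z.arg
  rw [h0, h4]
  constructor
  · intro h
    have := Real.cos_nonneg_of_neg_pi_div_two_le_of_le (x := |z.arg| - Real.pi / 4)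
      (by linarith) (by linarith)
    positivity
  · intro h
    by_contra! hlt
    have hz : 0 < ‖z‖ := by
      rw [norm_pos_iff]
      rintro rfl
      simp at hlt
      linarith
    have := Real.cos_neg_of_pi_div_two_lt_of_lt (x := |z.arg| - Real.pi / 4)
      (by linarith) (by linarith)
    have h5 : 0 < √2 := by positivity
    nlinarith [mul_pos hz (mul_pos h5 (neg_pos.2 this))]

theorem mm_sub_ofReal (u : ℂ) (R : ℝ) : mm (u - R) = mm u - R := by
  simp only [mm, Complex.sub_re, Complex.ofReal_re, Complex.sub_im, Complex.ofReal_im, sub_zero]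
  ring

theorem mem_K_iff {γ : ℝ → ℝ} {R δ : ℝ} {u : ℂ} :
    u ∈ K γ R δ ↔ -γ δ ≤ u.re ∧ R ≤ mm u := by
  have hset : {u : ℂ | -γ δ < u.re ∧
      (u - (R : ℂ)).arg ∈ Icc (-(3 * Real.pi / 4)) (3 * Real.pi / 4)} =
      {u : ℂ | -γ δ < u.re ∧ R ≤ mm u} := by
    ext u
    change (_ ∧ _) ↔ (_ ∧ _)
    rw [arg_mem_iff, mm_sub_ofReal, sub_nonneg]
  rw [K, hset]
  constructor
  · intro h
    have hcl : IsClosed {u : ℂ | -γ δ ≤ u.re ∧ R ≤ mm u} :=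
      (isClosed_le continuous_const Complex.continuous_re).inter
        (isClosed_le continuous_const continuous_mm)
    have hsub : {u : ℂ | -γ δ < u.re ∧ R ≤ mm u} ⊆ {u : ℂ | -γ δ ≤ u.re ∧ R ≤ mm u} :=
      fun u hu => ⟨le_of_lt hu.1, hu.2⟩
    exact closure_minimal hsub hcl h
  · rintro ⟨h1, h2⟩
    refine mem_closure_of_tendsto (f := fun n : ℕ => u + (1 / ((n : ℝ) + 1) : ℝ)) (b := atTop)
      ?_ (Eventually.of_forall fun n => ?_)
    · have := (Complex.continuous_ofReal.tendsto 0).comp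
        (tendsto_one_div_add_atTop_nhds_zero_nat (𝕜 := ℝ))
      simpa using this.const_add u
    · have : (0 : ℝ) < 1 / ((n : ℝ) + 1) := by positivity
      constructor
      · rw [Complex.add_re, Complex.ofReal_re]
        linarith
      · simp only [mm, Complex.add_re, Complex.ofReal_re, Complex.add_im, Complex.ofReal_im,
          add_zero] at h2 ⊢
        linarith

/-! ### Estimates for the logarithm -/

theorem norm_log_add_sub_le {u s : ℂ} (hu : 0 < mm u) (hs : 4 * ‖s‖ ≤ mm u) :
    ‖Complex.log (u + s) - Complex.log u - s * u⁻¹‖ ≤ 2 * ‖s‖ ^ 2 * ‖u⁻¹‖ ^ 2 := by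
  have hm := mm_le_norm u
  have hu0 : 0 < ‖u‖ := norm_pos_of_mm_pos hu
  have hv : ∀ v ∈ Metric.closedBall u ‖s‖, 0 < mm v ∧ ‖u‖ / 2 ≤ ‖v‖ := by
    intro v hv
    have h1 : ‖v - u‖ ≤ ‖s‖ := by simpa [dist_eq_norm] using hv
    have h2 := (abs_le.1 (mm_add u (v - u))).1
    have h3 := norm_le_insert v u
    rw [add_sub_cancel] at h2
    exact ⟨by linarith, by linarith⟩
  have key := (convex_closedBall u ‖s‖).norm_image_sub_le_of_norm_hasDerivWithin_le
    (f := fun v => Complex.log v - v * u⁻¹) (f' := fun v => v⁻¹ - u⁻¹)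
    (C := 2 * ‖s‖ * ‖u⁻¹‖ ^ 2) (x := u) (y := u + s) (𝕜 := ℂ)
    (fun v hv' => by
      have h1 := Complex.hasDerivAt_log (mem_slitPlane_of_mm_pos (hv v hv').1)
      have h2 := (hasDerivAt_id v).mul_const u⁻¹
      rw [one_mul] at h2
      exact (h1.sub h2).hasDerivWithinAt)
    (fun v hv' => by
      obtain ⟨h1, h2⟩ := hv v hv'
      have h3 : ‖v - u‖ ≤ ‖s‖ := by simpa [dist_eq_norm] using hv'
      have hv0 : v ≠ 0 := norm_pos_iff.1 (norm_pos_of_mm_pos h1)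
      have hu0' : u ≠ 0 := norm_pos_iff.1 hu0
      have h4 : v⁻¹ - u⁻¹ = -(v - u) * v⁻¹ * u⁻¹ := by field_simp; ring
      rw [h4, norm_mul, norm_mul, norm_neg]
      have h5 : ‖v⁻¹‖ ≤ 2 * ‖u⁻¹‖ := by
        rw [norm_inv, norm_inv, ← inv_inv (2 : ℝ), ← mul_inv]
        apply inv_anti₀ (by positivity)
        linarith
      calc ‖v - u‖ * ‖v⁻¹‖ * ‖u⁻¹‖ ≤ ‖s‖ * (2 * ‖u⁻¹‖) * ‖u⁻¹‖ := by gcongr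
        _ = _ := by ring)
    (by simp) (by simp)
  calc ‖Complex.log (u + s) - Complex.log u - s * u⁻¹‖
      = ‖Complex.log (u + s) - (u + s) * u⁻¹ - (Complex.log u - u * u⁻¹)‖ := by congr 1; ring
    _ ≤ 2 * ‖s‖ * ‖u⁻¹‖ ^ 2 * ‖u + s - u‖ := key
    _ = _ := by rw [add_sub_cancel_left]; ring

theorem norm_log_add_sub_le' {u s : ℂ} (hu : 0 < mm u) (hs : 4 * ‖s‖ ≤ mm u) :
    ‖Complex.log (u + s) - Complex.log u‖ ≤ 2 * ‖s‖ * ‖u⁻¹‖ := by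
  have h1 := norm_log_add_sub_le hu hs
  have h2 := norm_le_insert' (Complex.log (u + s) - Complex.log u) (s * u⁻¹)
  rw [norm_mul] at h2
  have hu0 : 0 < ‖u‖ := norm_pos_of_mm_pos hu
  have h3 : ‖s‖ * ‖u⁻¹‖ ≤ 1 / 2 := by
    rw [norm_inv, ← div_eq_mul_inv, div_le_iff₀ hu0]
    have := mm_le_norm u
    linarith
  nlinarith [mul_nonneg (norm_nonneg s) (norm_nonneg u⁻¹)]

/-! ### Orbits in the coordinates `T` -/

theorem norm_inv_sq_le {u : ℂ} {m : ℝ} {n : ℕ} (hm : 1 ≤ m) (h : m + n / 2 ≤ mm u) :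
    ‖u⁻¹‖ ^ 2 ≤ 18 * ((2 * m + n) * (2 * m + n + 1))⁻¹ := by
  have hn : (0 : ℝ) ≤ n := n.cast_nonneg
  have h1 := mm_le_norm u
  have h2 : (2 * m + n) / 3 ≤ ‖u‖ := by linarith
  rw [norm_inv, inv_pow]
  calc (‖u‖ ^ 2)⁻¹ ≤ (((2 * m + n) / 3) ^ 2)⁻¹ := by gcongr
    _ ≤ ((2 * m + n) * (2 * m + n + 1) / 18)⁻¹ := by
      apply inv_anti₀ (by positivity)
      nlinarith
    _ = _ := by field_simp

/-- `y` is the orbit of `x` in the coordinates `T`, with the estimates for its steps. -/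
structure OrbitT (θ : ℝ) (f g : ℂ → ℂ) (F : ℂ × ℂ → ℂ × ℂ) (M : ℝ) (x : ℂ × ℂ)
    (y : ℕ → ℂ × ℂ) : Prop where
  zero : y 0 = x
  step : ∀ n, T θ f g F (y (n + 1)) = F (T θ f g F (y n))
  mm_le : ∀ n : ℕ, mm x.1 + n / 2 ≤ mm (y n).1
  snd_le : ∀ n, ‖(y n).2‖ ≤ ‖x.2‖ + M / mm x.1
  near : ∀ n, ‖y (n + 1) - Nf θ f g F (y n)‖ ≤ M * ‖(y n).1⁻¹‖ ^ 2
  fst_sub : ∀ n, ‖(y (n + 1)).1 - (y n).1 - 1‖ ≤ 1 / 8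

section

variable {θ r : ℝ} {f g : ℂ → ℂ} {F : ℂ × ℂ → ℂ × ℂ} {a b : ℂ × ℂ → ℂ}

theorem OrbitT.iterate {M : ℝ} {x : ℂ × ℂ} {y : ℕ → ℂ × ℂ} (h : OrbitT θ f g F M x y) (n : ℕ) :
    F^[n] (T θ f g F x) = T θ f g F (y n) := by
  induction n with
  | zero => rw [h.zero]; rfl
  | succ n ih => rw [Function.iterate_succ_apply', ih, h.step]

theorem Form.exists_orbitT (hD : HasDiophantineExponent θ r) (hF : Form θ f g F a b) (Δ : ℝ) :
    ∃ M : ℝ, 0 < M ∧ ∃ ρ : ℝ, 1 ≤ ρ ∧ M ≤ ρ ∧ ∀ x ∈ Dom ρ Δ, ∃ y, OrbitT θ f g F M x y := by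
  obtain ⟨C, hC, hstep⟩ := hF.exists_step hD (Δ + 1)
  have hlim : Tendsto (fun p : ℂ × ℂ => ‖A θ f g F‖ * ‖p.1⁻¹‖ + C * ‖p.1⁻¹‖ ^ 2) (Fl (Δ + 1))
      (𝓝 0) := by
    have h1 := (tendsto_inv_Fl (Δ + 1)).norm
    simpa using (h1.const_mul ‖A θ f g F‖).add ((h1.pow 2).const_mul C)
  obtain ⟨ρ₁, hρ₁, h1⟩ := eventually_Fl.1
    (hstep.and (hlim.eventually_le_const (u := 1 / 8) (by norm_num)))
  choose! st hst1 hst2 using fun x (hx : x ∈ Dom ρ₁ (Δ + 1)) => (h1 x hx).1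
  have hst3 : ∀ x ∈ Dom ρ₁ (Δ + 1), ‖(st x).1 - x.1 - 1‖ ≤ 1 / 8 := by
    intro x hx
    have h2 := (norm_fst_le (st x - Nf θ f g F x)).trans (hst2 x hx)
    have h3 := (h1 x hx).2
    have h4 := norm_add_le (A θ f g F * x.1⁻¹) (st x - Nf θ f g F x).1
    rw [norm_mul] at h4
    have h5 : (st x).1 - x.1 - 1 = A θ f g F * x.1⁻¹ + (st x - Nf θ f g F x).1 := by
      simp only [Nf, Prod.fst_sub]; ring
    rw [h5]
    linarith
  refine ⟨9 * C, by positivity, max (max ρ₁ 1) (9 * C),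
    (le_max_right _ _).trans (le_max_left _ _), le_max_right _ _, fun x hx => ?_⟩
  set m := mm x.1 with hm
  have hm1 : 1 ≤ m := ((le_max_right ρ₁ 1).trans (le_max_left _ _)).trans hx.1.le
  have hmρ : ρ₁ < m := ((le_max_left ρ₁ 1).trans (le_max_left _ _)).trans_lt hx.1
  have hmC : 9 * C ≤ m := (le_max_right _ _).trans hx.1.le
  have hsum : ∀ n : ℕ, ∑ k ∈ Finset.range n, C * (18 * ((2 * m + k) * (2 * m + k + 1))⁻¹) ≤
      9 * C / m := by
    intro n
    rw [← Finset.mul_sum, ← Finset.mul_sum]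
    calc C * (18 * ∑ k ∈ Finset.range n, ((2 * m + k) * (2 * m + k + 1))⁻¹)
        ≤ C * (18 * (2 * m)⁻¹) := by gcongr; exact sum_inv_mul_le (by positivity) n
      _ = 9 * C / m := by field_simp; norm_num
  have hone : 9 * C / m ≤ 1 := (div_le_one (by linarith)).2 hmC
  have key : ∀ n : ℕ, m + n / 2 ≤ mm (st^[n] x).1 ∧ ‖(st^[n] x).2‖ ≤ ‖x.2‖ +
      ∑ k ∈ Finset.range n, C * (18 * ((2 * m + k) * (2 * m + k + 1))⁻¹) := by
    intro n
    induction n with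
    | zero => simp [hm]
    | succ n ih =>
      have hn : (0 : ℝ) ≤ n := n.cast_nonneg
      have hmem : st^[n] x ∈ Dom ρ₁ (Δ + 1) :=
        ⟨by linarith [ih.1], by linarith [ih.2, hsum n, hx.2]⟩
      rw [Function.iterate_succ_apply', Finset.sum_range_succ]
      set z := st^[n] x
      constructor
      · have h2 := hst3 z hmem
        have h3 := (abs_le.1 (mm_add (z.1 + 1) ((st z).1 - z.1 - 1))).1
        have h4 : mm (z.1 + 1) = mm z.1 + 1 := by
          simp only [mm, Complex.add_re, Complex.one_re, Complex.add_im, Complex.one_im, add_zero]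
          ring
        rw [show z.1 + 1 + ((st z).1 - z.1 - 1) = (st z).1 by ring, h4] at h3
        push_cast
        linarith [ih.1]
      · have h2 := (norm_snd_le (st z - Nf θ f g F z)).trans (hst2 z hmem)
        have h3 := norm_inv_sq_le hm1 ih.1
        have h4 := norm_le_insert' (st z).2 (Nf θ f g F z).2
        have h5 : ‖(Nf θ f g F z).2‖ = ‖z.2‖ := norm_lam_mul _ _
        rw [Prod.snd_sub] at h2
        have h6 : C * ‖z.1⁻¹‖ ^ 2 ≤ C * (18 * ((2 * m + n) * (2 * m + n + 1))⁻¹) := by gcongr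
        linarith [ih.2]
  have hmem : ∀ n, st^[n] x ∈ Dom ρ₁ (Δ + 1) := fun n => by
    have hn : (0 : ℝ) ≤ n := n.cast_nonneg
    exact ⟨by linarith [(key n).1], by linarith [(key n).2, hsum n, hx.2]⟩
  refine ⟨fun n => st^[n] x, rfl, fun n => ?_, fun n => (key n).1,
    fun n => (key n).2.trans (by linarith [hsum n]), fun n => ?_, fun n => ?_⟩
  · rw [Function.iterate_succ_apply']
    exact hst1 _ (hmem n)
  · rw [Function.iterate_succ_apply']
    refine (hst2 _ (hmem n)).trans ?_
    gcongr
    linarith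
  · simp only [Function.iterate_succ_apply']
    exact hst3 _ (hmem n)

end

/-! ### The Fatou coordinate -/

/-- Removes the logarithmic term. -/
def Z (A : ℂ) (p : ℂ × ℂ) : ℂ × ℂ := (p.1 - A * Complex.log p.1, p.2)

/-- The `n`-th iterate of the inverse of `chi`. -/
def chiInv (θ : ℝ) (n : ℕ) (p : ℂ × ℂ) : ℂ × ℂ := (p.1 - n, (lam θ ^ n)⁻¹ * p.2)

theorem norm_chiInv_sub (θ : ℝ) (n : ℕ) (p q : ℂ × ℂ) :
    ‖chiInv θ n p - chiInv θ n q‖ = ‖p - q‖ := by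
  have h : chiInv θ n p - chiInv θ n q = (p.1 - q.1, (lam θ ^ n)⁻¹ * (p.2 - q.2)) := by
    simp only [chiInv]
    ext
    · simp
    · simp only [Prod.snd_sub]; ring
  rw [h, Prod.norm_def, Prod.norm_def, norm_mul, norm_inv, norm_lam_pow, inv_one, one_mul]
  rfl

theorem norm_Z_sub_le (A : ℂ) {p q : ℂ × ℂ} (hp : 4 ≤ mm p.1) (h : ‖q - p‖ ≤ 1) :
    ‖Z A q - Z A p‖ ≤ (1 + 2 * ‖A‖) * ‖q - p‖ := by
  have h1 := norm_fst_le (q - p)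
  have h2 := norm_snd_le (q - p)
  rw [Prod.fst_sub] at h1
  have h3 := norm_log_add_sub_le' (u := p.1) (s := q.1 - p.1) (by linarith) (by linarith)
  rw [add_sub_cancel] at h3
  have h4 : ‖p.1⁻¹‖ ≤ 1 := by
    rw [norm_inv]
    apply inv_le_one_of_one_le₀
    linarith [mm_le_norm p.1]
  refine norm_prod_le_iff.2 ⟨?_, ?_⟩
  · have h5 : (Z A q - Z A p).1 = (q.1 - p.1) - A * (Complex.log q.1 - Complex.log p.1) := by
      simp only [Z, Prod.fst_sub]; ring
    rw [h5]
    refine (norm_sub_le _ _).trans ?_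
    rw [norm_mul]
    have h6 : ‖Complex.log q.1 - Complex.log p.1‖ ≤ 2 * ‖q - p‖ := by
      refine h3.trans ?_
      have := norm_nonneg (q.1 - p.1)
      nlinarith [norm_nonneg p.1⁻¹]
    nlinarith [norm_nonneg A]
  · have h5 : (Z A q - Z A p).2 = (q - p).2 := rfl
    rw [h5]
    nlinarith [norm_nonneg A, norm_nonneg (q - p)]

/-- Approximations of the Fatou coordinate on the whole Fatou component. -/
def Qseq (θ : ℝ) (f g : ℂ → ℂ) (F : ℂ × ℂ → ℂ × ℂ) (n : ℕ) (p : ℂ × ℂ) : ℂ × ℂ :=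
  chiInv θ n (Z (A θ f g F) (PsiInv θ f (ThetaInv f (F^[n] p))))

/-- The Fatou coordinate. -/
def FC (θ : ℝ) (f g : ℂ → ℂ) (F : ℂ × ℂ → ℂ × ℂ) (p : ℂ × ℂ) : ℂ × ℂ :=
  limUnder atTop fun n => Qseq θ f g F n p

/-- The normalised orbit `y` in the coordinates `T`. -/
def ZH (θ : ℝ) (f g : ℂ → ℂ) (F : ℂ × ℂ → ℂ × ℂ) (y : ℕ → ℂ × ℂ) (n : ℕ) : ℂ × ℂ :=
  chiInv θ n (Z (A θ f g F) (y n))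

section

variable {θ r : ℝ} {f g : ℂ → ℂ} {F : ℂ × ℂ → ℂ × ℂ} {a b : ℂ × ℂ → ℂ}

theorem OrbitT.norm_ZH_sub_le {M : ℝ} (hM : 0 ≤ M) {x : ℂ × ℂ} {y : ℕ → ℂ × ℂ}
    (h : OrbitT θ f g F M x y) (hx : 5 ≤ mm x.1) (n : ℕ) :
    ‖ZH θ f g F y (n + 1) - ZH θ f g F y n‖ ≤
      (M + ‖A θ f g F‖ * (3 + ‖A θ f g F‖ + M)) * ‖(y n).1⁻¹‖ ^ 2 := by
  set α := A θ f g F with hα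
  set u := (y n).1 with hu
  set u' := (y (n + 1)).1 with hu'
  have hn : (0 : ℝ) ≤ n := n.cast_nonneg
  have hmu : 5 ≤ mm u := by linarith [h.mm_le n]
  have hJ1 : ‖u⁻¹‖ ≤ 1 := by
    rw [norm_inv]
    apply inv_le_one_of_one_le₀
    linarith [mm_le_norm u]
  have hJ0 := norm_nonneg u⁻¹
  have hα0 := norm_nonneg α
  have hnear := h.near n
  have h1 := (norm_fst_le _).trans hnear
  have h2 := (norm_snd_le _).trans hnear
  have hs := h.fst_sub n
  rw [← hu, ← hu'] at hs
  have hs1 : ‖u' - u‖ ≤ 9 / 8 := by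
    have := norm_le_insert' (u' - u) 1
    rw [norm_one] at this
    linarith
  set ρ := (y (n + 1) - Nf θ f g F (y n)).1 with hρ
  have hse : u' - u - 1 = α * u⁻¹ + ρ := by
    simp only [hρ, Nf, Prod.fst_sub]; ring
  have hlog := norm_log_add_sub_le (u := u) (s := u' - u) (by linarith) (by linarith)
  rw [add_sub_cancel] at hlog
  have hlog' : ‖Complex.log u' - Complex.log u - (u' - u) * u⁻¹‖ ≤ 3 * ‖u⁻¹‖ ^ 2 := by
    refine hlog.trans ?_
    have : ‖u' - u‖ ^ 2 ≤ (9 / 8) ^ 2 := by gcongr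
    have h0 : 0 ≤ ‖u⁻¹‖ ^ 2 := by positivity
    nlinarith
  have hs2 : ‖(u' - u - 1) * u⁻¹‖ ≤ (‖α‖ + M) * ‖u⁻¹‖ ^ 2 := by
    rw [hse, norm_mul]
    have h3 : ‖α * u⁻¹ + ρ‖ ≤ (‖α‖ + M) * ‖u⁻¹‖ := by
      refine (norm_add_le _ _).trans ?_
      rw [norm_mul]
      have : M * ‖u⁻¹‖ ^ 2 ≤ M * ‖u⁻¹‖ := by
        gcongr
        nlinarith
      linarith
    calc _ ≤ (‖α‖ + M) * ‖u⁻¹‖ * ‖u⁻¹‖ := by gcongr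
      _ = _ := by ring
  refine norm_prod_le_iff.2 ⟨?_, ?_⟩
  · have h3 : (ZH θ f g F y (n + 1) - ZH θ f g F y n).1 =
        ρ - α * ((Complex.log u' - Complex.log u - (u' - u) * u⁻¹) + (u' - u - 1) * u⁻¹) := by
      simp only [ZH, chiInv, Z, Prod.fst_sub]
      push_cast
      linear_combination hse
    rw [h3]
    refine (norm_sub_le _ _).trans ?_
    rw [norm_mul]
    have h4 := (norm_add_le (Complex.log u' - Complex.log u - (u' - u) * u⁻¹)
      ((u' - u - 1) * u⁻¹)).trans (add_le_add hlog' hs2)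
    calc _ ≤ M * ‖u⁻¹‖ ^ 2 + ‖α‖ * (3 * ‖u⁻¹‖ ^ 2 + (‖α‖ + M) * ‖u⁻¹‖ ^ 2) := by gcongr
      _ = _ := by ring
  · have hl := lam_ne_zero θ
    have h3 : (ZH θ f g F y (n + 1) - ZH θ f g F y n).2 =
        (lam θ ^ (n + 1))⁻¹ * (y (n + 1) - Nf θ f g F (y n)).2 := by
      simp only [ZH, chiInv, Z, Prod.snd_sub, Nf]
      rw [pow_succ]
      field_simp
    rw [h3, norm_mul, norm_inv, norm_lam_pow, inv_one, one_mul]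
    refine h2.trans ?_
    gcongr
    have : 0 ≤ ‖α‖ * (3 + ‖α‖ + M) := by positivity
    linarith

theorem OrbitT.exists_limit {M : ℝ} (hM : 0 ≤ M) {x : ℂ × ℂ} {y : ℕ → ℂ × ℂ}
    (h : OrbitT θ f g F M x y) (hx : 5 ≤ mm x.1) :
    ∃ G, Tendsto (ZH θ f g F y) atTop (𝓝 G) ∧ ∀ n : ℕ, ‖ZH θ f g F y n - G‖ ≤
      18 * (M + ‖A θ f g F‖ * (3 + ‖A θ f g F‖ + M)) / (2 * mm x.1 + n) := by
  set M₂ := M + ‖A θ f g F‖ * (3 + ‖A θ f g F‖ + M) with hM₂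
  have hM₂0 : 0 ≤ M₂ := by positivity
  set m := mm x.1
  set d : ℕ → ℝ := fun n => M₂ * (18 * ((2 * m + n) * (2 * m + n + 1))⁻¹) with hd
  have hdist : ∀ n, dist (ZH θ f g F y n) (ZH θ f g F y n.succ) ≤ d n := fun n => by
    rw [dist_comm, dist_eq_norm]
    refine (h.norm_ZH_sub_le hM hx n).trans ?_
    have := norm_inv_sq_le (by linarith : (1 : ℝ) ≤ m) (h.mm_le n)
    simp only [hd]
    gcongr
  have hsum : Summable d :=
    ((summable_inv_mul (by linarith : 0 < 2 * m)).mul_left 18).mul_left M₂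
  obtain ⟨G, hG⟩ := cauchySeq_tendsto_of_complete
    (cauchySeq_of_dist_le_of_summable d hdist hsum)
  refine ⟨G, hG, fun n => ?_⟩
  rw [← dist_eq_norm]
  refine (dist_le_tsum_of_dist_le_of_tendsto d hdist hsum hG n).trans ?_
  have hn : (0 : ℝ) ≤ n := n.cast_nonneg
  have h1 := tsum_inv_mul_le (t := 2 * m + n) (by linarith)
  simp only [hd]
  rw [tsum_mul_left, tsum_mul_left]
  push_cast
  simp only [← add_assoc]
  calc _ ≤ M₂ * (18 * (2 * m + n)⁻¹) := by gcongr
    _ = _ := by ring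

/-- The region `Dom ρ Δ` lies deep enough for the coordinates `T` and the Fatou coordinate. -/
structure Core (θ : ℝ) (f g : ℂ → ℂ) (F : ℂ × ℂ → ℂ × ℂ) (Δ M ρ : ℝ) : Prop where
  M_pos : 0 < M
  five_le : 5 ≤ ρ
  M_le : M ≤ ρ
  injOn : InjOn (Lm θ f g F) (Dom ρ (Δ + 1))
  diff : DifferentiableOn ℂ (Lm θ f g F) (Dom ρ (Δ + 1))
  near : ∀ x ∈ Dom ρ (Δ + 1), 0 < mm (Lm θ f g F x).1 ∧ ‖PsiInv θ f (Lm θ f g F x) - x‖ ≤ 1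
  unif : ∀ ε : ℝ, 0 < ε → ∃ N : ℕ, ∀ n ≥ N, ∀ x ∈ Dom ρ Δ,
    ‖Qseq θ f g F n (T θ f g F x) - FC θ f g F (T θ f g F x)‖ ≤ ε ∧
    ‖(F^[n] (T θ f g F x)).1‖ ≤ ε
  orbit : ∀ x ∈ Dom ρ Δ, ∃ y, OrbitT θ f g F M x y ∧ (∀ n, y n ∈ Dom ρ (Δ + 1)) ∧
    ∀ n : ℕ, ‖ZH θ f g F y n - FC θ f g F (T θ f g F x)‖ ≤ M / (2 * mm x.1 + n)

/-- The Fatou coordinate on a deep region, in the coordinates `T`. -/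
theorem Form.exists_core (hD : HasDiophantineExponent θ r) (hF : Form θ f g F a b) (Δ : ℝ) :
    ∃ M ρ : ℝ, Core θ f g F Δ M ρ := by
  obtain ⟨M, hM, ρ₁, hρ₁1, hρ₁M, h1⟩ := hF.exists_orbitT hD Δ
  obtain ⟨ρ₂, hρ₂, h2, h2', h2''⟩ := hF.injOn_Lm hD (Δ + 1)
  have he := (hF.tendsto_PsiInv_Lm hD (Δ + 1)).norm
  rw [norm_zero] at he
  obtain ⟨ρ₃, hρ₃, h3⟩ := eventually_Fl.1 (he.eventually_le_const one_pos)
  set M₂ := 18 * (M + ‖A θ f g F‖ * (3 + ‖A θ f g F‖ + M)) with hM₂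
  have hMM₂ : M ≤ M₂ := by
    have : 0 ≤ ‖A θ f g F‖ * (3 + ‖A θ f g F‖ + M) := by positivity
    linarith
  set ρ := max (max (max ρ₁ ρ₂) (max ρ₃ 5)) M₂ with hρ
  have e1 : ρ₁ ≤ ρ := (le_max_left _ _).trans ((le_max_left _ _).trans (le_max_left _ _))
  have e2 : ρ₂ ≤ ρ := (le_max_right _ _).trans ((le_max_left _ _).trans (le_max_left _ _))
  have e3 : ρ₃ ≤ ρ := (le_max_left _ _).trans ((le_max_right _ _).trans (le_max_left _ _))
  have e4 : 5 ≤ ρ := (le_max_right _ _).trans ((le_max_right _ _).trans (le_max_left _ _))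
  have e5 : M₂ ≤ ρ := le_max_right _ _
  have horb : ∀ x ∈ Dom ρ Δ, ∃ y, OrbitT θ f g F M x y ∧
      ∀ n : ℕ, y n ∈ Dom (ρ + n / 2) (Δ + 1) := by
    intro x hx
    obtain ⟨y, hy⟩ := h1 x (Dom_anti e1 le_rfl hx)
    refine ⟨y, hy, fun n => ⟨?_, ?_⟩⟩
    · linarith [hy.mm_le n, hx.1]
    · have h5 := hy.snd_le n
      have h6 : M / mm x.1 ≤ 1 := by
        rw [div_le_one (by linarith [hx.1])]
        linarith [hx.1]
      linarith [hx.2]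
  have hmem : ∀ x, ∀ n : ℕ, x ∈ Dom (ρ + n / 2) (Δ + 1) → x ∈ Dom ρ (Δ + 1) := fun x n hx =>
    Dom_anti (by have : (0 : ℝ) ≤ n := n.cast_nonneg; linarith) le_rfl hx
  have hTL : ∀ x, ThetaInv f (T θ f g F x) = Lm θ f g F x := fun x => ThetaInv_Theta hF.f0 _
  have hcmp : ∀ ε : ℝ, 0 < ε → ∃ N : ℕ, ∀ n ≥ N, ∀ x y, OrbitT θ f g F M x y →
      y n ∈ Dom (ρ + n / 2) (Δ + 1) → ‖Qseq θ f g F n (T θ f g F x) - ZH θ f g F y n‖ ≤ ε := by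
    intro ε hε
    set c := 1 + 2 * ‖A θ f g F‖ with hc
    have hc0 : 0 < c := by positivity
    obtain ⟨ρ₄, hρ₄, h4⟩ := eventually_Fl.1 (he.eventually_le_const
      (u := min 1 (ε / c)) (by positivity))
    obtain ⟨N, hN⟩ := exists_nat_ge (2 * ρ₄)
    refine ⟨N, fun n hn x y hy hyn => ?_⟩
    have hn' : (N : ℝ) ≤ n := by exact_mod_cast hn
    have h5 := h4 (y n) (Dom_anti (by linarith) le_rfl hyn)
    rw [Qseq, ZH, norm_chiInv_sub, hy.iterate, hTL]
    have hyn1 := hyn.1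
    have hn0 : (0 : ℝ) ≤ n := n.cast_nonneg
    refine (norm_Z_sub_le _ (by linarith) (h5.trans (min_le_left _ _))).trans ?_
    calc c * _ ≤ c * (ε / c) := by gcongr; exact h5.trans (min_le_right _ _)
      _ = ε := by field_simp
  have hFC : ∀ x ∈ Dom ρ Δ, ∀ y, OrbitT θ f g F M x y →
      (∀ n : ℕ, y n ∈ Dom (ρ + n / 2) (Δ + 1)) →
      ∀ n : ℕ, ‖ZH θ f g F y n - FC θ f g F (T θ f g F x)‖ ≤ M₂ / (2 * mm x.1 + n) := by
    intro x hx y hy hyn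
    obtain ⟨G, hG, hGn⟩ := hy.exists_limit hM.le (e4.trans hx.1.le)
    have hQ : Tendsto (fun n => Qseq θ f g F n (T θ f g F x)) atTop (𝓝 G) := by
      have h5 : Tendsto (fun n => Qseq θ f g F n (T θ f g F x) - ZH θ f g F y n) atTop (𝓝 0) := by
        rw [Metric.tendsto_atTop]
        intro ε hε
        obtain ⟨N, hN⟩ := hcmp (ε / 2) (by positivity)
        refine ⟨N, fun n hn => ?_⟩
        rw [dist_zero_right]
        linarith [hN n hn x y hy (hyn n)]
      simpa using h5.add hG
    have : FC θ f g F (T θ f g F x) = G := hQ.limUnder_eq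
    rw [this]
    exact hGn
  refine ⟨M₂, ρ, by linarith, e4, e5, h2.mono (Dom_anti e2 le_rfl),
    h2'.mono (Dom_anti e2 le_rfl), fun x hx => ⟨h2'' x (Dom_anti e2 le_rfl hx),
      h3 x (Dom_anti e3 le_rfl hx)⟩, fun ε hε => ?_, fun x hx => ?_⟩
  · obtain ⟨N₁, hN₁⟩ := hcmp (ε / 2) (by positivity)
    obtain ⟨N₂, hN₂⟩ := exists_nat_ge (2 * M₂ / ε)
    obtain ⟨Cq, hCq, hqb, -⟩ := exists_lipschitz_of_differentiable (hF.differentiable_q hD)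
      (Δ + 2)
    obtain ⟨N₃, hN₃⟩ := exists_nat_ge (4 * (Cq + 1) + 8 * (‖f 0‖⁻¹ / ε))
    refine ⟨max (max N₁ N₂) N₃, fun n hn x hx => ?_⟩
    obtain ⟨y, hy, hyn⟩ := horb x hx
    have hn1 : N₁ ≤ n := (le_max_left _ _).trans ((le_max_left _ _).trans hn)
    have hn2 : (N₂ : ℝ) ≤ n := by
      exact_mod_cast (le_max_right N₁ N₂).trans ((le_max_left _ _).trans hn)
    have hn3 : (N₃ : ℝ) ≤ n := by exact_mod_cast (le_max_right _ _).trans hn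
    constructor
    · have h5 := hN₁ n hn1 x y hy (hyn n)
      have h6 := hFC x hx y hy hyn n
      have h7 : M₂ / (2 * mm x.1 + n) ≤ ε / 2 := by
        have hx1 := hx.1
        have h0 : 2 * M₂ / ε ≤ 2 * mm x.1 + n := by linarith
        rw [div_le_iff₀ (by linarith)]
        rw [div_le_iff₀ hε] at h0
        linarith
      have := norm_sub_le_norm_sub_add_norm_sub (Qseq θ f g F n (T θ f g F x))
        (ZH θ f g F y n) (FC θ f g F (T θ f g F x))
      linarith
    · rw [hy.iterate]
      have h5 := h3 (y n) (Dom_anti e3 le_rfl (hmem _ n (hyn n)))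
      set v := Lm θ f g F (y n) with hv
      have h6 := (norm_fst_le (PsiInv θ f v - y n)).trans h5
      have h7 := (norm_snd_le (PsiInv θ f v - y n)).trans h5
      have h8 : (PsiInv θ f v - y n).1 = v.1 - q θ f v.2 - (y n).1 := rfl
      have h9 : (PsiInv θ f v - y n).2 = v.2 - (y n).2 := rfl
      rw [h8] at h6
      rw [h9] at h7
      have h10 : ‖v.2‖ ≤ Δ + 2 := by
        have := norm_le_insert' v.2 (y n).2
        linarith [(hyn n).2]
      have h11 := hqb v.2 h10
      have h12 : (n : ℝ) / 4 ≤ ‖(y n).1‖ := by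
        have := (hyn n).1
        have := mm_le_norm (y n).1
        have hn0 : (0 : ℝ) ≤ n := n.cast_nonneg
        linarith
      have h13 : n / 4 - (Cq + 1) ≤ ‖v.1‖ := by
        have h14 := norm_sub_le v.1 (q θ f v.2)
        have h15 := norm_le_insert (v.1 - q θ f v.2) (y n).1
        linarith
      have hf0 : 0 < ‖f 0‖ := norm_pos_iff.2 hF.f0
      have h16 : ‖f 0‖⁻¹ / ε ≤ ‖v.1‖ := by
        have : 0 ≤ ‖f 0‖⁻¹ / ε := by positivity
        linarith
      have h17 : (T θ f g F (y n)).1 = -1 / (f 0 * v.1) := rfl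
      rw [h17, norm_div, norm_neg, norm_one, norm_mul]
      have h18 : 0 < ‖f 0‖⁻¹ / ε := by positivity
      have h19 := h18.trans_le h16
      rw [div_le_iff₀ (by positivity)]
      calc (1 : ℝ) = ε * (‖f 0‖ * (‖f 0‖⁻¹ / ε)) := by field_simp
        _ ≤ _ := by gcongr
  · obtain ⟨y, hy, hyn⟩ := horb x hx
    refine ⟨y, ⟨hy.zero, hy.step, hy.mm_le, fun n => (hy.snd_le n).trans ?_,
      fun n => (hy.near n).trans ?_, hy.fst_sub⟩, fun n => hmem _ n (hyn n), hFC x hx y hy hyn⟩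
    · have := hx.1
      gcongr
      linarith
    · gcongr

end

/-! ### The basin -/

/-- The points off the `w`-axis whose orbits converge to the axis and stay bounded. -/
def Om (F : ℂ × ℂ → ℂ × ℂ) : Set (ℂ × ℂ) :=
  {p | p.1 ≠ 0 ∧ Tendsto (fun n => (F^[n] p).1) atTop (𝓝 0) ∧ ∃ B : ℝ, ∀ n, ‖(F^[n] p).2‖ ≤ B}

theorem IsAutomorphism.differentiable {F : ℂ × ℂ → ℂ × ℂ} (hA : IsAutomorphism F) :
    Differentiable ℂ F := differentiableOn_univ.1 hA.1

theorem IsAutomorphism.exists_inverse {F : ℂ × ℂ → ℂ × ℂ} (hA : IsAutomorphism F) :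
    ∃ P : ℂ × ℂ → ℂ × ℂ, Differentiable ℂ P ∧ Function.LeftInverse P F ∧
      Function.RightInverse P F := by
  obtain ⟨-, -, P, h1, -, h2, h3⟩ := hA
  exact ⟨P, differentiableOn_univ.1 h1, fun x => h2 (mem_univ x), fun x => h3 (mem_univ x)⟩

theorem IsAutomorphism.injective {F : ℂ × ℂ → ℂ × ℂ} (hA : IsAutomorphism F) :
    Function.Injective F := by
  obtain ⟨P, -, h, -⟩ := hA.exists_inverse
  exact h.injective

theorem IsAutomorphism.surjective {F : ℂ × ℂ → ℂ × ℂ} (hA : IsAutomorphism F) :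
    Function.Surjective F := by
  obtain ⟨P, -, -, h⟩ := hA.exists_inverse
  exact h.surjective

/-- The half-plane region `Re u > ρ`, `|w| < δ`. -/
def HP (ρ δ : ℝ) : Set (ℂ × ℂ) := {p | ρ < p.1.re ∧ ‖p.2‖ < δ}

theorem isOpen_HP (ρ δ : ℝ) : IsOpen (HP ρ δ) :=
  (isOpen_lt continuous_const (Complex.continuous_re.comp continuous_fst)).inter
    (isOpen_lt (continuous_norm.comp continuous_snd) continuous_const)

theorem HP_subset_Dom (ρ δ : ℝ) : HP ρ δ ⊆ Dom ρ δ := fun p hp =>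
  ⟨hp.1.trans_le (by rw [mm]; linarith [abs_nonneg p.1.im]), hp.2⟩

theorem HP_anti {ρ ρ' δ δ' : ℝ} (h : ρ ≤ ρ') (hδ : δ' ≤ δ) : HP ρ' δ' ⊆ HP ρ δ :=
  fun _ hp => ⟨h.trans_lt hp.1, hp.2.trans_le hδ⟩

theorem chi_chiInv_succ (θ : ℝ) (n : ℕ) (p : ℂ × ℂ) :
    chi θ (chiInv θ (n + 1) p) = chiInv θ n p := by
  have := lam_ne_zero θ
  simp only [chi, chiInv]
  ext
  · push_cast; ring
  · simp only; rw [pow_succ]; field_simp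

theorem chiInv_chiInv (θ : ℝ) (m n : ℕ) (p : ℂ × ℂ) :
    chiInv θ m (chiInv θ n p) = chiInv θ (n + m) p := by
  simp only [chiInv]
  ext
  · push_cast; ring
  · simp only; rw [pow_add, mul_inv]; ring

theorem chi_iterate (θ : ℝ) (n : ℕ) (p : ℂ × ℂ) :
    (chi θ)^[n] p = (p.1 + n, lam θ ^ n * p.2) := by
  induction n with
  | zero => simp
  | succ n ih =>
    rw [Function.iterate_succ_apply', ih, chi]
    ext
    · push_cast; ring
    · simp only; ring

theorem chiInv_chi_iterate (θ : ℝ) (n : ℕ) (p : ℂ × ℂ) : chiInv θ n ((chi θ)^[n] p) = p := by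
  have := lam_ne_zero θ
  rw [chi_iterate, chiInv]
  ext
  · simp
  · simp only; field_simp

theorem continuous_chiInv (θ : ℝ) (n : ℕ) : Continuous (chiInv θ n) := by
  unfold chiInv; fun_prop

theorem Qseq_iterate (θ : ℝ) (f g : ℂ → ℂ) (F : ℂ × ℂ → ℂ × ℂ) (n k : ℕ) (p : ℂ × ℂ) :
    Qseq θ f g F (n + k) p = chiInv θ k (Qseq θ f g F n (F^[k] p)) := by
  rw [Qseq, Qseq, chiInv_chiInv, Function.iterate_add_apply]

section

variable {θ r : ℝ} {f g : ℂ → ℂ} {F : ℂ × ℂ → ℂ × ℂ} {a b : ℂ × ℂ → ℂ}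

theorem Form.fst_eq_zero_iff (hF : Form θ f g F a b) (hA : IsAutomorphism F) (p : ℂ × ℂ) :
    (F p).1 = 0 ↔ p.1 = 0 := by
  have h0 : ∀ w, F (0, w) = (0, lam θ * w) := fun w => by rw [hF.eq]; simp
  constructor
  · intro h
    have h1 : F (0, (lam θ)⁻¹ * (F p).2) = F p := by
      rw [h0, mul_inv_cancel_left₀ (lam_ne_zero θ), ← h]
    rw [← hA.injective h1]
  · intro h
    have : p = (0, p.2) := by rw [← h]
    rw [this, h0]

theorem Form.iterate_fst_eq_zero_iff (hF : Form θ f g F a b) (hA : IsAutomorphism F) (n : ℕ)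
    (p : ℂ × ℂ) : (F^[n] p).1 = 0 ↔ p.1 = 0 := by
  induction n with
  | zero => rfl
  | succ n ih => rw [Function.iterate_succ_apply', hF.fst_eq_zero_iff hA, ih]

theorem Form.F_mem_Om_iff (hF : Form θ f g F a b) (hA : IsAutomorphism F) (p : ℂ × ℂ) :
    F p ∈ Om F ↔ p ∈ Om F := by
  simp only [Om, mem_ofPred_eq, hF.fst_eq_zero_iff hA, ne_eq, ← Function.iterate_succ_apply]
  refine and_congr_right fun _ => and_congr (tendsto_add_atTop_iff_nat
    (f := fun n => (F^[n] p).1) 1) ⟨?_, ?_⟩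
  · rintro ⟨B, hB⟩
    refine ⟨max B ‖p.2‖, fun n => ?_⟩
    cases n with
    | zero => exact le_max_right _ _
    | succ n => exact (hB n).trans (le_max_left _ _)
  · rintro ⟨B, hB⟩
    exact ⟨B, fun n => hB (n + 1)⟩

theorem Form.iterate_mem_Om_iff (hF : Form θ f g F a b) (hA : IsAutomorphism F) (n : ℕ)
    (p : ℂ × ℂ) : F^[n] p ∈ Om F ↔ p ∈ Om F := by
  induction n with
  | zero => rfl
  | succ n ih => rw [Function.iterate_succ_apply', hF.F_mem_Om_iff hA, ih]

theorem Core.T_fst_ne_zero {Δ M ρ : ℝ} (hF : Form θ f g F a b) (hC : Core θ f g F Δ M ρ)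
    {x : ℂ × ℂ} (hx : x ∈ Dom ρ (Δ + 1)) : (T θ f g F x).1 ≠ 0 := by
  have h1 : (Lm θ f g F x).1 ≠ 0 := norm_pos_iff.1 (norm_pos_of_mm_pos (hC.near x hx).1)
  rw [T_eq]
  exact div_ne_zero (by norm_num) (mul_ne_zero hF.f0 h1)

theorem Core.T_mem_Om {Δ M ρ : ℝ} (hF : Form θ f g F a b) (hC : Core θ f g F Δ M ρ)
    {x : ℂ × ℂ} (hx : x ∈ Dom ρ Δ) : T θ f g F x ∈ Om F := by
  refine ⟨hC.T_fst_ne_zero hF (Dom_anti le_rfl (by linarith) hx), ?_, Δ + 2, fun n => ?_⟩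
  · rw [Metric.tendsto_atTop]
    intro ε hε
    obtain ⟨N, hN⟩ := hC.unif (ε / 2) (by positivity)
    refine ⟨N, fun n hn => ?_⟩
    rw [dist_zero_right]
    linarith [(hN n hn x hx).2]
  · obtain ⟨y, hy, hyn, -⟩ := hC.orbit x hx
    rw [hy.iterate]
    have h1 := (norm_snd_le _).trans (hC.near _ (hyn n)).2
    have h2 : (PsiInv θ f (Lm θ f g F (y n)) - y n).2 = (T θ f g F (y n)).2 - (y n).2 := rfl
    rw [h2] at h1
    have h3 := norm_le_insert' (T θ f g F (y n)).2 (y n).2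
    linarith [(hyn n).2]

theorem tendsto_atTop_of_sub_ge {s : ℕ → ℝ} {c : ℝ} (hc : 0 < c)
    (h : ∀ᶠ n in atTop, c ≤ s (n + 1) - s n) : Tendsto s atTop atTop := by
  obtain ⟨N, hN⟩ := eventually_atTop.1 h
  rw [← tendsto_add_atTop_iff_nat N]
  have h1 : ∀ n : ℕ, s N + n * c ≤ s (n + N) := by
    intro n
    induction n with
    | zero => simp
    | succ n ih =>
      have := hN (n + N) (by omega)
      rw [show n + 1 + N = n + N + 1 by ring]
      push_cast
      linarith
  exact tendsto_atTop_mono h1 (tendsto_atTop_add_const_left _ _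
    (tendsto_natCast_atTop_atTop.atTop_mul_const hc))

/-- Orbits that converge to the axis do so along the attracting direction. -/
theorem Form.tendsto_re_of_mem_Om (hD : HasDiophantineExponent θ r) (hF : Form θ f g F a b)
    (hA : IsAutomorphism F) {p : ℂ × ℂ} (hp : p ∈ Om F) :
    Tendsto (fun n => (ThetaInv f (F^[n] p)).1.re) atTop atTop := by
  obtain ⟨hp0, hz, B, hB⟩ := hp
  set U : ℕ → ℂ × ℂ := fun n => ThetaInv f (F^[n] p) with hU
  have hU2 : ∀ n, (U n).2 = (F^[n] p).2 := fun n => rfl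
  have hUG : Tendsto U atTop (Gl (B + 1)) := by
    refine tendsto_Gl_iff.2 ⟨?_, Eventually.of_forall fun n => by
      rw [hU2]; linarith [hB n]⟩
    have h1 : Tendsto (fun n => ‖f 0 * (F^[n] p).1‖) atTop (𝓝[>] 0) := by
      refine tendsto_nhdsWithin_iff.2 ⟨by simpa using (hz.const_mul (f 0)).norm,
        Eventually.of_forall fun n => ?_⟩
      refine norm_pos_iff.2 (mul_ne_zero hF.f0 ?_)
      rwa [ne_eq, hF.iterate_fst_eq_zero_iff hA]
    refine (tendsto_inv_nhdsGT_zero.comp h1).congr fun n => ?_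
    simp only [hU, ThetaInv, Function.comp, norm_div, norm_neg, norm_one, one_div]
  have hstep : ∀ n, U (n + 1) = Ftilde f F (U n) := fun n => by
    simp only [hU, Ftilde, Function.comp, Theta_ThetaInv hF.f0, Function.iterate_succ_apply']
  have hJ : Tendsto (fun n => (U n).1⁻¹) atTop (𝓝 0) := (tendsto_inv_Gl _).comp hUG
  have hJ2 : Tendsto (fun n => (U n).1⁻¹ ^ 2) atTop (𝓝 0) := by simpa using hJ.pow 2
  obtain ⟨o1, o2⟩ := hF.isBigO_Ftilde (B + 1)
  have t1 : Tendsto (fun n => (U (n + 1)).1 - (U n).1 - f (U n).2 / f 0) atTop (𝓝 0) := by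
    have h1 := (o1.comp_tendsto hUG).trans_tendsto hJ2
    have h2 := ((isBigO_snd hF.differentiable_kap (B + 1)).comp_tendsto hUG).mul
      (Asymptotics.isBigO_refl (fun n => (U n).1⁻¹) atTop)
    simp only [Function.comp, one_mul] at h2
    have h3 := h1.add (h2.trans_tendsto hJ)
    rw [add_zero] at h3
    refine h3.congr fun n => ?_
    simp only [Function.comp, hstep]
    ring
  have t2 : Tendsto (fun n => (U (n + 1)).2 - lam θ * (U n).2) atTop (𝓝 0) := by
    have h1 := (o2.comp_tendsto hUG).trans_tendsto hJ2
    have h2 := ((isBigO_snd (c := fun w => g w / f 0) (by have := hF.hg; fun_prop)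
      (B + 1)).comp_tendsto hUG).mul (Asymptotics.isBigO_refl (fun n => (U n).1⁻¹) atTop)
    simp only [Function.comp, one_mul] at h2
    have h3 := h1.sub (h2.trans_tendsto hJ)
    rw [sub_zero] at h3
    refine h3.congr fun n => ?_
    simp only [Function.comp, hstep]
    ring
  obtain ⟨C, hC, hqb, hql⟩ := exists_lipschitz_of_differentiable (hF.differentiable_q hD) B
  have t3 : Tendsto (fun n => q θ f (U (n + 1)).2 - q θ f (lam θ * (U n).2)) atTop (𝓝 0) := by
    rw [tendsto_zero_iff_norm_tendsto_zero]
    refine squeeze_zero (fun n => norm_nonneg _)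
      (fun n => hql _ _ (by rw [hU2]; exact hB _) (by rw [norm_lam_mul, hU2]; exact hB _)) ?_
    simpa using t2.norm.const_mul C
  have t4 : Tendsto (fun n => (((U (n + 1)).1 - q θ f (U (n + 1)).2) -
      ((U n).1 - q θ f (U n).2) - 1).re) atTop (𝓝 0) := by
    have h1 := (t1.sub t3)
    rw [sub_zero] at h1
    have h2 := (Complex.continuous_re.tendsto 0).comp h1
    rw [Complex.zero_re] at h2
    refine h2.congr fun n => ?_
    simp only [Function.comp]
    congr 1
    linear_combination hF.q_lam hD (U n).2
  have t5 : Tendsto (fun n => ((U n).1 - q θ f (U n).2).re) atTop atTop := by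
    refine tendsto_atTop_of_sub_ge (c := 1 / 2) (by norm_num) ?_
    filter_upwards [t4.eventually_const_le (u := -1 / 2) (by norm_num)] with n hn
    rw [Complex.sub_re, Complex.sub_re, Complex.one_re] at hn
    linarith
  refine tendsto_atTop_mono (fun n => ?_) (tendsto_atTop_add_const_right _ (-C) t5)
  have h1 := (abs_le.1 (Complex.abs_re_le_norm (q θ f (U n).2))).1
  have h2 := hqb (U n).2 (hB n)
  rw [Complex.sub_re]
  change _ ≤ (U n).1.re
  linarith

/-- Points near infinity have coordinates `T`. -/
theorem Form.exists_T_eq (hD : HasDiophantineExponent θ r) (hF : Form θ f g F a b) (δ : ℝ) :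
    ∃ ρ C : ℝ, 0 < ρ ∧ 0 < C ∧ ∀ y ∈ Dom ρ δ, ∃ x, T θ f g F x = Theta f y ∧ ‖x.1 - y.1‖ ≤ C ∧
      ‖x.2‖ < δ + 1 := by
  obtain ⟨ρ, hρ, h⟩ := eventually_Fl.1 (hF.solve_Lm hD δ one_pos)
  obtain ⟨C, hC, hqb, -⟩ := exists_lipschitz_of_differentiable (hF.differentiable_q hD) δ
  refine ⟨ρ, C + 1, hρ, by positivity, fun y hy => ?_⟩
  obtain ⟨x, hx1, hx2⟩ := h y hy
  refine ⟨x, by rw [T_eq, hx1], ?_, ?_⟩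
  · have h1 := (norm_fst_le _).trans hx2
    have h2 : (x - PsiInv θ f y).1 = x.1 - y.1 + q θ f y.2 := by simp [PsiInv]; ring
    rw [h2] at h1
    have h3 := hqb y.2 hy.2.le
    have h4 := norm_sub_le (x.1 - y.1 + q θ f y.2) (q θ f y.2)
    rw [add_sub_cancel_right] at h4
    linarith
  · have h1 := (norm_snd_le _).trans hx2
    have h2 : (x - PsiInv θ f y).2 = x.2 - y.2 := rfl
    rw [h2] at h1
    have h3 := norm_le_insert' x.2 y.2
    linarith [hy.2]

/-- Every orbit in the basin enters all deep half-plane regions in the coordinates `T`. -/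
theorem Form.exists_deep (hD : HasDiophantineExponent θ r) (hF : Form θ f g F a b)
    (hA : IsAutomorphism F) {p : ℂ × ℂ} (hp : p ∈ Om F) :
    ∃ B : ℝ, 0 < B ∧ ∀ ρ, ∀ᶠ n in atTop, ∃ x ∈ HP ρ B, T θ f g F x = F^[n] p := by
  have hre := hF.tendsto_re_of_mem_Om hD hA hp
  obtain ⟨-, -, B, hB⟩ := hp
  obtain ⟨ρ₀, C, hρ₀, hC, h⟩ := hF.exists_T_eq hD (B + 1)
  refine ⟨B + 2, by linarith [(norm_nonneg _).trans (hB 0)], fun ρ => ?_⟩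
  filter_upwards [hre.eventually_gt_atTop (max ρ₀ (ρ + C))] with n hn
  have h1 : ThetaInv f (F^[n] p) ∈ HP ρ₀ (B + 1) :=
    ⟨(le_max_left _ _).trans_lt hn, by
      have : (ThetaInv f (F^[n] p)).2 = (F^[n] p).2 := rfl
      rw [this]; linarith [hB n]⟩
  obtain ⟨x, hx1, hx2, hx3⟩ := h _ (HP_subset_Dom _ _ h1)
  rw [Theta_ThetaInv hF.f0] at hx1
  refine ⟨x, ⟨?_, by linarith⟩, hx1⟩
  have h2 := (abs_le.1 ((Complex.abs_re_le_norm _).trans hx2)).1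
  rw [Complex.sub_re] at h2
  have h3 := (le_max_right ρ₀ (ρ + C)).trans_lt hn
  linarith

theorem Core.tendsto_Qseq {Δ M ρ : ℝ} (hC : Core θ f g F Δ M ρ) {x : ℂ × ℂ} (hx : x ∈ Dom ρ Δ) :
    Tendsto (fun n => Qseq θ f g F n (T θ f g F x)) atTop (𝓝 (FC θ f g F (T θ f g F x))) := by
  rw [Metric.tendsto_atTop]
  intro ε hε
  obtain ⟨N, hN⟩ := hC.unif (ε / 2) (by positivity)
  refine ⟨N, fun n hn => ?_⟩
  rw [dist_eq_norm]
  linarith [(hN n hn x hx).1]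

theorem tendsto_Qseq_of_iterate {p : ℂ × ℂ} {k : ℕ}
    (h : Tendsto (fun n => Qseq θ f g F n (F^[k] p)) atTop (𝓝 (FC θ f g F (F^[k] p)))) :
    Tendsto (fun n => Qseq θ f g F n p) atTop (𝓝 (chiInv θ k (FC θ f g F (F^[k] p)))) := by
  rw [← tendsto_add_atTop_iff_nat k]
  simp only [Qseq_iterate]
  exact ((continuous_chiInv θ k).tendsto _).comp h

theorem FC_of_iterate {p : ℂ × ℂ} {k : ℕ}
    (h : Tendsto (fun n => Qseq θ f g F n (F^[k] p)) atTop (𝓝 (FC θ f g F (F^[k] p)))) :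
    FC θ f g F p = chiInv θ k (FC θ f g F (F^[k] p)) :=
  (tendsto_Qseq_of_iterate h).limUnder_eq

theorem Form.tendsto_Qseq (hD : HasDiophantineExponent θ r) (hF : Form θ f g F a b)
    (hA : IsAutomorphism F) {p : ℂ × ℂ} (hp : p ∈ Om F) :
    Tendsto (fun n => Qseq θ f g F n p) atTop (𝓝 (FC θ f g F p)) := by
  obtain ⟨B, hB, h⟩ := hF.exists_deep hD hA hp
  obtain ⟨M, ρ, hC⟩ := hF.exists_core hD B
  obtain ⟨k, x, hx, hxT⟩ := (h ρ).exists
  have h1 := hC.tendsto_Qseq (HP_subset_Dom _ _ hx)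
  rw [hxT] at h1
  rw [FC_of_iterate h1]
  exact tendsto_Qseq_of_iterate h1

theorem Form.FC_F (hD : HasDiophantineExponent θ r) (hF : Form θ f g F a b)
    (hA : IsAutomorphism F) {p : ℂ × ℂ} (hp : p ∈ Om F) :
    FC θ f g F (F p) = chi θ (FC θ f g F p) := by
  have h1 := hF.tendsto_Qseq hD hA ((hF.F_mem_Om_iff hA p).2 hp)
  have h2 := (tendsto_add_atTop_iff_nat 1).2 (hF.tendsto_Qseq hD hA hp)
  have hc : Continuous (chi θ) := by unfold chi; fun_prop
  have h3 := (hc.tendsto _).comp h2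
  refine tendsto_nhds_unique h1 (h3.congr fun n => ?_)
  simp only [Function.comp, Qseq_iterate]
  have h4 : ∀ q, chi θ (chiInv θ 1 q) = q := fun q => by
    rw [chi_chiInv_succ]; simp [chiInv]
  rw [h4]
  rfl

theorem Form.FC_iterate (hD : HasDiophantineExponent θ r) (hF : Form θ f g F a b)
    (hA : IsAutomorphism F) {p : ℂ × ℂ} (hp : p ∈ Om F) (n : ℕ) :
    FC θ f g F (F^[n] p) = (chi θ)^[n] (FC θ f g F p) := by
  induction n with
  | zero => rfl
  | succ n ih =>
    rw [Function.iterate_succ_apply', Function.iterate_succ_apply',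
      hF.FC_F hD hA ((hF.iterate_mem_Om_iff hA n p).2 hp), ih]

theorem differentiable_iterate (hA : Differentiable ℂ F) (n : ℕ) : Differentiable ℂ F^[n] := by
  induction n with
  | zero => exact differentiable_id
  | succ n ih => rw [Function.iterate_succ']; exact hA.comp ih

/-- Local uniform convergence in the basin. -/
theorem Form.exists_nhd (hD : HasDiophantineExponent θ r) (hF : Form θ f g F a b)
    (hA : IsAutomorphism F) {p : ℂ × ℂ} (hp : p ∈ Om F) :
    ∃ W : Set (ℂ × ℂ), IsOpen W ∧ p ∈ W ∧ W ⊆ Om F ∧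
      TendstoUniformlyOn (Qseq θ f g F) (FC θ f g F) atTop W ∧
      TendstoUniformlyOn (fun n p => (F^[n] p).1) (fun _ => 0) atTop W ∧
      (∃ B : ℝ, ∀ p ∈ W, ‖(FC θ f g F p).2‖ ≤ B) ∧
      ∃ k, ∀ n, DifferentiableOn ℂ (Qseq θ f g F (n + k)) W := by
  have hre := hF.tendsto_re_of_mem_Om hD hA hp
  have hdF := hA.differentiable
  have hp0 := hp.1
  obtain ⟨B, hB⟩ := hp.2.2
  obtain ⟨ρ₀, C, hρ₀, hC0, h⟩ := hF.exists_T_eq hD (B + 1)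
  obtain ⟨M, ρ, hC⟩ := hF.exists_core hD (B + 2)
  set ρ' := max ρ₀ (ρ + 2 * C) with hρ'
  obtain ⟨k, hk⟩ := (hre.eventually_gt_atTop ρ').exists
  set S : Set (ℂ × ℂ) := {q | q.1 ≠ 0} ∩ ThetaInv f ⁻¹' Dom ρ' (B + 1) with hS
  have hS1 : IsOpen {q : ℂ × ℂ | q.1 ≠ 0} := isOpen_ne_fun continuous_fst continuous_const
  have hTd : DifferentiableOn ℂ (ThetaInv f) {q | q.1 ≠ 0} := by
    intro q hq
    have : f 0 * q.1 ≠ 0 := mul_ne_zero hF.f0 hq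
    unfold ThetaInv
    exact DifferentiableAt.differentiableWithinAt (by fun_prop (disch := assumption))
  have hSo : IsOpen S := hTd.continuousOn.isOpen_inter_preimage hS1 (isOpen_Dom _ _)
  have hW : ∀ p' ∈ F^[k] ⁻¹' S, ∃ x ∈ Dom ρ (B + 2), T θ f g F x = F^[k] p' := by
    intro p' hp'
    obtain ⟨x, hx1, hx2, hx3⟩ := h _ (Dom_anti (le_max_left _ _) le_rfl hp'.2)
    rw [Theta_ThetaInv hF.f0] at hx1
    refine ⟨x, ⟨?_, by linarith⟩, hx1⟩
    have h1 := (abs_le.1 (mm_add (ThetaInv f (F^[k] p')).1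
      (x.1 - (ThetaInv f (F^[k] p')).1))).1
    rw [add_sub_cancel] at h1
    have h2 := (le_max_right ρ₀ (ρ + 2 * C)).trans_lt hp'.2.1
    linarith
  have hWO : F^[k] ⁻¹' S ⊆ Om F := by
    intro p' hp'
    obtain ⟨x, hx, hxT⟩ := hW p' hp'
    rw [← hF.iterate_mem_Om_iff hA k, ← hxT]
    exact hC.T_mem_Om hF hx
  have hFC : ∀ p' ∈ F^[k] ⁻¹' S, FC θ f g F p' = chiInv θ k (FC θ f g F (F^[k] p')) := by
    intro p' hp'
    exact FC_of_iterate (hF.tendsto_Qseq hD hA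
      ((hF.iterate_mem_Om_iff hA k _).2 (hWO hp')))
  refine ⟨F^[k] ⁻¹' S, hSo.preimage (differentiable_iterate hdF k).continuous,
    ⟨by rw [mem_ofPred_eq, ne_eq, hF.iterate_fst_eq_zero_iff hA]; exact hp0, ?_⟩, hWO, ?_, ?_, ?_,
    k, fun n p' hp' => ?_⟩
  · refine HP_subset_Dom _ _ ⟨hk, ?_⟩
    have : (ThetaInv f (F^[k] p)).2 = (F^[k] p).2 := rfl
    rw [this]
    linarith [hB k]
  · rw [Metric.tendstoUniformlyOn_iff]
    intro ε hε
    obtain ⟨N, hN⟩ := hC.unif (ε / 2) (by positivity)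
    filter_upwards [eventually_ge_atTop (N + k)] with n hn p' hp'
    obtain ⟨x, hx, hxT⟩ := hW p' hp'
    obtain ⟨m, rfl⟩ : ∃ m, n = m + k := ⟨n - k, by omega⟩
    rw [dist_comm, dist_eq_norm, hFC p' hp', Qseq_iterate, norm_chiInv_sub, ← hxT]
    linarith [(hN m (by omega) x hx).1]
  · rw [Metric.tendstoUniformlyOn_iff]
    intro ε hε
    obtain ⟨N, hN⟩ := hC.unif (ε / 2) (by positivity)
    filter_upwards [eventually_ge_atTop (N + k)] with n hn p' hp'
    obtain ⟨x, hx, hxT⟩ := hW p' hp'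
    obtain ⟨m, rfl⟩ : ∃ m, n = m + k := ⟨n - k, by omega⟩
    rw [dist_comm, dist_zero_right, Function.iterate_add_apply, ← hxT]
    linarith [(hN m (by omega) x hx).2]
  · refine ⟨B + 3, fun p' hp' => ?_⟩
    obtain ⟨x, hx, hxT⟩ := hW p' hp'
    obtain ⟨y, hy, -, hyZ⟩ := hC.orbit x hx
    have h1 := (norm_snd_le _).trans (hyZ 0)
    have h2 : (ZH θ f g F y 0 - FC θ f g F (T θ f g F x)).2 =
        x.2 - (FC θ f g F (T θ f g F x)).2 := by
      simp [ZH, chiInv, Z, hy.zero]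
    have h3 : M / (2 * mm x.1 + (0 : ℕ)) ≤ 1 := by
      have := hx.1
      have := hC.M_le
      have := hC.five_le
      rw [div_le_one (by push_cast; linarith)]
      push_cast
      linarith
    rw [h2] at h1
    have h4 := norm_le_insert x.2 (FC θ f g F (T θ f g F x)).2
    rw [hFC p' hp', ← hxT, chiInv]
    simp only [norm_mul, norm_inv, norm_lam_pow, inv_one, one_mul]
    linarith [hx.2]
  · obtain ⟨x, hx, hxT⟩ := hW p' hp'
    obtain ⟨y, hy, hyn, -⟩ := hC.orbit x hx
    have h1 : F^[n + k] p' = T θ f g F (y n) := by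
      rw [Function.iterate_add_apply, ← hxT, hy.iterate]
    have h2 := hC.near _ (hyn n)
    have h3 : (F^[n + k] p').1 ≠ 0 := by
      rw [h1]
      exact hC.T_fst_ne_zero hF (hyn n)
    set v := PsiInv θ f (ThetaInv f (F^[n + k] p')) with hv
    have hvs : v.1 ∈ Complex.slitPlane := by
      have h4 : v = PsiInv θ f (Lm θ f g F (y n)) := by
        rw [hv, h1, T_eq, ThetaInv_Theta hF.f0]
      rw [← h4] at h2
      have h5 := (norm_fst_le _).trans h2.2
      have h6 := (abs_le.1 (mm_add (y n).1 (v - y n).1)).1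
      rw [Prod.fst_sub, add_sub_cancel] at h6
      rw [Prod.fst_sub] at h5
      have h7 := (hyn n).1
      have h8 := hC.five_le
      exact mem_slitPlane_of_mm_pos (by linarith)
    have hq := hF.differentiable_q hD
    have hΨ : Differentiable ℂ (PsiInv θ f) := by unfold PsiInv; fun_prop
    have d1 : DifferentiableAt ℂ (fun p => PsiInv θ f (ThetaInv f (F^[n + k] p))) p' :=
      (hΨ _).comp p' ((hTd.differentiableAt (hS1.mem_nhds h3)).comp p'
        (differentiable_iterate hdF (n + k) p'))
    have d2 : DifferentiableAt ℂ (Z (A θ f g F)) v := by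
      unfold Z
      fun_prop (disch := assumption)
    have d3 : Differentiable ℂ (chiInv θ (n + k)) := by unfold chiInv; fun_prop
    exact ((d3 _).comp p' (DifferentiableAt.comp p' d2 d1)).differentiableWithinAt

theorem Form.isOpen_Om (hD : HasDiophantineExponent θ r) (hF : Form θ f g F a b)
    (hA : IsAutomorphism F) : IsOpen (Om F) := by
  rw [isOpen_iff_mem_nhds]
  intro p hp
  obtain ⟨W, hW, hpW, hWO, -⟩ := hF.exists_nhd hD hA hp
  exact mem_of_superset (hW.mem_nhds hpW) hWO

theorem Form.differentiableOn_FC (hD : HasDiophantineExponent θ r) (hF : Form θ f g F a b)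
    (hA : IsAutomorphism F) : DifferentiableOn ℂ (FC θ f g F) (Om F) := by
  intro p hp
  obtain ⟨W, hW, hpW, hWO, hQ, -, -, k, hk⟩ := hF.exists_nhd hD hA hp
  have h1 : TendstoUniformlyOn (fun n => Qseq θ f g F (n + k)) (FC θ f g F) atTop W :=
    fun u hu => (tendsto_add_atTop_nat k).eventually (hQ u hu)
  exact ((differentiableOn_of_tendstoUniformlyOn hW hk h1).differentiableAt
    (hW.mem_nhds hpW)).differentiableWithinAt

end

/-! ### The Fatou coordinate is biholomorphic -/

theorem norm_log_sub_le_of_re {ρ : ℝ} (hρ : 0 < ρ) {u v : ℂ} (hu : ρ < u.re) (hv : ρ < v.re) :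
    ‖Complex.log u - Complex.log v‖ ≤ ρ⁻¹ * ‖u - v‖ := by
  refine (convex_halfSpace_re_gt ρ).norm_image_sub_le_of_norm_hasDerivWithin_le
    (f := Complex.log) (f' := fun z => z⁻¹) (𝕜 := ℂ) (fun z hz => ?_) (fun z hz => ?_) hv hu
  · exact (Complex.hasDerivAt_log (Or.inl (hρ.trans hz))).hasDerivWithinAt
  · rw [norm_inv]
    exact inv_anti₀ hρ ((le_of_lt hz).trans (Complex.re_le_norm z))

theorem tendsto_const_add_log_div (c₁ c₂ : ℝ) :
    Tendsto (fun n : ℕ => (c₁ + c₂ * Real.log n) / n) atTop (𝓝 0) := by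
  have h1 : Tendsto (fun n : ℕ => Real.log n / n) atTop (𝓝 0) :=
    (Real.isLittleO_log_id_atTop.tendsto_div_nhds_zero).comp tendsto_natCast_atTop_atTop
  have h2 : Tendsto (fun n : ℕ => c₁ / (n : ℝ)) atTop (𝓝 0) :=
    tendsto_const_div_atTop_nhds_zero_nat c₁
  have h3 := h2.add (h1.const_mul c₂)
  rw [mul_zero, add_zero] at h3
  refine h3.congr fun n => ?_
  ring

theorem mm_natCast (n : ℕ) : mm (n : ℂ) = n := by simp [mm]

/-- `log (n + s)` is close to `log n` when `s` is small compared to `n`. -/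
theorem norm_log_natCast_add_sub_le {n : ℕ} (hn : 0 < n) {s : ℂ} (hs : 4 * ‖s‖ ≤ n) :
    ‖Complex.log (n + s) - (Real.log n : ℂ)‖ ≤ 2 * (‖s‖ / n) := by
  rw [Complex.natCast_log]
  have := norm_log_add_sub_le' (u := n) (s := s) (by rw [mm_natCast]; exact_mod_cast hn)
    (by rwa [mm_natCast])
  rw [norm_inv, Complex.norm_natCast, mul_assoc] at this
  exact this

section

variable {θ r : ℝ} {f g : ℂ → ℂ} {F : ℂ × ℂ → ℂ × ℂ} {a b : ℂ × ℂ → ℂ}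

theorem Core.differentiableOn_T {Δ M ρ : ℝ} (hF : Form θ f g F a b) (hC : Core θ f g F Δ M ρ) :
    DifferentiableOn ℂ (T θ f g F) (Dom ρ (Δ + 1)) := by
  intro x hx
  have h1 : f 0 * (Lm θ f g F x).1 ≠ 0 :=
    mul_ne_zero hF.f0 (norm_pos_iff.1 (norm_pos_of_mm_pos (hC.near x hx).1))
  have h2 : DifferentiableAt ℂ (Theta f) (Lm θ f g F x) := by
    unfold Theta
    fun_prop (disch := assumption)
  exact h2.comp_differentiableWithinAt x (hC.diff x hx)

theorem Core.injOn_T {Δ M ρ : ℝ} (hF : Form θ f g F a b) (hC : Core θ f g F Δ M ρ) :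
    InjOn (T θ f g F) (Dom ρ (Δ + 1)) := by
  intro x hx y hy hxy
  have := congrArg (ThetaInv f) hxy
  rw [T_eq, T_eq, ThetaInv_Theta hF.f0, ThetaInv_Theta hF.f0] at this
  exact hC.injOn hx hy this

/-- In the coordinates `T`, the Fatou coordinate is close to the identity. -/
theorem Form.exists_nearId_FC_T (hD : HasDiophantineExponent θ r) (hF : Form θ f g F a b)
    (hA : IsAutomorphism F) (Δ : ℝ) :
    ∃ ρ : ℝ, 0 < ρ ∧ NearId (fun x => FC θ f g F (T θ f g F x)) (HP ρ Δ) ∧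
      DifferentiableOn ℂ (T θ f g F) (HP ρ Δ) ∧
      DifferentiableOn ℂ (fun x => FC θ f g F (T θ f g F x)) (HP ρ Δ) ∧
      (∀ x ∈ HP ρ Δ, T θ f g F x ∈ Om F) ∧
      ∀ x ∈ HP ρ Δ, ‖FC θ f g F (T θ f g F x) - Z (A θ f g F) x‖ ≤ 1 / 8 := by
  obtain ⟨M, ρ₀, hC⟩ := hF.exists_core hD (Δ + 1)
  have hM := hC.M_pos
  have h5 := hC.five_le
  set α := A θ f g F with hα
  set ρ₁ := max ρ₀ (4 * M) with hρ₁
  have hρ01 : ρ₀ ≤ ρ₁ := le_max_left _ _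
  have hM1 : 4 * M ≤ ρ₁ := le_max_right _ _
  set E : ℂ × ℂ → ℂ × ℂ := fun x => FC θ f g F (T θ f g F x) - Z α x with hE
  have hEb : ∀ x ∈ Dom ρ₁ (Δ + 1), ‖E x‖ ≤ 1 / 8 := by
    intro x hx
    obtain ⟨y, hy, -, hyZ⟩ := hC.orbit x (Dom_anti hρ01 le_rfl hx)
    have h1 := hyZ 0
    have h2 : ZH θ f g F y 0 = Z α x := by simp [ZH, chiInv, hy.zero, Z, hα]
    rw [h2, norm_sub_rev] at h1
    refine h1.trans ?_
    have := hx.1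
    rw [div_le_iff₀ (by push_cast; linarith)]
    push_cast
    linarith
  have hTd : DifferentiableOn ℂ (T θ f g F) (Dom ρ₁ (Δ + 1)) :=
    (hC.differentiableOn_T hF).mono (Dom_anti hρ01 (by linarith))
  have hTO : ∀ x ∈ Dom ρ₁ (Δ + 1), T θ f g F x ∈ Om F := fun x hx =>
    hC.T_mem_Om hF (Dom_anti hρ01 le_rfl hx)
  have hGd : DifferentiableOn ℂ (fun x => FC θ f g F (T θ f g F x)) (Dom ρ₁ (Δ + 1)) :=
    (hF.differentiableOn_FC hD hA).comp hTd hTO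
  have hEd : DifferentiableOn ℂ E (Dom ρ₁ (Δ + 1)) := by
    refine hGd.sub fun x hx => ?_
    have : x.1 ∈ Complex.slitPlane := mem_slitPlane_of_mm_pos (by linarith [hx.1])
    unfold Z
    exact DifferentiableAt.differentiableWithinAt (by fun_prop (disch := assumption))
  have hlip := lipschitz_of_norm_le_Dom hEd hEb
  set ρ := max (ρ₁ + 2) (4 * ‖α‖ + 1) with hρ
  have hρ2 : ρ₁ + 2 ≤ ρ := le_max_left _ _
  have hρα : 4 * ‖α‖ + 1 ≤ ρ := le_max_right _ _
  have hsub1 : HP ρ Δ ⊆ Dom (ρ₁ + 2) Δ := (HP_subset_Dom _ _).trans (Dom_anti hρ2 le_rfl)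
  have hsub : HP ρ Δ ⊆ Dom ρ₁ (Δ + 1) := hsub1.trans (Dom_anti (by linarith) (by linarith))
  have hρ0 : 0 < ρ := by linarith [norm_nonneg α]
  refine ⟨ρ, hρ0, fun x hx y hy => ?_, hTd.mono hsub, hGd.mono hsub,
    fun x hx => hTO x (hsub hx), fun x hx => hEb x (hsub hx)⟩
  have h1 := hlip x (hsub1 hx) y (hsub1 hy)
  have h2 := norm_log_sub_le_of_re hρ0 hx.1 hy.1
  have h3 : (FC θ f g F (T θ f g F x) - x) - (FC θ f g F (T θ f g F y) - y) =
      (E x - E y) + (-(α * (Complex.log x.1 - Complex.log y.1)), 0) := by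
    simp only [hE, Z]
    ext
    · simp only [Prod.fst_sub, Prod.fst_add]; ring
    · simp only [Prod.snd_sub, Prod.snd_add]; ring
  have h4 : ‖((-(α * (Complex.log x.1 - Complex.log y.1)), 0) : ℂ × ℂ)‖ ≤ 1 / 4 * ‖x - y‖ := by
    refine norm_prod_le_iff.2 ⟨?_, by rw [norm_zero]; positivity⟩
    rw [norm_neg, norm_mul]
    have h5 : ‖x.1 - y.1‖ ≤ ‖x - y‖ := norm_fst_le (x - y)
    calc ‖α‖ * ‖Complex.log x.1 - Complex.log y.1‖ ≤ ‖α‖ * (ρ⁻¹ * ‖x - y‖) := by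
          gcongr
          exact h2.trans (by gcongr)
      _ = ‖α‖ / ρ * ‖x - y‖ := by ring
      _ ≤ 1 / 4 * ‖x - y‖ :=
          mul_le_mul_of_nonneg_right ((div_le_iff₀ hρ0).2 (by linarith)) (norm_nonneg _)
  rw [h3]
  refine (norm_add_le _ _).trans ?_
  linarith

theorem Form.injOn_FC (hD : HasDiophantineExponent θ r) (hF : Form θ f g F a b)
    (hA : IsAutomorphism F) : InjOn (FC θ f g F) (Om F) := by
  intro p hp p' hp' h
  obtain ⟨B, hB, h1⟩ := hF.exists_deep hD hA hp
  obtain ⟨B', hB', h2⟩ := hF.exists_deep hD hA hp'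
  obtain ⟨ρ, hρ, hn, -⟩ := hF.exists_nearId_FC_T hD hA (max B B')
  obtain ⟨n, ⟨x, hx, hxT⟩, ⟨x', hx', hxT'⟩⟩ := ((h1 ρ).and (h2 ρ)).exists
  have h3 : x = x' := by
    refine hn.injOn (HP_anti le_rfl (le_max_left _ _) hx) (HP_anti le_rfl (le_max_right _ _) hx') ?_
    rw [hxT, hxT', hF.FC_iterate hD hA hp, hF.FC_iterate hD hA hp', h]
  apply hA.injective.iterate n
  rw [← hxT, ← hxT', h3]

theorem Form.surjOn_FC (hD : HasDiophantineExponent θ r) (hF : Form θ f g F a b)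
    (hA : IsAutomorphism F) (y : ℂ × ℂ) : ∃ p ∈ Om F, FC θ f g F p = y := by
  obtain ⟨ρ, hρ, hn, -, -, hTO, hZ⟩ := hF.exists_nearId_FC_T hD hA (‖y.2‖ + 2)
  set α := A θ f g F with hα
  set s : ℕ → ℂ := fun n => y.1 + α * (Real.log n : ℂ) with hs
  have hsb : ∀ n : ℕ, ‖s n‖ ≤ ‖y.1‖ + ‖α‖ * Real.log n := by
    intro n
    refine (norm_add_le _ _).trans ?_
    rw [norm_mul, Complex.norm_real, Real.norm_of_nonneg (Real.log_natCast_nonneg n)]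
  obtain ⟨n, hn1, hn2, hn3⟩ := (((tendsto_const_add_log_div ‖y.1‖ ‖α‖).eventually_le_const
    (u := min (1 / 4) (1 / (8 * (‖α‖ + 1)))) (by positivity)).and
    ((eventually_gt_atTop 0).and
      (tendsto_natCast_atTop_atTop.eventually_gt_atTop (2 * (ρ + 1))))).exists
  have hn0 : (0 : ℝ) < n := by exact_mod_cast hn2
  have hsn : ‖s n‖ / n ≤ min (1 / 4) (1 / (8 * (‖α‖ + 1))) := by
    refine le_trans ?_ hn1
    gcongr
    exact hsb n
  have hs4 : 4 * ‖s n‖ ≤ n := by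
    have := hsn.trans (min_le_left _ _)
    rw [div_le_iff₀ hn0] at this
    linarith
  have hlog := norm_log_natCast_add_sub_le hn2 hs4
  set x₀ : ℂ × ℂ := (n + s n, lam θ ^ n * y.2) with hx₀
  have hball : Metric.closedBall x₀ 1 ⊆ HP ρ (‖y.2‖ + 2) := by
    intro x hx
    have h1 : ‖x - x₀‖ ≤ 1 := by simpa [dist_eq_norm] using hx
    have h2 := (abs_le.1 ((Complex.abs_re_le_norm _).trans ((norm_fst_le _).trans h1))).1
    have h3 := (norm_snd_le _).trans h1
    have h4 := norm_le_insert' x.2 x₀.2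
    have h5 : ‖x₀.2‖ = ‖y.2‖ := norm_lam_pow_mul _ _ _
    have h6 := (abs_le.1 (Complex.abs_re_le_norm (s n))).1
    rw [Prod.fst_sub, Complex.sub_re] at h2
    rw [Prod.snd_sub] at h3
    have h7 : x₀.1.re = n + (s n).re := by simp [hx₀]
    exact ⟨by linarith, by linarith⟩
  have hd : 2 * ‖(chi θ)^[n] y - FC θ f g F (T θ f g F x₀)‖ ≤ 1 := by
    have h1 := hZ x₀ (hball (Metric.mem_closedBall_self (by norm_num)))
    have h2 : ‖(chi θ)^[n] y - Z α x₀‖ ≤ 1 / 4 := by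
      rw [chi_iterate]
      refine norm_prod_le_iff.2 ⟨?_, ?_⟩
      · have h3 : ((y.1 + n, lam θ ^ n * y.2) - Z α x₀).1 =
            α * (Complex.log (n + s n) - (Real.log n : ℂ)) := by
          simp only [Z, hx₀, hs, Prod.fst_sub]; ring
        rw [h3, norm_mul]
        have h4 := hsn.trans (min_le_right _ _)
        have hα0 : 0 < ‖α‖ + 1 := by positivity
        calc ‖α‖ * ‖Complex.log (n + s n) - (Real.log n : ℂ)‖
            ≤ (‖α‖ + 1) * (2 * (1 / (8 * (‖α‖ + 1)))) := by
              gcongr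
              · linarith
              · exact hlog.trans (by gcongr)
          _ = 1 / 4 := by field_simp; norm_num
      · simp [Z, hx₀]
    have h3 := norm_sub_le_norm_sub_add_norm_sub ((chi θ)^[n] y) (Z α x₀)
      (FC θ f g F (T θ f g F x₀))
    rw [norm_sub_rev (Z α x₀)] at h3
    linarith
  obtain ⟨x, hx, hxd⟩ := (hn.mono hball).exists_preimage hd
  have hxm : x ∈ HP ρ (‖y.2‖ + 2) := hball (by
    rw [mem_closedBall_iff_norm]; linarith)
  obtain ⟨p, hp⟩ := hA.surjective.iterate n (T θ f g F x)
  have hpO : p ∈ Om F := by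
    rw [← hF.iterate_mem_Om_iff hA n, hp]
    exact hTO x hxm
  refine ⟨p, hpO, ?_⟩
  have h1 := hF.FC_iterate hD hA hpO n
  rw [hp] at h1
  have h2 : (chi θ)^[n] (FC θ f g F p) = (chi θ)^[n] y := by rw [← h1]; exact hx
  have h3 := congrArg (chiInv θ n) h2
  rwa [chiInv_chi_iterate, chiInv_chi_iterate] at h3

theorem Form.isBiholomorphism_FC (hD : HasDiophantineExponent θ r) (hF : Form θ f g F a b)
    (hA : IsAutomorphism F) : IsBiholomorphism (FC θ f g F) (Om F) univ := by
  have hinj := hF.injOn_FC hD hA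
  have hsurj : SurjOn (FC θ f g F) (Om F) univ := fun y _ => hF.surjOn_FC hD hA y
  set P := Function.invFunOn (FC θ f g F) (Om F) with hP
  have hPm : MapsTo P univ (Om F) := hsurj.mapsTo_invFunOn
  have hPr : RightInvOn P (FC θ f g F) univ := hsurj.rightInvOn_invFunOn
  have hPl : LeftInvOn P (FC θ f g F) (Om F) := hinj.leftInvOn_invFunOn
  refine ⟨hF.differentiableOn_FC hD hA, mapsTo_univ _ _, P, fun y _ => ?_, hPm, hPl, hPr⟩
  obtain ⟨Fi, hFi, -, hFir⟩ := hA.exists_inverse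
  have hpO := hPm (mem_univ y)
  obtain ⟨B, hB, h1⟩ := hF.exists_deep hD hA hpO
  obtain ⟨ρ, hρ, hn, hTd, hGd, hTO, -⟩ := hF.exists_nearId_FC_T hD hA B
  obtain ⟨n, x, hx, hxT⟩ := (h1 ρ).exists
  set G : ℂ × ℂ → ℂ × ℂ := fun x => FC θ f g F (T θ f g F x) with hG
  set Gi := Function.invFunOn G (HP ρ B) with hGi
  have hGl : LeftInvOn Gi G (HP ρ B) := hn.injOn.leftInvOn_invFunOn
  have hopen := hn.isOpen_image (isOpen_HP ρ B)
  have hGid := hn.differentiableOn_inverse (isOpen_HP ρ B) hGd hGl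
  have hy : (chi θ)^[n] y = G x := by
    simp only [hG]
    rw [hxT, hF.FC_iterate hD hA hpO, hPr (mem_univ y)]
  have hyS : (chi θ)^[n] y ∈ G '' HP ρ B := hy ▸ mem_image_of_mem _ hx
  have hchi : Differentiable ℂ (chi θ)^[n] :=
    differentiable_iterate (by unfold chi; fun_prop) n
  have hFin : Function.RightInverse (Fi^[n]) (F^[n]) := hFir.iterate n
  have hd : DifferentiableAt ℂ (fun y' => Fi^[n] (T θ f g F (Gi ((chi θ)^[n] y')))) y := by
    have d1 : DifferentiableAt ℂ Gi ((chi θ)^[n] y) := hGid.differentiableAt (hopen.mem_nhds hyS)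
    have d2 : DifferentiableAt ℂ (T θ f g F) (Gi ((chi θ)^[n] y)) := by
      rw [hy, hGl hx]
      exact hTd.differentiableAt ((isOpen_HP ρ B).mem_nhds hx)
    have d3 : DifferentiableAt ℂ (fun y' => Gi ((chi θ)^[n] y')) y :=
      DifferentiableAt.comp (g := Gi) (f := (chi θ)^[n]) y d1 (hchi y)
    have d4 : DifferentiableAt ℂ (fun y' => T θ f g F (Gi ((chi θ)^[n] y'))) y :=
      DifferentiableAt.comp (g := T θ f g F) (f := fun y' => Gi ((chi θ)^[n] y')) y d2 d3
    exact DifferentiableAt.comp (g := Fi^[n])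
      (f := fun y' => T θ f g F (Gi ((chi θ)^[n] y'))) y (differentiable_iterate hFi n _) d4
  refine (hd.congr_of_eventuallyEq ?_).differentiableWithinAt
  filter_upwards [hchi.continuous.continuousAt.eventually_mem (hopen.mem_nhds hyS)] with y' hy'
  obtain ⟨x', hx', hxy'⟩ := hy'
  set p' := Fi^[n] (T θ f g F (Gi ((chi θ)^[n] y'))) with hp'
  have h2 : F^[n] p' = T θ f g F x' := by
    rw [hp', hFin, ← hxy', hGl hx']
  have h3 : p' ∈ Om F := by
    rw [← hF.iterate_mem_Om_iff hA n, h2]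
    exact hTO x' hx'
  have h4 : FC θ f g F p' = y' := by
    have h5 := hF.FC_iterate hD hA h3 n
    rw [h2] at h5
    have h6 := congrArg (chiInv θ n) (h5.symm.trans hxy')
    rwa [chiInv_chi_iterate, chiInv_chi_iterate] at h6
  rw [← h4]
  exact hPl h3

end

/-! ### The basin is a Fatou component -/

theorem exists_strictMono_const_or_tendsto (s : ℕ → ℕ) :
    ∃ σ : ℕ → ℕ, StrictMono σ ∧ ((∃ m, ∀ k, s (σ k) = m) ∨ Tendsto (s ∘ σ) atTop atTop) := by
  by_cases h : ∃ m, ∃ᶠ k in atTop, s k = m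
  · obtain ⟨m, hm⟩ := h
    obtain ⟨σ, hσ, h⟩ := extraction_of_frequently_atTop hm
    exact ⟨σ, hσ, Or.inl ⟨m, h⟩⟩
  · push Not at h
    refine ⟨id, strictMono_id, Or.inr (tendsto_atTop.2 fun b => ?_)⟩
    have h1 : ∀ᶠ k in atTop, ∀ m ∈ Finset.range b, s k ≠ m :=
      (Finset.eventually_all _).2 fun m _ => h m
    filter_upwards [h1] with k hk
    by_contra hlt
    exact hk (s k) (Finset.mem_range.2 (not_le.1 hlt)) rfl

theorem exists_tendsto_lam_pow (θ : ℝ) (s : ℕ → ℕ) :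
    ∃ μ : ℂ, μ ≠ 0 ∧ ∃ σ : ℕ → ℕ, StrictMono σ ∧
      Tendsto (fun k => lam θ ^ s (σ k)) atTop (𝓝 μ) := by
  obtain ⟨μ, hμ, σ, hσ, h⟩ := (isCompact_sphere (0 : ℂ) 1).tendsto_subseq
    (x := fun k => lam θ ^ s k) fun k => by rw [mem_sphere_zero_iff_norm, norm_lam_pow]
  refine ⟨μ, ?_, σ, hσ, h⟩
  rintro rfl
  simp at hμ

section

variable {θ r : ℝ} {f g : ℂ → ℂ} {F : ℂ × ℂ → ℂ × ℂ} {a b : ℂ × ℂ → ℂ}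

theorem tendstoUniformlyOn_iterate {W : Set (ℂ × ℂ)} {s : ℕ → ℕ} {μ : ℂ} {B : ℝ}
    (h1 : TendstoUniformlyOn (Qseq θ f g F) (FC θ f g F) atTop W)
    (h2 : TendstoUniformlyOn (fun n p => (F^[n] p).1) (fun _ => 0) atTop W)
    (h3 : ∀ p ∈ W, ‖(FC θ f g F p).2‖ ≤ B) (hs : Tendsto s atTop atTop)
    (hμ : Tendsto (fun k => lam θ ^ s k) atTop (𝓝 μ)) :
    TendstoUniformlyOn (fun k => F^[s k]) (fun p => (0, μ * (FC θ f g F p).2)) atTop W := by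
  rw [Metric.tendstoUniformlyOn_iff] at h1 h2 ⊢
  intro ε hε
  have hB : 0 < |B| + 1 := by positivity
  have h4 := hs.eventually (h1 (ε / 2) (by positivity))
  have h5 := hs.eventually (h2 ε hε)
  have h6 := Metric.tendsto_nhds.1 hμ (ε / 2 / (|B| + 1)) (by positivity)
  filter_upwards [h4, h5, h6] with k h4 h5 h6 p hp
  have h7 := h4 p hp
  have h8 := h5 p hp
  rw [dist_eq_norm] at h6 h7 h8 ⊢
  refine max_lt h8 ?_
  have h9 : (Qseq θ f g F (s k) p).2 = (lam θ ^ s k)⁻¹ * (F^[s k] p).2 := rfl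
  have h10 : μ * (FC θ f g F p).2 - (F^[s k] p).2 = (-((lam θ ^ s k) - μ)) * (FC θ f g F p).2 +
      lam θ ^ s k * (FC θ f g F p - Qseq θ f g F (s k) p).2 := by
    have := pow_ne_zero (s k) (lam_ne_zero θ)
    rw [Prod.snd_sub, h9]
    field_simp
    ring
  have h11 := (norm_snd_le _).trans_lt h7
  rw [Prod.snd_sub, h10]
  refine (norm_add_le _ _).trans_lt ?_
  rw [norm_lam_pow_mul, norm_mul, norm_neg]
  have h12 : ‖lam θ ^ s k - μ‖ * ‖(FC θ f g F p).2‖ ≤ ε / 2 / (|B| + 1) * (|B| + 1) := by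
    gcongr
    linarith [h3 p hp, le_abs_self B]
  rw [div_mul_cancel₀ _ hB.ne'] at h12
  linarith

theorem Form.Om_subset_fatouSet (hD : HasDiophantineExponent θ r) (hF : Form θ f g F a b)
    (hA : IsAutomorphism F) : Om F ⊆ fatouSet F := by
  intro p hp
  obtain ⟨W, hW, hpW, -, h1, h2, ⟨B, hB⟩, -⟩ := hF.exists_nhd hD hA hp
  refine ⟨W, hW, hpW, fun s => ?_⟩
  obtain ⟨σ, hσ, ⟨m, hm⟩ | h⟩ := exists_strictMono_const_or_tendsto s
  · refine ⟨σ, hσ, Or.inl ⟨F^[m], ?_⟩⟩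
    simp only [hm]
    exact fun u hu x _ => ⟨univ, univ_mem, Eventually.of_forall fun _ y _ => refl_mem_uniformity hu⟩
  · obtain ⟨μ, -, σ', hσ', hμ⟩ := exists_tendsto_lam_pow θ (s ∘ σ)
    exact ⟨σ ∘ σ', hσ.comp hσ', Or.inl ⟨_, (tendstoUniformlyOn_iterate h1 h2 hB
      (h.comp hσ'.tendsto_atTop) hμ).tendstoLocallyUniformlyOn⟩⟩

/-- At a point of the Fatou set in the closure of the basin, limits of iterates exist near the
point and lie on the `w`-axis. -/
theorem exists_ball_tendstoUniformlyOn (hA : Differentiable ℂ F) (hO : IsOpen (Om F))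
    {p : ℂ × ℂ} (hp : p ∈ fatouSet F) (hpc : p ∈ closure (Om F)) :
    ∃ c, 0 < c ∧ ∀ s : ℕ → ℕ, ∃ σ : ℕ → ℕ, StrictMono σ ∧ ∃ G : ℂ × ℂ → ℂ × ℂ,
      TendstoUniformlyOn (fun k => F^[s (σ k)]) G atTop (Metric.ball p c) ∧
      (Tendsto s atTop atTop → ∀ q ∈ Metric.ball p c, (G q).1 = 0) := by
  obtain ⟨W, hW, hpW, hN⟩ := hp
  obtain ⟨c, hc, hcW⟩ := Metric.nhds_basis_closedBall.mem_iff.1 (hW.mem_nhds hpW)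
  obtain ⟨q, hqb, hqO⟩ := mem_closure_iff.1 hpc _ Metric.isOpen_ball (Metric.mem_ball_self hc)
  have hbW : Metric.ball p c ⊆ W := Metric.ball_subset_closedBall.trans hcW
  refine ⟨c, hc, fun s => ?_⟩
  obtain ⟨σ, hσ, ⟨G, hG⟩ | hdiv⟩ := hN s
  · have hu : TendstoUniformlyOn (fun k => F^[s (σ k)]) G atTop (Metric.ball p c) :=
      ((tendstoLocallyUniformlyOn_iff_forall_isCompact hW).1 hG _ hcW
        (isCompact_closedBall p c)).mono Metric.ball_subset_closedBall
    refine ⟨σ, hσ, G, hu, fun hs => ?_⟩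
    have hGd : DifferentiableOn ℂ G (Metric.ball p c) :=
      differentiableOn_of_tendstoUniformlyOn Metric.isOpen_ball
        (fun k => (differentiable_iterate hA _).differentiableOn) hu
    refine eqOn_zero_ball_of_eqOn_zero_open hGd.fst hO ⟨q, hqO, hqb⟩ fun x hx => ?_
    have h1 := (continuous_fst.tendsto _).comp (hu.tendsto_at hx.2)
    exact tendsto_nhds_unique h1 (hx.1.2.1.comp (hs.comp hσ.tendsto_atTop))
  · exfalso
    obtain ⟨-, h0, B, hB⟩ := hqO
    obtain ⟨B₁, hB₁⟩ := (Metric.isBounded_range_of_tendsto _ h0).exists_norm_le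
    obtain ⟨k, hk⟩ := (hdiv {q} (singleton_subset_iff.2 (hbW hqb)) isCompact_singleton _
      (isCompact_closedBall (0 : ℂ × ℂ) (max B₁ B))).exists
    rw [image_singleton, disjoint_singleton_left, mem_closedBall_zero_iff] at hk
    exact hk (max_le_max (hB₁ _ ⟨_, rfl⟩) (hB _))

theorem Form.hasDerivAt_iterate_fst (hF : Form θ f g F a b) (hA : Differentiable ℂ F) (w : ℂ)
    (n : ℕ) : HasDerivAt (fun z => (F^[n] (z, w)).1) 1 0 := by
  induction n with
  | zero => exact hasDerivAt_id 0
  | succ n ih =>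
    set Γ : ℂ → ℂ × ℂ := fun z => F^[n] (z, w) with hΓ
    have hΓd : Differentiable ℂ Γ := (differentiable_iterate hA n).comp (by fun_prop)
    have h0 : ∀ n, (F^[n] (0, w)).1 = 0 := fun n => by
      induction n with
      | zero => rfl
      | succ n ih =>
        rw [Function.iterate_succ_apply',
          show F^[n] (0, w) = (0, (F^[n] (0, w)).2) from Prod.ext ih rfl, hF.eq]
        simp
    have hG0 : (Γ 0).1 = 0 := h0 n
    have h1 : (fun z => (F^[n + 1] (z, w)).1) =
        fun z => (Γ z).1 * (1 + f (Γ z).2 * (Γ z).1 + (Γ z).1 ^ 2 * a (Γ z)) := by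
      funext z
      rw [Function.iterate_succ_apply']
      change (F ((Γ z).1, (Γ z).2)).1 = _
      rw [hF.eq]
      ring
    have hf := hF.hf
    have ha := hF.ha
    have h2 : Differentiable ℂ
        (fun z => 1 + f (Γ z).2 * (Γ z).1 + (Γ z).1 ^ 2 * a (Γ z)) := by fun_prop
    rw [h1]
    have h3 := ih.mul (h2 0).hasDerivAt
    refine h3.congr_deriv ?_
    rw [hG0]
    ring

theorem Form.mem_Om_of_mem_closure (hF : Form θ f g F a b) (hA : IsAutomorphism F)
    (hO : IsOpen (Om F)) {p : ℂ × ℂ} (hp : p ∈ fatouSet F) (hpc : p ∈ closure (Om F)) :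
    p ∈ Om F := by
  obtain ⟨c, hc, h⟩ := exists_ball_tendstoUniformlyOn hA.differentiable hO hp hpc
  have hpb : p ∈ Metric.ball p c := Metric.mem_ball_self hc
  refine ⟨fun hp0 => ?_, ?_, ?_⟩
  · obtain ⟨σ, hσ, G, hG, h0⟩ := h id
    obtain ⟨k, hk⟩ := (Metric.tendstoUniformlyOn_iff.1 hG (c / 4) (by positivity)).exists
    have hd := hF.hasDerivAt_iterate_fst hA.differentiable p.2 (σ k)
    have hdd : Differentiable ℂ (fun z => (F^[σ k] (z, p.2)).1) :=
      ((differentiable_iterate hA.differentiable (σ k)).comp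
        (f := fun z : ℂ => (z, p.2)) (by fun_prop)).fst
    have h1 := Complex.norm_deriv_le_of_forall_mem_sphere_norm_le (c := 0) (C := c / 4)
      (half_pos hc) hdd.diffContOnCl fun z hz => by
        have hz' : (z, p.2) ∈ Metric.ball p c := by
          rw [mem_ball_iff_norm]
          rw [mem_sphere_zero_iff_norm] at hz
          refine max_lt ?_ ?_
          · simp only [Prod.fst_sub, hp0, sub_zero]; linarith
          · simpa using hc
        have h2 := hk _ hz'
        rw [dist_eq_norm] at h2
        have h3 := (norm_fst_le _).trans h2.le
        rwa [Prod.fst_sub, h0 tendsto_id _ hz', zero_sub, norm_neg] at h3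
    rw [hd.deriv, norm_one, le_div_iff₀ (by positivity)] at h1
    linarith
  · refine tendsto_of_subseq_tendsto fun s hs => ?_
    obtain ⟨σ, hσ, G, hG, h0⟩ := h s
    refine ⟨σ, ?_⟩
    have h1 := (continuous_fst.tendsto _).comp (hG.tendsto_at hpb)
    rwa [h0 hs p hpb] at h1
  · by_contra! hB
    choose s hs using fun k : ℕ => hB k
    obtain ⟨σ, hσ, G, hG, -⟩ := h s
    have h1 := ((continuous_norm.comp continuous_snd).tendsto _).comp (hG.tendsto_at hpb)
    refine not_tendsto_nhds_of_tendsto_atTop ?_ _ h1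
    exact tendsto_atTop_mono (fun k => (hs (σ k)).le)
      (tendsto_natCast_atTop_atTop.comp hσ.tendsto_atTop)

theorem Form.isPreconnected_Om (hD : HasDiophantineExponent θ r) (hF : Form θ f g F a b)
    (hA : IsAutomorphism F) : IsPreconnected (Om F) := by
  obtain ⟨-, -, P, hP, hPm, hl, -⟩ := hF.isBiholomorphism_FC hD hA
  have h : P '' univ = Om F := by
    refine Subset.antisymm hPm.image_subset fun p hp => ⟨_, mem_univ _, hl hp⟩
  rw [← h]
  exact isPreconnected_univ.image P hP.continuousOn

theorem Form.isFatouComponent_Om (hD : HasDiophantineExponent θ r) (hF : Form θ f g F a b)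
    (hA : IsAutomorphism F) : IsFatouComponent F (Om F) := by
  have hO := hF.isOpen_Om hD hA
  have hsub := hF.Om_subset_fatouSet hD hA
  obtain ⟨p, hp, -⟩ := hF.surjOn_FC hD hA 0
  refine ⟨p, hsub hp, Subset.antisymm
    ((hF.isPreconnected_Om hD hA).subset_connectedComponentIn hp hsub) ?_⟩
  refine isPreconnected_connectedComponentIn.subset_of_closure_inter_subset hO
    ⟨p, mem_connectedComponentIn (hsub hp), hp⟩ fun q hq => ?_
  exact hF.mem_Om_of_mem_closure hA hO (connectedComponentIn_subset _ _ hq.2) hq.1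

theorem Form.image_Om (hF : Form θ f g F a b) (hA : IsAutomorphism F) : F '' Om F = Om F := by
  refine Subset.antisymm ?_ fun p hp => ?_
  · rintro _ ⟨p, hp, rfl⟩
    exact (hF.F_mem_Om_iff hA p).2 hp
  · obtain ⟨q, rfl⟩ := hA.surjective p
    exact ⟨q, (hF.F_mem_Om_iff hA q).1 hp, rfl⟩

theorem isNonRecurrent_Om (F : ℂ × ℂ → ℂ × ℂ) : IsNonRecurrent F (Om F) := by
  intro p hp S hS hSc
  have h1 : (Prod.fst '' S)ᶜ ∈ 𝓝 (0 : ℂ) := by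
    refine (hSc.image continuous_fst).isClosed.isOpen_compl.mem_nhds ?_
    rintro ⟨q, hq, hq0⟩
    exact (hS hq).1 hq0
  filter_upwards [hp.2.1 h1] with n hn hmem
  exact hn ⟨_, hmem, rfl⟩

theorem Form.omegaLimitSet_Om (hD : HasDiophantineExponent θ r) (hF : Form θ f g F a b)
    (hA : IsAutomorphism F) : omegaLimitSet F (Om F) = wAxis := by
  refine Subset.antisymm ?_ fun q hq => ?_
  · rintro q ⟨p, hp, hq⟩
    obtain ⟨ψ, hψ, h⟩ := hq.tendsto_subseq
    exact tendsto_nhds_unique ((continuous_fst.tendsto _).comp h)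
      (hp.2.1.comp hψ.tendsto_atTop)
  · obtain ⟨μ, hμ0, σ, hσ, hμ⟩ := exists_tendsto_lam_pow θ id
    obtain ⟨p, hp, hpq⟩ := hF.surjOn_FC hD hA (0, μ⁻¹ * q.2)
    obtain ⟨W, -, hpW, -, h1, h2, ⟨B, hB⟩, -⟩ := hF.exists_nhd hD hA hp
    have h3 := (tendstoUniformlyOn_iterate h1 h2 hB hσ.tendsto_atTop hμ).tendsto_at hpW
    refine ⟨p, hp, ?_⟩
    have h4 : ((0, μ * (FC θ f g F p).2) : ℂ × ℂ) = q := by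
      rw [hpq, mul_inv_cancel_left₀ hμ0, ← show q.1 = 0 from hq]
    rw [h4] at h3
    exact MapClusterPt.of_comp (φ := σ) hσ.tendsto_atTop h3.mapClusterPt

theorem Form.wAxis_subset_frontier (hD : HasDiophantineExponent θ r) (hF : Form θ f g F a b)
    (hA : IsAutomorphism F) : wAxis ⊆ frontier (Om F) := by
  intro q hq
  rw [(hF.isOpen_Om hD hA).frontier_eq]
  refine ⟨?_, fun h => h.1 hq⟩
  rw [← hF.omegaLimitSet_Om hD hA] at hq
  obtain ⟨p, hp, h⟩ := hq
  rw [mem_closure_iff_nhds]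
  intro s hs
  obtain ⟨n, hn⟩ := (mapClusterPt_iff_frequently.1 h s hs).exists
  exact ⟨_, hn, (hF.iterate_mem_Om_iff hA n p).2 hp⟩

end

/-! ### The approximate Fatou coordinates -/

theorem summable_gam {f : ℂ → ℂ} (hf : Differentiable ℂ f) (r : ℝ) {δ : ℝ} (hδ : 0 ≤ δ) :
    Summable fun l : ℕ => ‖coeff f f (l + 1)‖ * ((l + 1 : ℕ) : ℝ) ^ r * δ ^ (l + 1) := by
  have h := (entSeq_coeff f hf).mul_rpow
    (d := fun l => (((l + 1 : ℕ) : ℝ) ^ r : ℝ) * coeff f f (l + 1)) (B := 1) (r := r) fun l => by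
      rw [norm_mul, Complex.norm_real, Real.norm_of_nonneg (by positivity), one_mul]
  refine (h δ hδ).congr fun l => ?_
  rw [norm_mul, Complex.norm_real, Real.norm_of_nonneg (by positivity)]
  ring

theorem gam_nonneg (f : ℂ → ℂ) {C δ : ℝ} (r : ℝ) (hC : 0 ≤ C) (hδ : 0 ≤ δ) : 0 ≤ gam f C r δ :=
  mul_nonneg hC (tsum_nonneg fun l => by positivity)

theorem gam_mono {f : ℂ → ℂ} (hf : Differentiable ℂ f) {C δ δ' : ℝ} (r : ℝ) (hC : 0 ≤ C)
    (hδ : 0 ≤ δ) (h : δ ≤ δ') : gam f C r δ ≤ gam f C r δ' := by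
  unfold gam
  gcongr with l
  · exact summable_gam hf r hδ
  · exact summable_gam hf r (hδ.trans h)

section

variable {θ r : ℝ} {f g : ℂ → ℂ} {F : ℂ × ℂ → ℂ × ℂ} {a b : ℂ × ℂ → ℂ}

theorem OrbitT.norm_fst_sub_le {M : ℝ} {x : ℂ × ℂ} {y : ℕ → ℂ × ℂ}
    (h : OrbitT θ f g F M x y) (n : ℕ) : ‖(y n).1 - n‖ ≤ ‖x.1‖ + n / 8 := by
  induction n with
  | zero => simp [h.zero]
  | succ n ih =>
    have h1 : (y (n + 1)).1 - (n + 1 : ℕ) =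
        ((y n).1 - n) + ((y (n + 1)).1 - (y n).1 - 1) := by push_cast; ring
    rw [h1]
    refine (norm_add_le _ _).trans ?_
    have := h.fst_sub n
    push_cast
    linarith

theorem OrbitT.re_le {M : ℝ} {x : ℂ × ℂ} {y : ℕ → ℂ × ℂ}
    (h : OrbitT θ f g F M x y) (n : ℕ) : x.1.re ≤ (y n).1.re := by
  induction n with
  | zero => rw [h.zero]
  | succ n ih =>
    have h1 := (abs_le.1 ((Complex.abs_re_le_norm _).trans (h.fst_sub n))).1
    simp only [Complex.sub_re, Complex.one_re] at h1
    linarith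

theorem Core.tendstoUniformlyOn_Qn {Δ M ρ : ℝ} (hD : HasDiophantineExponent θ r)
    (hF : Form θ f g F a b) (hA : IsAutomorphism F) (hC : Core θ f g F Δ M ρ) {B : Set (ℂ × ℂ)}
    (hB : IsCompact B) (hBD : B ⊆ Dom ρ Δ) {Y : ℂ × ℂ → ℕ → ℂ × ℂ}
    (hY : ∀ x ∈ B, OrbitT θ f g F M x (Y x) ∧
      ∀ n : ℕ, ‖ZH θ f g F (Y x) n - FC θ f g F (T θ f g F x)‖ ≤ M / (2 * mm x.1 + n)) :
    TendstoUniformlyOn (fun n x => Qn θ f g F n (Y x n)) (fun x => FC θ f g F (T θ f g F x))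
      atTop B := by
  have hcont : ContinuousOn (fun x => FC θ f g F (T θ f g F x)) B :=
    (hF.differentiableOn_FC hD hA).continuousOn.comp
      ((hC.differentiableOn_T hF).continuousOn.mono
        (hBD.trans (Dom_anti le_rfl (by linarith)))) fun x hx => hC.T_mem_Om hF (hBD hx)
  obtain ⟨b₁, hb₁⟩ := hB.exists_bound_of_continuousOn hcont
  obtain ⟨c, hc⟩ := hB.exists_bound_of_continuousOn continuousOn_id
  set α := A θ f g F with hα
  have hlim : Tendsto (fun n : ℕ => 2 * ‖α‖ * (((b₁ + 1 + ‖α‖) + ‖α‖ * Real.log n) / n) + M / n)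
      atTop (𝓝 0) := by
    have h1 := ((tendsto_const_add_log_div (b₁ + 1 + ‖α‖) ‖α‖).const_mul (2 * ‖α‖)).add
      (tendsto_const_div_atTop_nhds_zero_nat M)
    simpa using h1
  rw [Metric.tendstoUniformlyOn_iff]
  intro ε hε
  filter_upwards [hlim.eventually_lt_const hε, eventually_gt_atTop 0,
    tendsto_natCast_atTop_atTop.eventually_ge_atTop (8 * c)] with n h1 hn hnc x hx
  have hn0 : (0 : ℝ) < n := by exact_mod_cast hn
  obtain ⟨hy, hZ⟩ := hY x hx
  have hm := (hBD hx).1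
  have h5 := hC.five_le
  have hM := hC.M_pos
  set s := (Y x n).1 - n with hs
  have hus : (Y x n).1 = n + s := by rw [hs]; ring
  have hxc : ‖x.1‖ ≤ c := (norm_fst_le x).trans (hc x hx)
  have hs1 : 4 * ‖s‖ ≤ n := by linarith [hy.norm_fst_sub_le n]
  have hlog := norm_log_natCast_add_sub_le hn hs1
  have hlog1 : ‖Complex.log (n + s)‖ ≤ Real.log n + 1 := by
    have h2 := norm_le_insert' (Complex.log (n + s)) (Real.log n : ℂ)
    rw [Complex.norm_real, Real.norm_of_nonneg (Real.log_natCast_nonneg n)] at h2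
    have h3 : ‖s‖ / n ≤ 1 / 4 := by rw [div_le_iff₀ hn0]; linarith
    linarith
  have hZn : ‖ZH θ f g F (Y x) n - FC θ f g F (T θ f g F x)‖ ≤ M / n :=
    (hZ n).trans (by gcongr; linarith)
  have hZ1 : ‖ZH θ f g F (Y x) n - FC θ f g F (T θ f g F x)‖ ≤ 1 := by
    refine (hZ n).trans ?_
    rw [div_le_one (by linarith)]
    linarith [hC.M_le]
  have hsb : ‖s‖ ≤ (b₁ + 1 + ‖α‖) + ‖α‖ * Real.log n := by
    have h2 : s = (ZH θ f g F (Y x) n).1 + α * Complex.log (n + s) := by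
      rw [← hus]
      simp only [ZH, chiInv, Z, hs]
      ring
    have h3 := norm_le_insert' (ZH θ f g F (Y x) n) (FC θ f g F (T θ f g F x))
    have h4 := norm_fst_le (ZH θ f g F (Y x) n)
    have h6 := hb₁ x hx
    rw [h2]
    refine (norm_add_le _ _).trans ?_
    rw [norm_mul]
    have h7 : ‖α‖ * ‖Complex.log (n + s)‖ ≤ ‖α‖ * (Real.log n + 1) := by gcongr
    linarith
  have hQ : Qn θ f g F n (Y x n) - ZH θ f g F (Y x) n =
      (α * (Complex.log (n + s) - (Real.log n : ℂ)), 0) := by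
    rw [← hus]
    simp only [Qn, ZH, chiInv, Z]
    ext
    · simp only [Prod.fst_sub]; ring
    · simp
  have hQn : ‖Qn θ f g F n (Y x n) - ZH θ f g F (Y x) n‖ ≤
      2 * ‖α‖ * (((b₁ + 1 + ‖α‖) + ‖α‖ * Real.log n) / n) := by
    rw [hQ]
    refine norm_prod_le_iff.2 ⟨?_, by
      rw [norm_zero]; exact mul_nonneg (by positivity)
        (div_nonneg ((norm_nonneg _).trans hsb) hn0.le)⟩
    rw [norm_mul]
    calc _ ≤ ‖α‖ * (2 * (‖s‖ / n)) := by gcongr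
      _ = 2 * ‖α‖ * (‖s‖ / n) := by ring
      _ ≤ _ := by gcongr
  rw [dist_comm, dist_eq_norm]
  have := norm_sub_le_norm_sub_add_norm_sub (Qn θ f g F n (Y x n)) (ZH θ f g F (Y x) n)
    (FC θ f g F (T θ f g F x))
  linarith

theorem Form.exists_radius (hD : HasDiophantineExponent θ r) (hF : Form θ f g F a b)
    (hA : IsAutomorphism F) {γ : ℝ → ℝ} {δ : ℝ} (hδ : 0 < δ) (hγ : γ (δ / 4) ≤ γ δ) :
    ∃ ρ₀ : ℝ, 0 < ρ₀ ∧ ∀ R, ρ₀ ≤ R →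
      InjOn (T θ f g F) (U γ R δ) ∧
      (∀ x ∈ U γ R (δ / 4), T θ f g F x ∈ Om F ∧
        ∀ n : ℕ, F^[n] (T θ f g F x) ∈ T θ f g F '' U γ R δ) ∧
      (∀ B ⊆ U γ R (δ / 4), IsCompact B →
        TendstoUniformlyOn (phi θ f g F γ R δ) (fun x => FC θ f g F (T θ f g F x)) atTop B) ∧
      V f γ R (δ / 4) ⊆ Om F := by
  obtain ⟨M, ρ, hC⟩ := hF.exists_core hD (δ + 1)
  obtain ⟨ρ', C, hρ', hC0, hT⟩ := hF.exists_T_eq hD (δ / 4)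
  have hρ5 := hC.five_le
  have hM0 := hC.M_pos
  have hMδ : 0 < 2 * M / δ := by positivity
  refine ⟨ρ + ρ' + 2 * C + 2 * M / δ + 1, by linarith, fun R hR => ?_⟩
  have hUD : U γ R δ ⊆ Dom ρ (δ + 1 + 1) := fun x hx =>
    ⟨by linarith [(mem_K_iff.1 hx.1).2], by linarith [hx.2]⟩
  have hUD' : U γ R (δ / 4) ⊆ Dom ρ (δ + 1) := fun x hx =>
    ⟨by linarith [(mem_K_iff.1 hx.1).2], by linarith [hx.2]⟩
  have hinj := (hC.injOn_T hF).mono hUD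
  choose! Y hY hYD hYZ using hC.orbit
  have hYU : ∀ x ∈ U γ R (δ / 4), ∀ n, Y x n ∈ U γ R δ := by
    intro x hx n
    have hy := hY x (hUD' hx)
    obtain ⟨h1, h2⟩ := mem_K_iff.1 hx.1
    have hn : (0 : ℝ) ≤ n := n.cast_nonneg
    refine ⟨mem_K_iff.2 ⟨by linarith [hy.re_le n], by linarith [hy.mm_le n]⟩, ?_⟩
    have h3 : M / mm x.1 ≤ δ / 2 := by
      rw [div_le_iff₀ (by linarith)]
      have h4 : 2 * M / δ ≤ mm x.1 := by linarith
      rw [div_le_iff₀ hδ] at h4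
      linarith
    linarith [hy.snd_le n, hx.2]
  refine ⟨hinj, fun x hx => ⟨hC.T_mem_Om hF (hUD' hx), fun n => ?_⟩, fun B hBU hB => ?_, ?_⟩
  · rw [(hY x (hUD' hx)).iterate n]
    exact ⟨_, hYU x hx n, rfl⟩
  · refine (hC.tendstoUniformlyOn_Qn hD hF hA hB (hBU.trans hUD')
      fun x hx => ⟨hY x (hUD' (hBU hx)), hYZ x (hUD' (hBU hx))⟩).congr
      (Eventually.of_forall fun n x hx => ?_)
    have hy := hY x (hUD' (hBU hx))
    have hH : ∀ n, (H θ f g F γ R δ)^[n] x = Y x n := by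
      intro n
      induction n with
      | zero => exact hy.zero.symm
      | succ n ih =>
        rw [Function.iterate_succ_apply', ih, H, Function.comp, Function.comp, ← hy.step n]
        exact hinj.leftInvOn_invFunOn (hYU x (hBU hx) (n + 1))
    simp only [phi, Function.comp, hH]
  · rintro _ ⟨y, hy, rfl⟩
    have h2 := (mem_K_iff.1 hy.1).2
    obtain ⟨x, hx, hx1, hx2⟩ := hT y ⟨by linarith, hy.2⟩
    rw [← hx]
    refine hC.T_mem_Om hF ⟨?_, by linarith⟩
    have h3 := (abs_le.1 (mm_add y.1 (x.1 - y.1))).1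
    rw [add_sub_cancel] at h3
    linarith

theorem Form.Om_eq_iUnion_preimage (hD : HasDiophantineExponent θ r) (hF : Form θ f g F a b)
    (hA : IsAutomorphism F) {γ : ℝ → ℝ} {δ R : ℕ → ℝ} (hγ : ∀ m, 0 ≤ γ (δ m / 4))
    (hδ : Tendsto δ atTop atTop) (hV : ∀ m, V f γ (R m) (δ m / 4) ⊆ Om F) :
    absorbingSet f F γ R δ ⊆ Om F ∧ Om F = ⋃ n : ℕ, F^[n] ⁻¹' absorbingSet f F γ R δ := by
  have hsub : absorbingSet f F γ R δ ⊆ Om F := by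
    simp only [absorbingSet, iUnion_subset_iff]
    rintro n m _ ⟨p, hp, rfl⟩
    exact (hF.iterate_mem_Om_iff hA n p).2 (hV m hp)
  refine ⟨hsub, Subset.antisymm (fun p hp => ?_) ?_⟩
  · obtain ⟨B, hB⟩ := hp.2.2
    obtain ⟨m, hm⟩ := (hδ.eventually_gt_atTop (4 * B)).exists
    obtain ⟨n, hn⟩ := ((hF.tendsto_re_of_mem_Om hD hA hp).eventually_gt_atTop
      (max (R m) 0)).exists
    refine mem_iUnion.2 ⟨n, mem_iUnion.2 ⟨0, mem_iUnion.2 ⟨m, F^[n] p, ?_, rfl⟩⟩⟩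
    refine ⟨ThetaInv f (F^[n] p), ⟨mem_K_iff.2 ⟨?_, ?_⟩, ?_⟩, Theta_ThetaInv hF.f0 _⟩
    · linarith [le_max_right (R m) 0, hγ m]
    · rw [mm]
      linarith [le_max_left (R m) 0, abs_nonneg (ThetaInv f (F^[n] p)).1.im]
    · have : (ThetaInv f (F^[n] p)).2 = (F^[n] p).2 := rfl
      rw [this]
      linarith [hB n]
  · refine iUnion_subset fun n p hp => ?_
    exact (hF.iterate_mem_Om_iff hA n p).1 (hsub hp)

theorem Form.exists_mem_image_U (hD : HasDiophantineExponent θ r) (hF : Form θ f g F a b)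
    (hA : IsAutomorphism F) {γ : ℝ → ℝ} (hγ : ∀ δ, 0 < δ → 0 ≤ γ δ) {p : ℂ × ℂ} (hp : p ∈ Om F) :
    ∃ δ : ℝ, 0 < δ ∧ ∀ R : ℝ, ∃ n : ℕ, F^[n] p ∈ T θ f g F '' U γ R (δ / 4) := by
  obtain ⟨B, hB, h⟩ := hF.exists_deep hD hA hp
  refine ⟨4 * B, by positivity, fun R => ?_⟩
  obtain ⟨n, x, hx, hxT⟩ := (h (max R 0)).exists
  refine ⟨n, x, ⟨mem_K_iff.2 ⟨?_, ?_⟩, ?_⟩, hxT⟩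
  · linarith [le_max_right R 0, hγ (4 * B / 4) (by positivity), hx.1]
  · rw [mm]
    linarith [le_max_left R 0, abs_nonneg x.1.im, hx.1]
  · rw [mul_div_cancel_left₀ B (by norm_num)]
    exact hx.2

end

end ParabolicCylinder

end

theorem mainTheorem3 (θ : ℝ) (hθ : ParabolicCylinder.IsDiophantine θ)
    (f g : ℂ → ℂ) (F : ℂ × ℂ → ℂ × ℂ)
    (hF : ParabolicCylinder.IsAutomorphism F)
    (hform : ParabolicCylinder.HasForm θ f g F) :
    ∃ Ω : Set (ℂ × ℂ),
      -- the invariant non-recurrent Fatou component, with its limit set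
      ParabolicCylinder.IsFatouComponent F Ω ∧
      F '' Ω = Ω ∧
      ParabolicCylinder.IsNonRecurrent F Ω ∧
      ParabolicCylinder.omegaLimitSet F Ω = ParabolicCylinder.wAxis ∧
      ParabolicCylinder.wAxis ⊆ frontier Ω ∧
      ∃ Q : ℂ × ℂ → ℂ × ℂ,
        -- the Fatou coordinate
        ParabolicCylinder.IsUnivalentOn Q Ω ∧
        ParabolicCylinder.IsBiholomorphism Q Ω Set.univ ∧
        (∀ p ∈ Ω, Q (F p) = ParabolicCylinder.chi θ (Q p)) ∧
        -- for every admissible choice of the function `γ` that shapes the regions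
        ∀ C r : ℝ, 1 < C → 0 < r → ParabolicCylinder.HasDiophantineExponent θ r →
          (∀ w : ℂ, ‖ParabolicCylinder.q θ f w‖ ≤ ParabolicCylinder.gam f C r ‖w‖) →
          ∃ R₀ : ℝ → ℝ, (∀ δ : ℝ, 0 < δ → 0 < R₀ δ) ∧
            -- every absorbing set lies in `Ω`, and its backward images exhaust `Ω`
            (∀ δ R : ℕ → ℝ, (∀ m, 0 < δ m) → Monotone δ →
              Filter.Tendsto δ Filter.atTop Filter.atTop →
              Monotone R → (∀ m, R₀ (δ m) ≤ R m) →
              ParabolicCylinder.absorbingSet f F (ParabolicCylinder.gam f C r) R δ ⊆ Ω ∧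
              Ω = ⋃ n : ℕ,
                F^[n] ⁻¹' ParabolicCylinder.absorbingSet f F (ParabolicCylinder.gam f C r) R δ) ∧
            -- in the coordinates `T`, the iterates of `H` are well defined and `Q` is the limit
            -- of the approximate Fatou coordinates
            (∀ δ : ℝ, 0 < δ → ∀ R : ℝ, R₀ δ ≤ R →
              Set.InjOn (ParabolicCylinder.T θ f g F)
                (ParabolicCylinder.U (ParabolicCylinder.gam f C r) R δ) ∧
              (∀ x ∈ ParabolicCylinder.U (ParabolicCylinder.gam f C r) R (δ / 4),
                ParabolicCylinder.T θ f g F x ∈ Ω ∧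
                ∀ n : ℕ, F^[n] (ParabolicCylinder.T θ f g F x) ∈
                  ParabolicCylinder.T θ f g F ''
                    ParabolicCylinder.U (ParabolicCylinder.gam f C r) R δ) ∧
              ∀ B ⊆ ParabolicCylinder.U (ParabolicCylinder.gam f C r) R (δ / 4), IsCompact B →
                TendstoUniformlyOn
                  (ParabolicCylinder.phi θ f g F (ParabolicCylinder.gam f C r) R δ)
                  (fun x => Q (ParabolicCylinder.T θ f g F x)) Filter.atTop B) ∧
            -- every orbit in `Ω` enters the region where `Q` is given by this limit
            (∀ p ∈ Ω, ∃ δ : ℝ, 0 < δ ∧ ∀ R : ℝ, R₀ δ ≤ R →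
              ∃ n : ℕ, F^[n] p ∈ ParabolicCylinder.T θ f g F ''
                ParabolicCylinder.U (ParabolicCylinder.gam f C r) R (δ / 4)) := by
  obtain ⟨r₀, -, hD⟩ := hθ.2
  obtain ⟨a, b, hf⟩ := hform.exists_form
  refine ⟨ParabolicCylinder.Om F, hf.isFatouComponent_Om hD hF, hf.image_Om hF,
    ParabolicCylinder.isNonRecurrent_Om F, hf.omegaLimitSet_Om hD hF,
    hf.wAxis_subset_frontier hD hF, ParabolicCylinder.FC θ f g F,
    ⟨hf.differentiableOn_FC hD hF, hf.injOn_FC hD hF⟩, hf.isBiholomorphism_FC hD hF,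
    fun p hp => hf.FC_F hD hF hp, fun C r hC _ _ _ => ?_⟩
  have hC0 : 0 ≤ C := by linarith
  have hγ : ∀ δ : ℝ, 0 < δ → 0 ≤ ParabolicCylinder.gam f C r δ := fun δ hδ =>
    ParabolicCylinder.gam_nonneg f r hC0 hδ.le
  choose! R₀ hR₀ hR using fun (δ : ℝ) (hδ : 0 < δ) => hf.exists_radius hD hF hδ
    (ParabolicCylinder.gam_mono hf.hf r hC0 (by positivity : 0 ≤ δ / 4) (by linarith))
  refine ⟨R₀, hR₀, fun δ R hδ _ hδt _ hRm => ?_, fun δ hδ R hRδ => ?_, fun p hp => ?_⟩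
  · exact hf.Om_eq_iUnion_preimage hD hF (fun m => hγ _ (by linarith [hδ m])) hδt
      fun m => (hR (δ m) (hδ m) (R m) (hRm m)).2.2.2
  · obtain ⟨h1, h2, h3, -⟩ := hR δ hδ R hRδ
    exact ⟨h1, h2, h3⟩
  · obtain ⟨δ, hδ, h⟩ := hf.exists_mem_image_U hD hF hγ hp
    exact ⟨δ, hδ, fun R _ => h R⟩
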